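/- Let $d\ge 0$, $q\in(0,1)$, $\beta_0\in\mathcal B\subseteq\mathbb R^d$, and let $(X_j,Z_j,Y_j)$, $j\ge 1$, be iid with $X_j,Z_j\in\mathbb R^d$ and $Y_j=X_j'\beta_0+U_j\in\mathbb R$. Write $(X,Z,Y,U)$ for a generic copy. Let $h=h_n>0$, $h_n\to0$, and let $G:\mathbb R\to\mathbb R$. Put $$m_n(\beta)=n^{-1/2}\sum_{j=1}^n Z_j\Big[G\Big(\frac{X_j'\beta-Y_j}{h}\Big)-q\Big],\qquad J_n=\mathbb E\Big[\frac{\partial}{\partial\beta'}\frac1{\sqrt n}m_n(\beta_0)\Big],\qquad L_n=-J_n^{-1}m_n(\beta_0).$$ A smoothed estimating equations (SEE) estimator is any $\hat\beta=\hat\beta_n$ that, with probability tending to one, satisfies $\hat\beta\in\mathcal B$ and $m_n(\hat\beta)=0$. The Nagar-type approximate MSE (AMSE) of $\sqrt n(\hat\beta-\beta_0)$ is the second-moment matrix $\mathbb E(L_nL_n')=J_n^{-1}\,\mathbb E[m_n(\beta_0)m_n(\beta_0)']\,(J_n^{-1})'$ of its leading term $L_n$. Assume, for an integer $r>2$: 1.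 $\mathbb E[Z(1\{U<0\}-q)]=0$; $Z$ has bounded support and $\mathbb E(ZZ')$ is nonsingular. 2. $P(U<0\mid Z=z)=q$ for almost all $z$. For $u$ in a neighborhood of $0$ and almost all $z$, the conditional density $f_{U|Z}(u\mid z)$ exists, is bounded away from $0$, is $r$ times continuously differentiable in $u$, and $|f^{(s)}_{U|Z}(u\mid z)|\le C_0(z)$ for $s=0,2,3,\dots,r$, where $\mathbb E[C_0(Z)\|Z\|]<\infty$ and $\mathbb E[C_0(Z)\|Z\|^2]<\infty$. 3. $G$ is Lipschitz (absolutely continuous with bounded derivative $G'$), $G(v)=0$ for $v\le-1$, $G(v)=1$ for $v\ge1$, $1-\int_{-1}^1G^2(u)\,du>0$, $G'$ is symmetric, $\int_{-1}^1G'(v)\,dv=1$, $\int_{-1}^1v^kG'(v)\,dv=0$ for $1\le k\le r-1$, and $\int_{-1}^1v^rG'(v)\,dv\ne0$. 4. $\beta=\beta_0$ is the unique solution in $\mathcal B$ of $\mathbb E[Z(q-1\{Y<X'\beta\})]=0$. 5. For $u$ in a neighborhood of $0$ and almost all $(z,x)$, the conditional density $f_{U|Z,X}(u\mid z,x)$ exists,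 is $r$ times continuously differentiable in $u$, and $|f^{(s)}_{U|Z,X}(u\mid z,x)|\le C(z,x)$ for $0\le s\le r$, where $\mathbb E[C(Z,X)\|Z\|\|X\|]<\infty$; the matrix $\Sigma_{ZX}=\mathbb E[ZX'f_{U|Z,X}(0\mid Z,X)]$ is nonsingular. 6. $nh^r\to\infty$ and $n^3h^{4r+1}\to\infty$. Let $V=q(1-q)\mathbb E(ZZ')$, let $V^{1/2}$ be any matrix with $V^{1/2}(V^{1/2})'=V$, and let $V^{-1/2}=(V^{1/2})^{-1}$ and $$A=\Big[1-\int_{-1}^1G^2(u)\,du\Big]^{1/2}\big[f_{U|Z}(0\mid Z)\big]^{1/2}V^{-1/2}Z,\qquad B=\Big[\frac1{r!}\int_{-1}^1G'(v)v^r\,dv\Big]f^{(r-1)}_{U|Z}(0\mid Z)\,V^{-1/2}Z.$$ Then for all large $n$ the matrix $J_n$ is well defined and invertible and $\mathbb E\|L_n\|^2<\infty$, and the AMSE of $\sqrt n(\hat\beta-\beta_0)$ is $$\Sigma_{ZX}^{-1}V^{1/2}\big[I_d+nh^{2r}\,\mathbb E(B)\mathbb E(B)'-h\,\mathbb E(AA')\big](V^{1/2})'(\Sigma_{ZX}')^{-1}+O(h^r)+o(h+nh^{2r}).$$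 Moreover, if $\mathcal B$ is compact, $P(Y=X'\beta)=0$ for every $\beta\in\mathcal B$, $\mathbb E\|X\|^3<\infty$ and $\mathbb E[C(Z,X)\|Z\|\|X\|^3]<\infty$, then for every SEE estimator the part of $\sqrt n(\hat\beta-\beta_0)$ that the AMSE drops is of smaller order: $$\sqrt n(\hat\beta-\beta_0)=L_n+o_p(h+nh^{2r}).$$ -/

import Mathlib

open MeasureTheory ProbabilityTheory Filter Topology Asymptotics
open scoped ENNReal Matrix

noncomputable section

namespace SEE

/-- `ℝᵈ` with the Euclidean norm. -/
abbrev Vec (d : ℕ) := EuclideanSpace ℝ (Fin d)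

variable {Ω : Type*} [MeasurableSpace Ω] {d : ℕ}

/-! ### Smoothed estimating equations -/

/-- The regression error `U_j = Y_j - X_j' β₀`. -/
def err (X : ℕ → Ω → Vec d) (Y : ℕ → Ω → ℝ) (β₀ : Vec d) (j : ℕ) (ω : Ω) : ℝ :=
  Y j ω - inner ℝ (X j ω) β₀

/-- The smoothed estimating function for sample size `n` and bandwidth `h`:
`m_n(β) = n^{-1/2} ∑_{j=1}^n Z_j [G((X_j'β - Y_j)/h) - q]`. -/
def ee (q : ℝ) (G : ℝ → ℝ) (X Z : ℕ → Ω → Vec d) (Y : ℕ → Ω → ℝ)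
    (n : ℕ) (h : ℝ) (β : Vec d) (ω : Ω) : Vec d :=
  (√(n : ℝ))⁻¹ • ∑ j ∈ Finset.range n,
    (G ((inner ℝ (X j ω) β - Y j ω) / h) - q) • Z j ω

/-- The random `d × d` Jacobian `∂/∂β' (n^{-1/2} m_n)(β₀)`, entry by entry as partial
derivatives. -/
def jacobian (q : ℝ) (G : ℝ → ℝ) (X Z : ℕ → Ω → Vec d) (Y : ℕ → Ω → ℝ) (β₀ : Vec d)
    (n : ℕ) (h : ℝ) (ω : Ω) : Matrix (Fin d) (Fin d) ℝ :=
  Matrix.of fun a b =>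
    lineDeriv ℝ (fun β : Vec d => (√(n : ℝ))⁻¹ * ee q G X Z Y n h β ω a) β₀
      (EuclideanSpace.single b 1)

/-- `E[∂/∂β' (n^{-1/2} m_n)(β₀)]`. -/
def meanJacobian (P : Measure Ω) (q : ℝ) (G : ℝ → ℝ) (X Z : ℕ → Ω → Vec d) (Y : ℕ → Ω → ℝ)
    (β₀ : Vec d) (n : ℕ) (h : ℝ) : Matrix (Fin d) (Fin d) ℝ :=
  Matrix.of fun a b => ∫ ω, jacobian q G X Z Y β₀ n h ω a b ∂P

/-- The leading term `-{E[∂/∂β' (n^{-1/2} m_n)(β₀)]}⁻¹ m_n(β₀)` of `√n (β̂ - β₀)`. -/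
def leadingTerm (P : Measure Ω) (q : ℝ) (G : ℝ → ℝ) (X Z : ℕ → Ω → Vec d) (Y : ℕ → Ω → ℝ)
    (β₀ : Vec d) (n : ℕ) (h : ℝ) (ω : Ω) : Vec d :=
  WithLp.toLp 2
    (-((meanJacobian P q G X Z Y β₀ n h)⁻¹ *ᵥ (ee q G X Z Y n h β₀ ω).ofLp))

/-- The Nagar-type approximate MSE of `√n (β̂ - β₀)`: the second-moment matrix
`E[L_n L_n']` of the leading term `L_n`. -/
def amse (P : Measure Ω) (q : ℝ) (G : ℝ → ℝ) (X Z : ℕ → Ω → Vec d) (Y : ℕ → Ω → ℝ)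
    (β₀ : Vec d) (n : ℕ) (h : ℝ) : Matrix (Fin d) (Fin d) ℝ :=
  Matrix.of fun a b => ∫ ω,
    leadingTerm P q G X Z Y β₀ n h ω a * leadingTerm P q G X Z Y β₀ n h ω b ∂P

/-- `T_n = o_p(δ_n)`. -/
def IsLittleOP (P : Measure Ω) (T : ℕ → Ω → Vec d) (δ : ℕ → ℝ) : Prop :=
  ∀ η : ℝ, 0 < η → Tendsto (fun n => P {ω | η * δ n < ‖T n ω‖}) atTop (𝓝 0)

/-- `β̂` is a smoothed estimating equations estimator over the parameter set `𝓑`: with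
probability tending to one it lies in `𝓑` and solves `m_n(β̂) = 0`. -/
def IsSEEEstimator (P : Measure Ω) (q : ℝ) (G : ℝ → ℝ) (X Z : ℕ → Ω → Vec d)
    (Y : ℕ → Ω → ℝ) (h : ℕ → ℝ) (𝓑 : Set (Vec d)) (βhat : ℕ → Ω → Vec d) : Prop :=
  Tendsto (fun n => P {ω | ¬ (βhat n ω ∈ 𝓑 ∧ ee q G X Z Y n (h n) (βhat n ω) ω = 0)})
    atTop (𝓝 0)

/-! ### Population quantities -/

/-- `E(Z Z')`. -/
def secondMoment (P : Measure Ω) (Z : ℕ → Ω → Vec d) : Matrix (Fin d) (Fin d) ℝ :=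
  Matrix.of fun a b => ∫ ω, Z 0 ω a * Z 0 ω b ∂P

/-- `V = q(1-q) E(Z Z')`. -/
def asympVar (P : Measure Ω) (q : ℝ) (Z : ℕ → Ω → Vec d) : Matrix (Fin d) (Fin d) ℝ :=
  (q * (1 - q)) • secondMoment P Z

/-- `Σ_ZX = E[Z X' f_{U|Z,X}(0 | Z, X)]`, where `g (z, x) u = f_{U|Z,X}(u | z, x)`. -/
def sigmaZX (P : Measure Ω) (X Z : ℕ → Ω → Vec d) (g : Vec d × Vec d → ℝ → ℝ) :
    Matrix (Fin d) (Fin d) ℝ :=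
  Matrix.of fun a b => ∫ ω, Z 0 ω a * X 0 ω b * g (Z 0 ω, X 0 ω) 0 ∂P

/-- `A = [1 - ∫_{-1}^1 G²]^{1/2} [f_{U|Z}(0 | Z)]^{1/2} V^{-1/2} Z`, where `S` is the chosen
square root `V^{1/2}` and `f z u = f_{U|Z}(u | z)`. -/
def vecA (G : ℝ → ℝ) (Z : ℕ → Ω → Vec d) (f : Vec d → ℝ → ℝ)
    (S : Matrix (Fin d) (Fin d) ℝ) (ω : Ω) : Fin d → ℝ :=
  (√(1 - ∫ u in (-1 : ℝ)..1, G u ^ 2) * √(f (Z 0 ω) 0)) • (S⁻¹ *ᵥ (Z 0 ω).ofLp)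

/-- `B = [(1/r!) ∫_{-1}^1 G'(v) v^r dv] f_{U|Z}^{(r-1)}(0 | Z) V^{-1/2} Z`. -/
def vecB (r : ℕ) (G : ℝ → ℝ) (Z : ℕ → Ω → Vec d) (f : Vec d → ℝ → ℝ)
    (S : Matrix (Fin d) (Fin d) ℝ) (ω : Ω) : Fin d → ℝ :=
  (1 / (r.factorial : ℝ) * (∫ v in (-1 : ℝ)..1, deriv G v * v ^ r)
    * iteratedDeriv (r - 1) (f (Z 0 ω)) 0) • (S⁻¹ *ᵥ (Z 0 ω).ofLp)

/-- `E(A A')`. -/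
def meanAA (P : Measure Ω) (G : ℝ → ℝ) (Z : ℕ → Ω → Vec d) (f : Vec d → ℝ → ℝ)
    (S : Matrix (Fin d) (Fin d) ℝ) : Matrix (Fin d) (Fin d) ℝ :=
  Matrix.of fun a b => ∫ ω, vecA G Z f S ω a * vecA G Z f S ω b ∂P

/-- `E(B)`. -/
def meanB (P : Measure Ω) (r : ℕ) (G : ℝ → ℝ) (Z : ℕ → Ω → Vec d) (f : Vec d → ℝ → ℝ)
    (S : Matrix (Fin d) (Fin d) ℝ) : Fin d → ℝ :=
  fun a => ∫ ω, vecB r G Z f S ω a ∂P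

/-! ### Assumptions -/

/-- On `(-ε, ε)`, `f w` is a probability density of the conditional law of `U` given
`W = w`, for almost every value `w` of `W`. -/
def HasCondDensityNear {𝓦 : Type*} [MeasurableSpace 𝓦] (P : Measure Ω) [IsFiniteMeasure P]
    (U : Ω → ℝ) (W : Ω → 𝓦) (f : 𝓦 → ℝ → ℝ) (ε : ℝ) : Prop :=
  ∀ᵐ w ∂(P.map W), (∀ u ∈ Set.Ioo (-ε) ε, 0 ≤ f w u) ∧
    ∀ s : Set ℝ, MeasurableSet s → s ⊆ Set.Ioo (-ε) ε →
      condDistrib U W P w s = ∫⁻ u in s, ENNReal.ofReal (f w u)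

/-- Sampling: `(X_j, Z_j, Y_j)` is iid and `E[Z (1{U < 0} - q)] = 0`. -/
structure Sampling (P : Measure Ω) (q : ℝ) (X Z : ℕ → Ω → Vec d) (Y : ℕ → Ω → ℝ)
    (β₀ : Vec d) : Prop where
  measurable_X : ∀ j, Measurable (X j)
  measurable_Z : ∀ j, Measurable (Z j)
  measurable_Y : ∀ j, Measurable (Y j)
  indep : iIndepFun (fun j ω => (X j ω, Z j ω, Y j ω)) P
  identDistrib : ∀ j, IdentDistrib (fun ω => (X j ω, Z j ω, Y j ω))
    (fun ω => (X 0 ω, Z 0 ω, Y 0 ω)) P P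
  moment : ∫ ω, (Set.indicator {ω' | err X Y β₀ 0 ω' < 0} 1 ω - q) • Z 0 ω ∂P = 0

/-- Instruments: bounded support and nonsingular second-moment matrix. -/
structure Instruments (P : Measure Ω) (Z : ℕ → Ω → Vec d) : Prop where
  bounded : ∃ M : ℝ, ∀ᵐ ω ∂P, ‖Z 0 ω‖ ≤ M
  nonsingular : IsUnit (secondMoment P Z).det

/-- Conditional law of `U` given `Z`; `f z u = f_{U|Z}(u | z)`. -/
structure CondLawGivenZ (P : Measure Ω) [IsFiniteMeasure P] (q : ℝ) (r : ℕ)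
    (X Z : ℕ → Ω → Vec d) (Y : ℕ → Ω → ℝ) (β₀ : Vec d) (f : Vec d → ℝ → ℝ) : Prop where
  quantile : ∀ᵐ z ∂(P.map (Z 0)),
    condDistrib (err X Y β₀ 0) (Z 0) P z (Set.Iio 0) = ENNReal.ofReal q
  smooth : ∃ ε : ℝ, 0 < ε ∧ HasCondDensityNear P (err X Y β₀ 0) (Z 0) f ε ∧
    (∀ᵐ z ∂(P.map (Z 0)), ∃ c : ℝ, 0 < c ∧ ∀ u ∈ Set.Ioo (-ε) ε, c ≤ f z u) ∧
    (∀ᵐ z ∂(P.map (Z 0)), ContDiffOn ℝ r (f z) (Set.Ioo (-ε) ε)) ∧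
    ∃ C : Vec d → ℝ,
      (∀ᵐ z ∂(P.map (Z 0)), ∀ s ≤ r, s ≠ 1 → ∀ u ∈ Set.Ioo (-ε) ε,
        |iteratedDeriv s (f z) u| ≤ C z) ∧
      Integrable (fun ω => C (Z 0 ω) * ‖Z 0 ω‖) P ∧
      Integrable (fun ω => C (Z 0 ω) * ‖Z 0 ω‖ ^ 2) P

/-- Smoothing function. `G` is Lipschitz, that is, absolutely continuous with a bounded
derivative `G'` (which exists almost everywhere), and `G'` is a symmetric `r`th order kernel
supported in `[-1, 1]`. -/
structure SmoothingFunction (r : ℕ) (G : ℝ → ℝ) : Prop where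
  eq_zero : ∀ v ≤ -1, G v = 0
  eq_one : ∀ v, 1 ≤ v → G v = 1
  variance_reduction : 0 < 1 - ∫ u in (-1 : ℝ)..1, G u ^ 2
  lipschitz : ∃ K, LipschitzWith K G
  symmetric : ∀ v, deriv G (-v) = deriv G v
  integral_one : ∫ v in (-1 : ℝ)..1, deriv G v = 1
  moments_zero : ∀ k : ℕ, 1 ≤ k → k ≤ r - 1 → ∫ v in (-1 : ℝ)..1, v ^ k * deriv G v = 0
  moment_ne_zero : ∫ v in (-1 : ℝ)..1, v ^ r * deriv G v ≠ 0

/-- Identification: over `β ∈ 𝓑`, `E[Z (q - 1{Y < X'β})] = 0` exactly for `β = β₀`. -/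
structure Identification (P : Measure Ω) (q : ℝ) (X Z : ℕ → Ω → Vec d) (Y : ℕ → Ω → ℝ)
    (β₀ : Vec d) (𝓑 : Set (Vec d)) : Prop where
  mem : β₀ ∈ 𝓑
  unique : ∀ β ∈ 𝓑,
    (∫ ω, (q - Set.indicator {ω' | Y 0 ω' < inner ℝ (X 0 ω') β} 1 ω) • Z 0 ω ∂P = 0) ↔ β = β₀

/-- Conditional law of `U` given `(Z, X)`; `g (z, x) u = f_{U|Z,X}(u | z, x)`, and `C (z, x)`
dominates its derivatives near `0`. -/
structure CondLawGivenZX (P : Measure Ω) [IsFiniteMeasure P] (r : ℕ)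
    (X Z : ℕ → Ω → Vec d) (Y : ℕ → Ω → ℝ) (β₀ : Vec d) (g : Vec d × Vec d → ℝ → ℝ)
    (C : Vec d × Vec d → ℝ) : Prop where
  order : 2 < r
  smooth : ∃ ε : ℝ, 0 < ε ∧
    HasCondDensityNear P (err X Y β₀ 0) (fun ω => (Z 0 ω, X 0 ω)) g ε ∧
    (∀ᵐ w ∂(P.map fun ω => (Z 0 ω, X 0 ω)), ContDiffOn ℝ r (g w) (Set.Ioo (-ε) ε)) ∧
    (∀ᵐ w ∂(P.map fun ω => (Z 0 ω, X 0 ω)), ∀ s ≤ r, ∀ u ∈ Set.Ioo (-ε) ε,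
      |iteratedDeriv s (g w) u| ≤ C w)
  dominated : Integrable (fun ω => C (Z 0 ω, X 0 ω) * ‖Z 0 ω‖ * ‖X 0 ω‖) P
  nonsingular : IsUnit (sigmaZX P X Z g).det

/-- Regularity under which the remainder of the linearization of the estimator is controlled:
`𝓑` is compact, the law of `(X, Y)` puts no mass on `{Y = X'β}`, and third moments of
`X` are finite. -/
structure RemainderRegularity (P : Measure Ω) (X Z : ℕ → Ω → Vec d) (Y : ℕ → Ω → ℝ)
    (𝓑 : Set (Vec d)) (C : Vec d × Vec d → ℝ) : Prop where
  compact : IsCompact 𝓑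
  no_mass : ∀ β ∈ 𝓑, P {ω | Y 0 ω = inner ℝ (X 0 ω) β} = 0
  third_moment : Integrable (fun ω => ‖X 0 ω‖ ^ 3) P
  third_moment_dominated :
    Integrable (fun ω => C (Z 0 ω, X 0 ω) * ‖Z 0 ω‖ * ‖X 0 ω‖ ^ 3) P

end SEE

end

noncomputable section

namespace SEE

/-! ### The smoothing function -/

namespace SmoothingFunction

variable {r : ℕ} {G : ℝ → ℝ}

/-! Put s = Z(G(-U/h) - q) for a generic score at `β₀`. For iid scores E[m_n m_n'] = E[ss'] + (n-1)
E[s]E[s]' (`integral_ee_mul_ee`), so the AMSE expansion needs only E[s], E[ss'] and `J_n`. Split G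
into the indicator 1{v > 0} and the `defect`. By the quantile restriction the indicator part of the
score has conditional mean zero given Z and second moment V. What is left lives on |U| ≤ h. There
the substitution u = -hv and a Taylor expansion of the conditional density reduce everything to
moments of a kernel on [-1, 1] (`tendsto_inv_mul_integral_kernel`). The moments of the defect are
those of G' shifted by one degree, so it annihilates polynomials of degree below r - 1, and E[s] =
(-h)^r V^{1/2} E(B) + o(h^r). For E[ss'] the kernel is (G - q)² - (1{v > 0} - q)²; its integral is
-(1 - ∫G²) ≠ 0, which gives the correction of order h. As G' is an r-th order kernel, J_n = Σ_ZX +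
O(h^r) (`exists_slope_bound`). `amse_expansion` combines the three.

For the remainder put Δ = β̂ - β₀. When m_n(β̂) = 0, the vector J_n(√n Δ - L_n) is, up to sign, the
sum of the curvature of the mean score, √n O(‖Δ‖²), and the centred fluctuation of m_n(β̂) -
m_n(β₀). Both are small once β̂ is localized. Let x = n^{1/26}. A Bernstein bound on a polynomially
large grid (`tendsto_measure_uniform_deviation`) puts the averaged scores within x^{-12} of their
means uniformly on a ball. Identification and compactness (`exists_le_meanScore`) then force β̂ near
β₀, and inverting the linearized mean score gives ‖Δ‖ = O(x^{-12} + h^r). On that shrinking ball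
score increments have second moment O(‖Δ‖²/h) (`exists_increment_bounds`), and the same deviation
bound makes their fluctuation o(h + nh^{2r}). The bandwidth enters through h ≥ x^{-6}, a consequence
of n³h^{4r+1} → ∞.

G is only Lipschitz, so G' exists almost everywhere: integrations by parts rest on absolute
continuity, and the density of U near 0 makes the points of non-differentiability negligible. -/

theorem continuous (hG : SmoothingFunction r G) : Continuous G :=
  let ⟨_, hK⟩ := hG.lipschitz
  hK.continuous

theorem measurable (hG : SmoothingFunction r G) : Measurable G := hG.continuous.measurable

theorem exists_bound (hG : SmoothingFunction r G) :
    ∃ B : ℝ, 1 ≤ B ∧ (∀ v, |G v| ≤ B) ∧ (∀ v, |deriv G v| ≤ B) ∧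
      ∀ v w, |G v - G w| ≤ B * |v - w| := by
  obtain ⟨K, hK⟩ := hG.lipschitz
  have h0 : (0 : ℝ) ≤ K := K.2
  have hL : ∀ v w, |G v - G w| ≤ K * |v - w| := fun v w => by
    simpa [Real.dist_eq] using hK.dist_le_mul v w
  -- On [-1, 1] the Lipschitz bound from G(-1) = 0 gives |G| ≤ 2K; the extra 1 covers the value 1 to
  -- the right of 1 and makes the common constant at least 1.
  refine ⟨2 * K + 1, by linarith, fun v => ?_, fun v => ?_, fun v w => ?_⟩
  · rcases le_total v (-1) with hv | hv
    · rw [hG.eq_zero v hv, abs_zero]; linarith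
    rcases le_total 1 v with hv' | hv'
    · rw [hG.eq_one v hv', abs_one]; linarith
    have h1 := hL v (-1)
    rw [hG.eq_zero (-1) le_rfl, sub_zero] at h1
    have h2 : |v - (-1)| ≤ 2 := by rw [abs_le]; constructor <;> linarith
    nlinarith
  · have := norm_deriv_le_of_lipschitz (x₀ := v) hK
    rw [Real.norm_eq_abs] at this
    linarith
  · exact (hL v w).trans (mul_le_mul_of_nonneg_right (by linarith) (abs_nonneg _))

theorem deriv_eq_zero (hG : SmoothingFunction r G) {v : ℝ} (hv : 1 < |v|) : deriv G v = 0 := by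
  rcases lt_abs.1 hv with h | h
  · have : G =ᶠ[𝓝 v] fun _ => 1 := by
      filter_upwards [lt_mem_nhds h] with w hw using hG.eq_one w hw.le
    rw [this.deriv_eq]; simp
  · have : G =ᶠ[𝓝 v] fun _ => 0 := by
      filter_upwards [gt_mem_nhds (show v < -1 by linarith)] with w hw using hG.eq_zero w hw.le
    rw [this.deriv_eq]; simp

/-- Smoothed minus unsmoothed indicator. -/
abbrev _root_.SEE.defect (G : ℝ → ℝ) (v : ℝ) : ℝ := G v - (Set.Ioi (0 : ℝ)).indicator 1 v

theorem defect_eq_zero (hG : SmoothingFunction r G) {v : ℝ} (hv : 1 < |v|) : defect G v = 0 := by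
  rcases lt_abs.1 hv with h | h
  · rw [defect, hG.eq_one v h.le, Set.indicator_of_mem (by simp; linarith)]; simp
  · rw [defect, hG.eq_zero v (by linarith), Set.indicator_of_notMem (by simp; linarith)]; simp

theorem measurable_defect (hG : SmoothingFunction r G) : Measurable (defect G) :=
  hG.measurable.sub (measurable_one.indicator measurableSet_Ioi)

theorem integral_indicator_mul_pow (k : ℕ) :
    ∫ v in (-1 : ℝ)..1, (Set.Ioi (0 : ℝ)).indicator 1 v * v ^ k = 1 / (k + 1) := by
  have e : ∀ v : ℝ, (Set.Ioi (0 : ℝ)).indicator 1 v * v ^ k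
      = (Set.Ioi (0 : ℝ)).indicator (fun v => v ^ k) v := fun v => by
    by_cases hv : v ∈ Set.Ioi (0 : ℝ) <;> simp [hv]
  simp_rw [e]
  rw [intervalIntegral.integral_of_le (by norm_num), setIntegral_indicator measurableSet_Ioi]
  have : Set.Ioc (-1 : ℝ) 1 ∩ Set.Ioi 0 = Set.Ioc 0 1 := by
    ext x; simp only [Set.mem_inter_iff, Set.mem_Ioc, Set.mem_Ioi]
    constructor
    · rintro ⟨⟨_, h⟩, h'⟩; exact ⟨h', h⟩
    · rintro ⟨h, h'⟩; exact ⟨⟨by linarith, h'⟩, h⟩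
  rw [this, ← intervalIntegral.integral_of_le (by norm_num), integral_pow]
  simp

theorem intervalIntegrable_indicator (a b : ℝ) {p : ℝ → ℝ} (hp : Continuous p) :
    IntervalIntegrable (fun v => (Set.Ioi (0 : ℝ)).indicator (1 : ℝ → ℝ) v * p v) volume a b := by
  have e : (fun v : ℝ => (Set.Ioi (0 : ℝ)).indicator (1 : ℝ → ℝ) v * p v)
      = (Set.Ioi (0 : ℝ)).indicator p := by
    funext v; by_cases hv : v ∈ Set.Ioi (0 : ℝ) <;> simp [hv]
  rw [e]
  have := hp.intervalIntegrable (μ := volume) a b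
  exact ⟨this.1.indicator measurableSet_Ioi, this.2.indicator measurableSet_Ioi⟩

/-- Integration by parts for absolutely continuous functions, which a Lipschitz G permits without
being differentiable everywhere. The boundary term is G(1) = 1, since G(-1) = 0. -/
theorem integral_mul_deriv (hG : SmoothingFunction r G) (k : ℕ) :
    ∫ v in (-1 : ℝ)..1, v ^ (k + 1) * deriv G v
      = 1 - (k + 1) * ∫ v in (-1 : ℝ)..1, G v * v ^ k := by
  obtain ⟨K, hK⟩ := hG.lipschitz
  have h1 : AbsolutelyContinuousOnInterval G (-1) 1 :=
    (hK.lipschitzOnWith (s := Set.uIcc (-1) 1)).absolutelyContinuousOnInterval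
  have h2 : AbsolutelyContinuousOnInterval (fun v : ℝ => v ^ (k + 1)) (-1) 1 := by
    have : ContDiffOn ℝ 1 (fun v : ℝ => v ^ (k + 1)) (Set.uIcc (-1) 1) := by fun_prop
    obtain ⟨L, hL⟩ := this.exists_lipschitzOnWith (by norm_num) (convex_uIcc _ _) isCompact_uIcc
    exact hL.absolutelyContinuousOnInterval
  have h3 := h2.integral_mul_deriv_eq_deriv_mul h1
  rw [h3, hG.eq_zero (-1) le_rfl, hG.eq_one 1 le_rfl, ← intervalIntegral.integral_const_mul]
  simp only [one_pow, mul_one, mul_zero, sub_zero]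
  congr 1
  refine intervalIntegral.integral_congr fun v _ => ?_
  simp; ring

/-- This shifts degrees by one: an r-th order kernel G' makes the defect orthogonal to all powers
below r - 1, with a nonzero moment of degree r - 1. The order h^r of the bias is this r - 1 plus the
factor h of the change of variables. -/
theorem integral_defect_mul_pow (hG : SmoothingFunction r G) (k : ℕ) :
    ∫ v in (-1 : ℝ)..1, defect G v * v ^ k
      = -(1 / (k + 1)) * ∫ v in (-1 : ℝ)..1, v ^ (k + 1) * deriv G v := by
  have hk : (k : ℝ) + 1 ≠ 0 := by positivity
  simp_rw [defect, sub_mul]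
  rw [intervalIntegral.integral_sub
    (f := fun v => G v * v ^ k)
    ((hG.continuous.mul (continuous_pow k)).intervalIntegrable _ _)
    (intervalIntegrable_indicator _ _ (continuous_pow k)), integral_indicator_mul_pow,
    hG.integral_mul_deriv k]
  field_simp
  ring

theorem integral_defect_mul_pow_eq_zero (hG : SmoothingFunction r G) {k : ℕ} (hk : k < r - 1) :
    ∫ v in (-1 : ℝ)..1, defect G v * v ^ k = 0 := by
  rw [hG.integral_defect_mul_pow, hG.moments_zero _ (by omega) (by omega), mul_zero]

end SmoothingFunction

/-! ### Taylor expansion against a kernel -/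

/-- Lagrange's form around 0, stated with the global `iteratedDeriv` and including m = 0 and u = 0,
where there is no open interval to pick ξ from, so that later uses need no case distinction. -/
theorem exists_taylor_remainder {f : ℝ → ℝ} {ε : ℝ} {m : ℕ}
    (hf : ContDiffOn ℝ m f (Set.Ioo (-ε) ε)) {u : ℝ} (hu : u ∈ Set.Ioo (-ε) ε) :
    ∃ ξ, |ξ| ≤ |u| ∧ f u = ∑ k ∈ Finset.range m, iteratedDeriv k f 0 * (u ^ k / k.factorial)
      + iteratedDeriv m f ξ * (u ^ m / m.factorial) := by
  have hε : 0 < ε := by linarith [hu.1, hu.2]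
  have h0 : (0 : ℝ) ∈ Set.Ioo (-ε) ε := ⟨by linarith, hε⟩
  rcases m with _ | m
  · exact ⟨u, le_rfl, by simp⟩
  rcases eq_or_ne u 0 with rfl | hu0
  · refine ⟨0, le_rfl, ?_⟩
    rw [Finset.sum_range_succ', Finset.sum_eq_zero (by intro k _; simp)]
    simp
  have hsub : Set.uIcc 0 u ⊆ Set.Ioo (-ε) ε := Set.ordConnected_Ioo.uIcc_subset h0 hu
  obtain ⟨ξ, hξ, he⟩ := taylor_mean_remainder_lagrange_iteratedDeriv (n := m) hu0.symm
    (by exact_mod_cast hf.mono hsub)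
  refine ⟨ξ, ?_, ?_⟩
  · rcases le_total 0 u with h | h
    · rw [Set.uIoo_of_le h] at hξ
      rw [abs_of_pos hξ.1, abs_of_nonneg h]; exact hξ.2.le
    · rw [Set.uIoo_of_ge h] at hξ
      rw [abs_of_neg hξ.2, abs_of_nonpos h]; linarith [hξ.1]
  · rw [sub_eq_iff_eq_add] at he
    rw [he, taylor_within_apply, add_comm, sub_zero, mul_div_assoc]
    congr 1
    refine Finset.sum_congr rfl fun k hk => ?_
    have hk' : k ≤ m + 1 := (Finset.mem_range.1 hk).le
    rw [iteratedDerivWithin_eq_iteratedDeriv (uniqueDiffOn_uIcc hu0.symm) _ Set.left_mem_uIcc]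
    · simp; field_simp
    · exact (hf.contDiffAt (isOpen_Ioo.mem_nhds h0)).of_le (by exact_mod_cast hk')

/-- The integrand of the remainder is at most B · C h^m on an interval of length 2. Only the m-th
derivative has to be bounded, and m = 0 is the crude bound with no expansion. -/
theorem abs_kernel_integral_sub_le {f k : ℝ → ℝ} {ε B C h : ℝ} {m : ℕ}
    (hf : ContDiffOn ℝ m f (Set.Ioo (-ε) ε))
    (hC : ∀ u ∈ Set.Ioo (-ε) ε, |iteratedDeriv m f u| ≤ C)
    (hk : Measurable k) (hB : ∀ v, |k v| ≤ B) (h0 : 0 ≤ h) (hε : h < ε) :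
    |(∫ v in (-1 : ℝ)..1, k v * f (-(h * v))) - ∑ i ∈ Finset.range m,
      iteratedDeriv i f 0 * ((-h) ^ i / i.factorial) * ∫ v in (-1 : ℝ)..1, k v * v ^ i|
      ≤ 2 * B * C * h ^ m := by
  have hB0 : 0 ≤ B := (abs_nonneg _).trans (hB 0)
  have hmem : ∀ v ∈ Set.uIcc (-1 : ℝ) 1, -(h * v) ∈ Set.Ioo (-ε) ε := fun v hv => by
    rw [Set.uIcc_of_le (by norm_num)] at hv
    constructor <;> nlinarith [hv.1, hv.2]
  have hint : ∀ p : ℝ → ℝ, ContinuousOn p (Set.uIcc (-1) 1) →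
      IntervalIntegrable (fun v => k v * p v) volume (-1) 1 := fun p hp => by
    refine IntervalIntegrable.mul_continuousOn ?_ hp
    refine (intervalIntegrable_const (c := B)).mono_fun' hk.aestronglyMeasurable ?_
    exact ae_of_all _ fun v => by simpa using hB v
  have hfc : ContinuousOn (fun v : ℝ => f (-(h * v))) (Set.uIcc (-1) 1) :=
    hf.continuousOn.comp (by fun_prop) hmem
  have e : ∑ i ∈ Finset.range m,
      iteratedDeriv i f 0 * ((-h) ^ i / i.factorial) * (∫ v in (-1 : ℝ)..1, k v * v ^ i)
      = ∫ v in (-1 : ℝ)..1, k v *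
        ∑ i ∈ Finset.range m, iteratedDeriv i f 0 * ((-(h * v)) ^ i / i.factorial) := by
    simp_rw [← intervalIntegral.integral_const_mul, Finset.mul_sum]
    rw [intervalIntegral.integral_finsetSum]
    · refine Finset.sum_congr rfl fun i _ => intervalIntegral.integral_congr fun v _ => ?_
      simp only [neg_mul_eq_neg_mul, mul_pow]; ring
    · exact fun i _ => hint _ (by fun_prop)
  rw [e, ← intervalIntegral.integral_sub (hint _ hfc) (hint _ (by fun_prop))]
  have := intervalIntegral.norm_integral_le_of_norm_le_const (a := (-1 : ℝ)) (b := 1)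
    (C := B * (C * h ^ m)) (f := fun v => k v * f (-(h * v)) - k v *
        ∑ i ∈ Finset.range m, iteratedDeriv i f 0 * ((-(h * v)) ^ i / i.factorial)) ?_
  · rw [Real.norm_eq_abs] at this
    refine this.trans (le_of_eq ?_)
    norm_num; ring
  · intro v hv
    have hv' : v ∈ Set.uIcc (-1 : ℝ) 1 := Set.uIoc_subset_uIcc hv
    obtain ⟨ξ, hξ, he⟩ := exists_taylor_remainder hf (hmem v hv')
    have hξ' : ξ ∈ Set.Ioo (-ε) ε := by
      have h1 := hmem v hv'
      rw [Set.mem_Ioo, ← abs_lt] at h1 ⊢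
      exact hξ.trans_lt h1
    have hvabs : |v| ≤ 1 := by
      rw [Set.uIcc_of_le (by norm_num)] at hv'; exact abs_le.2 hv'
    rw [← mul_sub, he, add_sub_cancel_left, Real.norm_eq_abs, abs_mul]
    refine mul_le_mul (hB v) ?_ (abs_nonneg _) hB0
    rw [abs_mul]
    refine mul_le_mul (hC ξ hξ') ?_ (abs_nonneg _) ((abs_nonneg _).trans (hC ξ hξ'))
    rw [abs_div, abs_pow, abs_neg, abs_mul, abs_of_nonneg h0, Nat.abs_cast]
    refine (div_le_self (by positivity) (by exact_mod_cast m.factorial_pos)).trans ?_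
    exact pow_le_pow_left₀ (by positivity) (mul_le_of_le_one_right h0 hvabs) _

/-- The vanishing moments erase the Taylor polynomial exactly, so dividing by h^m leaves an
integrand bounded by BC, whose intermediate point tends to 0; dominated convergence finishes. -/
theorem tendsto_kernel_integral {f k : ℝ → ℝ} {ε B C : ℝ} {m : ℕ} (hε : 0 < ε)
    (hf : ContDiffOn ℝ m f (Set.Ioo (-ε) ε))
    (hC : ∀ u ∈ Set.Ioo (-ε) ε, |iteratedDeriv m f u| ≤ C)
    (hk : Measurable k) (hB : ∀ v, |k v| ≤ B)
    (hmom : ∀ i < m, ∫ v in (-1 : ℝ)..1, k v * v ^ i = 0) :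
    Tendsto (fun h : ℝ => (h ^ m)⁻¹ * ∫ v in (-1 : ℝ)..1, k v * f (-(h * v))) (𝓝[>] 0)
      (𝓝 ((-1) ^ m / m.factorial * iteratedDeriv m f 0 * ∫ v in (-1 : ℝ)..1, k v * v ^ m)) := by
  have hzero : (0 : ℝ) ∈ Set.Ioo (-ε) ε := ⟨by linarith, hε⟩
  have hB0 : 0 ≤ B := (abs_nonneg _).trans (hB 0)
  have hC0 : 0 ≤ C := (abs_nonneg _).trans (hC 0 hzero)
  have hcont : ContinuousAt (iteratedDeriv m f) 0 := by
    have h1 := hf.continuousOn_iteratedDerivWithin le_rfl isOpen_Ioo.uniqueDiffOn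
    have h2 : ContinuousAt (iteratedDerivWithin m f (Set.Ioo (-ε) ε)) 0 :=
      h1.continuousAt (isOpen_Ioo.mem_nhds hzero)
    refine h2.congr ?_
    filter_upwards [isOpen_Ioo.mem_nhds hzero] with u hu
    exact iteratedDerivWithin_of_isOpen isOpen_Ioo hu
  have hint : ∀ p : ℝ → ℝ, ContinuousOn p (Set.uIcc (-1) 1) →
      IntervalIntegrable (fun v => k v * p v) volume (-1) 1 := fun p hp => by
    refine IntervalIntegrable.mul_continuousOn ?_ hp
    refine (intervalIntegrable_const (c := B)).mono_fun' hk.aestronglyMeasurable ?_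
    exact ae_of_all _ fun v => by simpa using hB v
  -- the remainder of the Taylor polynomial
  set ρ : ℝ → ℝ := fun u => f u - ∑ i ∈ Finset.range m, iteratedDeriv i f 0 * (u ^ i / i.factorial)
    with hρ
  have hev : ∀ᶠ h : ℝ in 𝓝[>] 0, h ∈ Set.Ioo 0 ε := Ioo_mem_nhdsGT hε
  have hmem : ∀ h ∈ Set.Ioo 0 ε, ∀ v ∈ Set.uIcc (-1 : ℝ) 1, -(h * v) ∈ Set.Ioo (-ε) ε :=
    fun h hh v hv => by
      rw [Set.uIcc_of_le (by norm_num)] at hv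
      constructor <;> nlinarith [hv.1, hv.2, hh.1, hh.2]
  have hfc : ∀ h ∈ Set.Ioo 0 ε, ContinuousOn (fun v : ℝ => f (-(h * v))) (Set.uIcc (-1) 1) :=
    fun h hh => hf.continuousOn.comp (by fun_prop) (hmem h hh)
  have e1 : ∀ h ∈ Set.Ioo 0 ε, (h ^ m)⁻¹ * ∫ v in (-1 : ℝ)..1, k v * f (-(h * v))
      = ∫ v in (-1 : ℝ)..1, (h ^ m)⁻¹ * (k v * ρ (-(h * v))) := fun h hh => by
    rw [intervalIntegral.integral_const_mul]
    congr 1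
    simp only [hρ, mul_sub]
    rw [intervalIntegral.integral_sub (hint _ (hfc h hh)) (hint _ (by fun_prop))]
    rw [eq_comm, sub_eq_self]
    simp_rw [Finset.mul_sum]
    rw [intervalIntegral.integral_finsetSum fun i _ => hint _ (by fun_prop)]
    refine Finset.sum_eq_zero fun i hi => ?_
    have : ∀ v : ℝ, k v * (iteratedDeriv i f 0 * ((-(h * v)) ^ i / i.factorial))
        = iteratedDeriv i f 0 * (-h) ^ i / i.factorial * (k v * v ^ i) := fun v => by
      rw [neg_mul_eq_neg_mul, mul_pow]; ring
    simp_rw [this]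
    rw [intervalIntegral.integral_const_mul, hmom i (Finset.mem_range.1 hi), mul_zero]
  have e2 : (-1 : ℝ) ^ m / m.factorial * iteratedDeriv m f 0 * ∫ v in (-1 : ℝ)..1, k v * v ^ m
      = ∫ v in (-1 : ℝ)..1, k v * (iteratedDeriv m f 0 * ((-v) ^ m / m.factorial)) := by
    rw [← intervalIntegral.integral_const_mul]
    refine intervalIntegral.integral_congr fun v _ => ?_
    simp only [neg_pow v]; ring
  rw [e2]
  refine Tendsto.congr' (hev.mono fun h hh => (e1 h hh).symm) ?_
  -- pointwise form of the remainder
  have hrem : ∀ h ∈ Set.Ioo 0 ε, ∀ v ∈ Set.uIcc (-1 : ℝ) 1, ∃ ξ ∈ Set.Ioo (-ε) ε, |ξ| ≤ h ∧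
      (h ^ m)⁻¹ * (k v * ρ (-(h * v))) = k v * (iteratedDeriv m f ξ * ((-v) ^ m / m.factorial))
          := by
    intro h hh v hv
    obtain ⟨ξ, hξ, he⟩ := exists_taylor_remainder hf (hmem h hh v hv)
    have hvabs : |v| ≤ 1 := by
      rw [Set.uIcc_of_le (by norm_num)] at hv; exact abs_le.2 hv
    have hξh : |ξ| ≤ h := by
      refine hξ.trans ?_
      rw [abs_neg, abs_mul, abs_of_pos hh.1]
      exact mul_le_of_le_one_right hh.1.le hvabs
    refine ⟨ξ, abs_lt.1 (hξh.trans_lt hh.2), hξh, ?_⟩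
    have hh0 : h ^ m ≠ 0 := pow_ne_zero _ hh.1.ne'
    simp only [hρ]
    rw [he, add_sub_cancel_left, neg_mul_eq_mul_neg, mul_pow]
    field_simp
  refine intervalIntegral.tendsto_integral_filter_of_dominated_convergence (fun _ => B * C)
    ?_ ?_ intervalIntegrable_const ?_
  · filter_upwards [hev] with h hh
    have : ContinuousOn (fun v => ρ (-(h * v))) (Set.uIcc (-1) 1) := by
      simp only [hρ]
      exact (hfc h hh).sub (by fun_prop)
    exact ((hint _ this).const_mul _).def'.aestronglyMeasurable
  · filter_upwards [hev] with h hh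
    refine ae_of_all _ fun v hv => ?_
    have hv' := Set.uIoc_subset_uIcc hv
    obtain ⟨ξ, hξ, -, he⟩ := hrem h hh v hv'
    have hvabs : |v| ≤ 1 := by
      rw [Set.uIcc_of_le (by norm_num)] at hv'; exact abs_le.2 hv'
    rw [he, Real.norm_eq_abs, abs_mul, abs_mul]
    refine mul_le_mul (hB v) ?_ (by positivity) hB0
    rw [abs_div, abs_pow, abs_neg, Nat.abs_cast]
    calc |iteratedDeriv m f ξ| * (|v| ^ m / m.factorial) ≤ C * 1 := by
          refine mul_le_mul (hC ξ hξ) ?_ (by positivity) hC0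
          exact (div_le_self (by positivity) (by exact_mod_cast m.factorial_pos)).trans
            (pow_le_one₀ (abs_nonneg _) hvabs)
      _ = C := mul_one C
  · refine ae_of_all _ fun v hv => ?_
    have hv' := Set.uIoc_subset_uIcc hv
    -- With v fixed, the intermediate point becomes a function of h with |ξ h| ≤ h, so continuity of
    -- the m-th derivative at 0 alone is enough.
    choose! ξ hξ hξh he using fun h (hh : h ∈ Set.Ioo 0 ε) => hrem h hh v hv'
    refine Tendsto.congr' (hev.mono fun h hh => (he h hh).symm) ?_
    have hξ0 : Tendsto ξ (𝓝[>] 0) (𝓝 0) := by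
      refine squeeze_zero_norm' (a := id) ?_ (tendsto_id.mono_left nhdsWithin_le_nhds)
      filter_upwards [hev] with h hh using hξh h hh
    exact ((hcont.tendsto.comp hξ0).mul_const _).const_mul _

end SEE

namespace SEE

/-! ### Conditional densities -/

section Conditioning

variable {Ω 𝓦 : Type*} [MeasurableSpace Ω] [MeasurableSpace 𝓦] {P : Measure Ω}
  [IsFiniteMeasure P] {U : Ω → ℝ} {W : Ω → 𝓦}

/-- Fubini for the disintegration of the law of (W, U). Boundedness in u for each w gives
integrability on the fibres; the bound D on the conditional L¹ norms gives it on the base. -/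
theorem integrable_and_integral_eq_condDistrib (hU : Measurable U) (hW : Measurable W)
    {Φ : 𝓦 × ℝ → ℝ} (hΦ : Measurable Φ) (hb : ∀ w, ∃ B, ∀ u, |Φ (w, u)| ≤ B) {D : 𝓦 → ℝ}
    (hD : ∀ᵐ w ∂(P.map W), ∫ u, |Φ (w, u)| ∂(condDistrib U W P w) ≤ D w)
    (hDi : Integrable (fun ω => D (W ω)) P) :
    Integrable (fun ω => Φ (W ω, U ω)) P ∧
      ∫ ω, Φ (W ω, U ω) ∂P = ∫ ω, (∫ u, Φ (W ω, u) ∂(condDistrib U W P (W ω))) ∂P := by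
  have hmap : P.map W ⊗ₘ condDistrib U W P = P.map fun ω => (W ω, U ω) :=
    compProd_map_condDistrib hU.aemeasurable
  have hWU : Measurable fun ω => (W ω, U ω) := hW.prodMk hU
  have hi : Integrable Φ (P.map W ⊗ₘ condDistrib U W P) := by
    rw [Measure.integrable_compProd_iff hΦ.aestronglyMeasurable]
    constructor
    · refine ae_of_all _ fun w => ?_
      obtain ⟨B, hB⟩ := hb w
      exact Integrable.of_bound (hΦ.comp measurable_prodMk_left).aestronglyMeasurable B
        (ae_of_all _ hB)
    · have hm : StronglyMeasurable fun w => ∫ u, ‖Φ (w, u)‖ ∂(condDistrib U W P w) :=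
        hΦ.stronglyMeasurable.norm.integral_condDistrib
      rw [integrable_map_measure hm.aestronglyMeasurable hW.aemeasurable]
      refine hDi.mono' (hm.comp_measurable hW).aestronglyMeasurable ?_
      filter_upwards [ae_of_ae_map hW.aemeasurable hD] with ω hω
      rw [Function.comp_apply, Real.norm_of_nonneg (integral_nonneg fun _ => norm_nonneg _)]
      exact hω
  have hi' := hi
  rw [hmap, integrable_map_measure hΦ.aestronglyMeasurable hWU.aemeasurable] at hi'
  refine ⟨hi', ?_⟩
  have h1 := Measure.integral_compProd hi
  rw [hmap, integral_map hWU.aemeasurable hΦ.aestronglyMeasurable,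
    integral_map hW.aemeasurable] at h1
  · exact h1
  · exact (hΦ.stronglyMeasurable.integral_condDistrib).aestronglyMeasurable

variable {f : 𝓦 → ℝ → ℝ} {ε : ℝ}

/-- The test function is quantified after the exceptional null set, so one null set serves every
kernel and every bandwidth at once. The density is only known on the window, hence the support
condition. -/
theorem HasCondDensityNear.ae_integral_eq (hf : HasCondDensityNear P U W f ε)
    (hc : ∀ᵐ w ∂(P.map W), ContinuousOn (f w) (Set.Ioo (-ε) ε)) :
    ∀ᵐ w ∂(P.map W), ∀ φ : ℝ → ℝ, (∀ u ∉ Set.Ioo (-ε) ε, φ u = 0) →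
      ∫ u, φ u ∂(condDistrib U W P w) = ∫ u in Set.Ioo (-ε) ε, φ u * f w u := by
  filter_upwards [hf, hc] with w hw hcw φ hφ
  have hm : AEMeasurable (fun u => ENNReal.ofReal (f w u)) (volume.restrict (Set.Ioo (-ε) ε)) :=
    (hcw.aemeasurable measurableSet_Ioo).ennreal_ofReal
  have hr : (condDistrib U W P w).restrict (Set.Ioo (-ε) ε)
      = (volume.restrict (Set.Ioo (-ε) ε)).withDensity fun u => ENNReal.ofReal (f w u) := by
    ext s hs
    rw [Measure.restrict_apply hs, withDensity_apply _ hs, Measure.restrict_restrict hs,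
      hw.2 _ (hs.inter measurableSet_Ioo) Set.inter_subset_right]
  rw [← setIntegral_eq_integral_of_forall_compl_eq_zero hφ, hr,
    integral_withDensity_eq_integral_toReal_smul₀ hm (ae_of_all _ fun _ => ENNReal.ofReal_lt_top)]
  refine setIntegral_congr_fun measurableSet_Ioo fun u hu => ?_
  simp only [smul_eq_mul]
  rw [ENNReal.toReal_ofReal (hw.1 u hu), mul_comm]

/-- Substitution u = t - hv; the condition |t| + h < ε keeps the rescaled kernel inside the window.
-/
theorem setIntegral_shifted_kernel_eq {k p : ℝ → ℝ} {h t : ℝ} (hk : ∀ v, 1 < |v| → k v = 0)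
    (h0 : 0 < h) (hε : |t| + h < ε) :
    ∫ u in Set.Ioo (-ε) ε, k ((t - u) / h) * p u
      = h * ∫ v in (-1 : ℝ)..1, k v * p (t - h * v) := by
  have ht := abs_le.1 (le_refl |t|)
  have e1 : ∫ u in Set.Ioo (-ε) ε, k ((t - u) / h) * p u
      = ∫ u in Set.Icc (t - h) (t + h), k ((t - u) / h) * p u := by
    refine (setIntegral_eq_of_subset_of_forall_sdiff_eq_zero measurableSet_Ioo ?_ ?_)
    · intro u hu; exact ⟨by linarith [hu.1], by linarith [hu.2]⟩
    · intro u hu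
      rw [hk, zero_mul]
      rw [abs_div, abs_of_pos h0, lt_div_iff₀ h0, one_mul, lt_abs]
      by_contra! hcon
      exact hu.2 ⟨by linarith, by linarith⟩
  have e2 := intervalIntegral.integral_comp_sub_mul (a := (-1 : ℝ)) (b := 1)
    (fun u => k ((t - u) / h) * p u) h0.ne' t
  have e3 : (fun v : ℝ => k ((t - (t - h * v)) / h) * p (t - h * v))
      = fun v => k v * p (t - h * v) := by
    funext v
    rw [show (t - (t - h * v)) / h = v by field_simp; ring]
  simp only [e3] at e2
  rw [e1, e2, integral_Icc_eq_integral_Ioc,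
    ← intervalIntegral.integral_of_le (by linarith), mul_one, mul_neg, mul_one, sub_neg_eq_add,
    smul_eq_mul, mul_inv_cancel_left₀ h0.ne']

theorem setIntegral_kernel_eq {k p : ℝ → ℝ} {h : ℝ} (hk : ∀ v, 1 < |v| → k v = 0)
    (h0 : 0 < h) (hε : h < ε) :
    ∫ u in Set.Ioo (-ε) ε, k (-u / h) * p u
      = h * ∫ v in (-1 : ℝ)..1, k v * p (-(h * v)) := by
  simpa using setIntegral_shifted_kernel_eq (p := p) (t := 0) hk h0 (by simpa using hε)

theorem HasCondDensityNear.ae_integral_kernel_eq (hf : HasCondDensityNear P U W f ε)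
    (hc : ∀ᵐ w ∂(P.map W), ContinuousOn (f w) (Set.Ioo (-ε) ε)) :
    ∀ᵐ w ∂(P.map W), ∀ (k : ℝ → ℝ) (h : ℝ), (∀ v, 1 < |v| → k v = 0) → 0 < h → h < ε →
      ∫ u, k (-u / h) ∂(condDistrib U W P w)
        = h * ∫ v in (-1 : ℝ)..1, k v * f w (-(h * v)) := by
  filter_upwards [hf.ae_integral_eq hc] with w hw k h hk h0 hε
  rw [hw, setIntegral_kernel_eq hk h0 hε]
  intro u hu
  refine hk _ ?_
  rw [abs_div, abs_neg, abs_of_pos h0, lt_div_iff₀ h0, one_mul]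
  by_contra! hcon
  exact hu (abs_lt.1 (hcon.trans_lt hε))

end Conditioning

end SEE

namespace SEE

/-! ### Observations -/

variable {Ω : Type*} [MeasurableSpace Ω] {d : ℕ}

theorem measurable_coord (a : Fin d) : Measurable fun v : Vec d => v a :=
  (EuclideanSpace.proj (𝕜 := ℝ) a).continuous.measurable

theorem abs_coord_le (v : Vec d) (a : Fin d) : |v a| ≤ ‖v‖ := PiLp.norm_apply_le v a

namespace Sampling

variable {P : Measure Ω} {q : ℝ} {X Z : ℕ → Ω → Vec d} {Y : ℕ → Ω → ℝ} {β₀ : Vec d}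

theorem measurable_obs (hS : Sampling P q X Z Y β₀) (j : ℕ) :
    Measurable fun ω => (X j ω, Z j ω, Y j ω) :=
  (hS.measurable_X j).prodMk ((hS.measurable_Z j).prodMk (hS.measurable_Y j))

theorem measurable_err (hS : Sampling P q X Z Y β₀) (j : ℕ) : Measurable (err X Y β₀ j) :=
  (hS.measurable_Y j).sub ((hS.measurable_X j).inner measurable_const)

theorem integral_obs_eq (hS : Sampling P q X Z Y β₀) (j : ℕ) {F : Vec d × Vec d × ℝ → ℝ}
    (hF : Measurable F) :
    ∫ ω, F (X j ω, Z j ω, Y j ω) ∂P = ∫ ω, F (X 0 ω, Z 0 ω, Y 0 ω) ∂P :=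
  ((hS.identDistrib j).comp hF).integral_eq

theorem integrable_obs (hS : Sampling P q X Z Y β₀) (j : ℕ) {F : Vec d × Vec d × ℝ → ℝ}
    (hF : Measurable F) (h0 : Integrable (fun ω => F (X 0 ω, Z 0 ω, Y 0 ω)) P) :
    Integrable (fun ω => F (X j ω, Z j ω, Y j ω)) P :=
  ((hS.identDistrib j).comp hF).integrable_iff.2 h0

theorem ae_obs (hS : Sampling P q X Z Y β₀) (j : ℕ) {p : Vec d × Vec d × ℝ → Prop}
    (hp : MeasurableSet {x | p x}) (h0 : ∀ᵐ ω ∂P, p (X 0 ω, Z 0 ω, Y 0 ω)) :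
    ∀ᵐ ω ∂P, p (X j ω, Z j ω, Y j ω) :=
  (hS.identDistrib j).symm.ae_snd hp h0

end Sampling

/-! ### The mean Jacobian -/

section Jacobian

variable {P : Measure Ω} [IsProbabilityMeasure P] {r : ℕ} {q : ℝ} {X Z : ℕ → Ω → Vec d}
  {Y : ℕ → Ω → ℝ} {β₀ : Vec d} {G : ℝ → ℝ} {g : Vec d × Vec d → ℝ → ℝ} {C : Vec d × Vec d → ℝ}

/-- The contribution `Z_a X_b G'(-U / h) / h` of an observation `(X, Z, Y)` to the Jacobian. -/
def slope (G : ℝ → ℝ) (β₀ : Vec d) (h : ℝ) (a b : Fin d) (x : Vec d × Vec d × ℝ) : ℝ :=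
  x.2.1 a * x.1 b * (deriv G ((inner ℝ x.1 β₀ - x.2.2) / h) / h)

theorem measurable_slope (h : ℝ) (a b : Fin d) : Measurable (slope G β₀ h a b) := by
  refine (((measurable_coord a).comp measurable_snd.fst).mul
    ((measurable_coord b).comp measurable_fst)).mul ?_
  refine ((measurable_deriv G).comp ?_).div_const h
  exact ((measurable_fst.inner measurable_const).sub measurable_snd.snd).div_const h

theorem jacobian_eq_of_differentiableAt {Ω : Type*} {X Z : ℕ → Ω → Vec d} {Y : ℕ → Ω → ℝ} (n : ℕ)
    (h : ℝ) {ω : Ω}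
    (hd : ∀ j, DifferentiableAt ℝ G ((inner ℝ (X j ω) β₀ - Y j ω) / h)) (a b : Fin d) :
    jacobian q G X Z Y β₀ n h ω a b
      = (n : ℝ)⁻¹ * ∑ j ∈ Finset.range n, slope G β₀ h a b (X j ω, Z j ω, Y j ω) := by
  have hin : ∀ j (t : ℝ), inner ℝ (X j ω) (β₀ + t • EuclideanSpace.single b (1 : ℝ))
      = inner ℝ (X j ω) β₀ + t * X j ω b := fun j t => by
    rw [inner_add_right, inner_smul_right, EuclideanSpace.inner_single_right]
    simp
  have hD : ∀ j, HasDerivAt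
      (fun t : ℝ => (G ((inner ℝ (X j ω) (β₀ + t • EuclideanSpace.single b (1 : ℝ)) - Y j ω) / h)
        - q) * Z j ω a)
      (slope G β₀ h a b (X j ω, Z j ω, Y j ω)) 0 := fun j => by
    have h1 : HasDerivAt (fun t : ℝ => (inner ℝ (X j ω) β₀ + t * X j ω b - Y j ω) / h)
        (X j ω b / h) 0 := by
      have := ((((hasDerivAt_id (0 : ℝ)).mul_const (X j ω b)).const_add
        (inner ℝ (X j ω) β₀)).sub_const (Y j ω)).div_const h
      simpa using this
    have h2 : HasDerivAt G (deriv G ((inner ℝ (X j ω) β₀ - Y j ω) / h))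
        ((inner ℝ (X j ω) β₀ + 0 * X j ω b - Y j ω) / h) := by
      rw [zero_mul, add_zero]; exact (hd j).hasDerivAt
    have h3 := ((h2.comp 0 h1).sub_const q).mul_const (Z j ω a)
    simp only [hin]
    refine h3.congr_deriv ?_
    simp only [slope]; ring
  have hsum := (HasDerivAt.fun_sum fun j (_ : j ∈ Finset.range n) => hD j).const_mul
    ((√(n : ℝ))⁻¹ * (√(n : ℝ))⁻¹)
  have hnn : (√(n : ℝ))⁻¹ * (√(n : ℝ))⁻¹ = (n : ℝ)⁻¹ := by
    rw [← mul_inv, Real.mul_self_sqrt (Nat.cast_nonneg n)]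
  rw [hnn] at hsum
  rw [← hsum.deriv, jacobian, Matrix.of_apply, lineDeriv]
  congr 1
  funext t
  simp only [ee, PiLp.smul_apply, WithLp.ofLp_sum, Finset.sum_apply, smul_eq_mul]
  rw [← mul_assoc, hnn]

/-- A Lipschitz G fails to be differentiable only on a Lebesgue null set, contained in [-1, 1]. If
-U/h falls there, then |U| ≤ h < ε, where U has a conditional density; so this has probability zero,
for all observations simultaneously. -/
theorem ae_differentiableAt_obs (hS : Sampling P q X Z Y β₀) (hG : SmoothingFunction r G)
    {ε : ℝ} (hf : HasCondDensityNear P (err X Y β₀ 0) (fun ω => (Z 0 ω, X 0 ω)) g ε)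
    (hc : ∀ᵐ w ∂(P.map fun ω => (Z 0 ω, X 0 ω)), ContinuousOn (g w) (Set.Ioo (-ε) ε))
    {h : ℝ} (h0 : 0 < h) (hε : h < ε) :
    ∀ᵐ ω ∂P, ∀ j, DifferentiableAt ℝ G ((inner ℝ (X j ω) β₀ - Y j ω) / h) := by
  have hms : MeasurableSet {v | DifferentiableAt ℝ G v} := measurableSet_of_differentiableAt ℝ G
  rw [ae_all_iff]
  intro j
  have hmd : Measurable fun x : Vec d × Vec d × ℝ => (inner ℝ x.1 β₀ - x.2.2) / h :=
    ((measurable_fst.inner measurable_const).sub measurable_snd.snd).div_const h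
  refine hS.ae_obs j (p := fun x => DifferentiableAt ℝ G ((inner ℝ x.1 β₀ - x.2.2) / h))
    (hmd hms) ?_
  obtain ⟨K, hK⟩ := hG.lipschitz
  -- The bad set is treated as a kernel: it is supported in [-1, 1] and vanishes almost everywhere,
  -- so its conditional integral is zero.
  set k : ℝ → ℝ := {v | ¬ DifferentiableAt ℝ G v}.indicator 1 with hk
  have hkm : Measurable k := measurable_one.indicator hms.compl
  have hk1 : ∀ v, 1 < |v| → k v = 0 := fun v hv => by
    rw [hk, Set.indicator_of_notMem]
    simp only [Set.mem_ofPred_eq, not_not]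
    rcases lt_abs.1 hv with h | h
    · have : G =ᶠ[𝓝 v] fun _ => 1 := by
        filter_upwards [lt_mem_nhds h] with w hw using hG.eq_one w hw.le
      exact (differentiableAt_const _).congr_of_eventuallyEq this
    · have : G =ᶠ[𝓝 v] fun _ => 0 := by
        filter_upwards [gt_mem_nhds (show v < -1 by linarith)] with w hw using hG.eq_zero w hw.le
      exact (differentiableAt_const _).congr_of_eventuallyEq this
  have hk0 : k =ᵐ[volume] 0 := by
    filter_upwards [hK.ae_differentiableAt_real] with v hv
    simp [hk, hv]
  have hkn : ∀ v, 0 ≤ k v := fun v => Set.indicator_nonneg (fun _ _ => zero_le_one) _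
  have hkb : ∀ v, |k v| ≤ 1 := fun v => by
    rw [abs_of_nonneg (hkn v)]; exact Set.indicator_le_self' (fun _ _ => zero_le_one) v
  have hker := hf.ae_integral_kernel_eq hc
  have hz : ∀ᵐ w ∂(P.map fun ω => (Z 0 ω, X 0 ω)),
      ∫ u, k (-u / h) ∂(condDistrib (err X Y β₀ 0) (fun ω => (Z 0 ω, X 0 ω)) P w) = 0 := by
    filter_upwards [hker] with w hw
    rw [hw k h hk1 h0 hε, intervalIntegral.integral_congr_ae (g := fun _ => 0)]
    · simp
    · filter_upwards [hk0] with v hv _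
      simp [hv]
  have hWm : Measurable fun ω => (Z 0 ω, X 0 ω) := (hS.measurable_Z 0).prodMk (hS.measurable_X 0)
  obtain ⟨h1, h2⟩ := integrable_and_integral_eq_condDistrib (hS.measurable_err 0) hWm
    (Φ := fun p => k (-p.2 / h)) (hkm.comp (measurable_snd.neg.div_const h))
    (fun w => ⟨1, fun u => hkb _⟩) (D := fun _ => 0)
    (by filter_upwards [hz] with w hw
        simp_rw [abs_of_nonneg (hkn _)]; exact hw.le) (integrable_zero _ _ _)
  rw [integral_congr_ae (g := fun _ => (0 : ℝ)) (ae_of_ae_map hWm.aemeasurable hz),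
    integral_zero, integral_eq_zero_iff_of_nonneg (fun _ => hkn _) h1] at h2
  filter_upwards [h2] with ω hω
  by_contra hcon
  have e : -(err X Y β₀ 0 ω) / h = (inner ℝ (X 0 ω) β₀ - Y 0 ω) / h := by rw [err, neg_sub]
  simp only [e, hk, Pi.zero_apply] at hω
  rw [Set.indicator_of_mem (by exact hcon)] at hω
  simp at hω

/-- Conditional expectations of the slope kernel. -/
theorem ae_condDistrib_slope_le {𝓦 : Type*} [MeasurableSpace 𝓦] {U : Ω → ℝ} {W : Ω → 𝓦}
    {g : 𝓦 → ℝ → ℝ} {C : 𝓦 → ℝ} {ε : ℝ} (hG : SmoothingFunction r G) (hr : 2 < r)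
    (hf : HasCondDensityNear P U W g ε)
    (hsm : ∀ᵐ w ∂(P.map W), ContDiffOn ℝ r (g w) (Set.Ioo (-ε) ε))
    (hbd : ∀ᵐ w ∂(P.map W), ∀ s ≤ r, ∀ u ∈ Set.Ioo (-ε) ε, |iteratedDeriv s (g w) u| ≤ C w)
    {B : ℝ} (hB : ∀ v, |deriv G v| ≤ B) :
    ∀ᵐ w ∂(P.map W), ∀ h, 0 < h → h < ε →
      ∫ u, |deriv G (-u / h) / h| ∂(condDistrib U W P w) ≤ 2 * B * C w ∧
      |∫ u, deriv G (-u / h) / h ∂(condDistrib U W P w) - g w 0| ≤ 2 * B * C w * h ^ r := by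
  have hker := hf.ae_integral_kernel_eq (hsm.mono fun w hw => hw.continuousOn)
  filter_upwards [hker, hsm, hbd] with w hw hws hwb h h0 hhε
  constructor
  · simp_rw [abs_div, abs_of_pos h0]
    rw [hw (fun v => |deriv G v| / h) h (fun v hv => by simp [hG.deriv_eq_zero hv]) h0 hhε]
    -- No expansion here: the kernel |G'|/h is of size B/h, and the factor h of the substitution
    -- cancels it, leaving a bound uniform in h.
    have := abs_kernel_integral_sub_le (m := 0) (k := fun v => |deriv G v| / h) (f := g w)
      (B := B / h) (C := C w) (hws.of_le (by positivity))
      (fun u hu => by simpa using hwb 0 (by omega) u hu)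
      ((continuous_abs.measurable.comp (measurable_deriv G)).div_const h)
      (fun v => by
        rw [abs_div, abs_abs, abs_of_pos h0]; exact div_le_div_of_nonneg_right (hB v) h0.le)
      h0.le hhε
    simp only [Finset.range_zero, Finset.sum_empty, sub_zero, pow_zero, mul_one] at this
    calc h * _ ≤ h * (2 * (B / h) * C w) := mul_le_mul_of_nonneg_left
          ((le_abs_self _).trans this) h0.le
      _ = 2 * B * C w := by field_simp
  · rw [hw (fun v => deriv G v / h) h (fun v hv => by simp [hG.deriv_eq_zero hv]) h0 hhε]
    have e2 : h * ∫ v in (-1 : ℝ)..1, deriv G v / h * g w (-(h * v))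
        = ∫ v in (-1 : ℝ)..1, deriv G v * g w (-(h * v)) := by
      rw [← intervalIntegral.integral_const_mul]
      congr 1; funext v; field_simp
    rw [e2]
    have := abs_kernel_integral_sub_le (m := r) (k := deriv G) (f := g w)
      (B := B) (C := C w) hws (fun u hu => hwb r le_rfl u hu)
      (measurable_deriv G) hB h0.le hhε
    -- Of the Taylor polynomial only the constant term survives, with weight ∫ G' = 1.
    rw [Finset.sum_eq_single_of_mem 0 (Finset.mem_range.2 (by omega))] at this
    · simpa [hG.integral_one] using this
    · intro i hi hi0
      have hm := hG.moments_zero i (by omega) (by have := Finset.mem_range.1 hi; omega)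
      simp_rw [mul_comm (deriv G _)]
      rw [hm, mul_zero]

/-- The expected slopes, with the rate at which they approach `Σ_ZX`. -/
theorem exists_slope_bound (hS : Sampling P q X Z Y β₀) (hG : SmoothingFunction r G)
    (hL : CondLawGivenZX P r X Z Y β₀ g C) :
    ∃ ε > 0, ∃ K, ∀ h, 0 < h → h < ε → ∀ a b,
      Integrable (fun ω => slope G β₀ h a b (X 0 ω, Z 0 ω, Y 0 ω)) P ∧
      |∫ ω, slope G β₀ h a b (X 0 ω, Z 0 ω, Y 0 ω) ∂P - sigmaZX P X Z g a b| ≤ K * h ^ r := by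
  obtain ⟨ε, hε, hf, hsm, hbd⟩ := hL.smooth
  obtain ⟨B, hB1, -, hB, -⟩ := hG.exists_bound
  have hWm : Measurable fun ω => (Z 0 ω, X 0 ω) := (hS.measurable_Z 0).prodMk (hS.measurable_X 0)
  have hzero : (0 : ℝ) ∈ Set.Ioo (-ε) ε := ⟨by linarith, hε⟩
  have hr := hL.order
  set κ := condDistrib (err X Y β₀ 0) (fun ω => (Z 0 ω, X 0 ω)) P with hκ
  have hdom := hL.dominated
  have hker' := ae_condDistrib_slope_le hG hr hf hsm hbd hB
  have hker'' := ae_of_ae_map hWm.aemeasurable hker'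
  have hCnn : ∀ᵐ w ∂(P.map fun ω => (Z 0 ω, X 0 ω)), 0 ≤ C w := by
    filter_upwards [hbd] with w hw using (abs_nonneg _).trans (hw 0 (by omega) 0 hzero)
  have hCn := ae_of_ae_map hWm.aemeasurable hCnn
  have hZX : ∀ (a b : Fin d) ω, |Z 0 ω a * X 0 ω b| ≤ ‖Z 0 ω‖ * ‖X 0 ω‖ := fun a b ω => by
    rw [abs_mul]
    exact mul_le_mul (abs_coord_le _ _) (abs_coord_le _ _) (abs_nonneg _) (norm_nonneg _)
  have hslope : ∀ h, 0 < h → h < ε → ∀ a b,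
      Integrable (fun ω => slope G β₀ h a b (X 0 ω, Z 0 ω, Y 0 ω)) P ∧
      ∫ ω, slope G β₀ h a b (X 0 ω, Z 0 ω, Y 0 ω) ∂P
        = ∫ ω, Z 0 ω a * X 0 ω b * ∫ u, deriv G (-u / h) / h ∂(κ (Z 0 ω, X 0 ω)) ∂P := by
    intro h h0 hhε a b
    have := integrable_and_integral_eq_condDistrib (hS.measurable_err 0) hWm
      (Φ := fun p => p.1.1 a * p.1.2 b * (deriv G (-p.2 / h) / h))
      (by
        refine (((measurable_coord a).comp measurable_fst.fst).mul
          ((measurable_coord b).comp measurable_fst.snd)).mul ?_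
        exact ((measurable_deriv G).comp (measurable_snd.neg.div_const h)).div_const h)
      (fun w => ⟨|w.1 a * w.2 b| * (B / h), fun u => by
        rw [abs_mul, abs_div, abs_of_pos h0]
        exact mul_le_mul_of_nonneg_left (div_le_div_of_nonneg_right (hB _) h0.le) (abs_nonneg _)⟩)
      (D := fun w => 2 * B * (C w * ‖w.1‖ * ‖w.2‖))
      (by
        filter_upwards [hker', hCnn] with w hw hCw
        simp_rw [abs_mul (w.1 a * w.2 b)]
        rw [integral_const_mul]
        calc |w.1 a * w.2 b| * _ ≤ (‖w.1‖ * ‖w.2‖) * (2 * B * C w) := by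
              refine mul_le_mul ?_ (hw h h0 hhε).1 (integral_nonneg fun _ => abs_nonneg _)
                (by positivity)
              rw [abs_mul]
              exact mul_le_mul (abs_coord_le _ _) (abs_coord_le _ _) (abs_nonneg _)
                (norm_nonneg _)
          _ = _ := by ring)
      (hdom.const_mul _)
    simp only [integral_const_mul] at this
    simpa only [slope, err, neg_sub] using this
  -- measurability of the limit
  have hgm : AEStronglyMeasurable (fun ω => g (Z 0 ω, X 0 ω) 0) P := by
    have hseq : Tendsto (fun n : ℕ => ε / ((n : ℝ) + 2)) atTop (𝓝[>] 0) := by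
      rw [tendsto_nhdsWithin_iff]
      refine ⟨?_, Eventually.of_forall fun n => by simp; positivity⟩
      exact (tendsto_const_nhds.div_atTop
        (tendsto_atTop_add_const_right _ 2 tendsto_natCast_atTop_atTop))
    refine aestronglyMeasurable_of_tendsto_ae atTop
      (f := fun (n : ℕ) ω => ∫ u, deriv G (-u / (ε / ((n : ℝ) + 2))) / (ε / ((n : ℝ) + 2))
        ∂(κ (Z 0 ω, X 0 ω))) ?_ ?_
    · intro n
      have : StronglyMeasurable fun p : (Vec d × Vec d) × ℝ =>
          deriv G (-p.2 / (ε / ((n : ℝ) + 2))) / (ε / ((n : ℝ) + 2)) :=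
        (((measurable_deriv G).comp (measurable_snd.neg.div_const _)).div_const
            _).stronglyMeasurable
      exact (this.integral_condDistrib.comp_measurable hWm).aestronglyMeasurable
    · filter_upwards [hker''] with ω hω
      have hz : Tendsto (fun h : ℝ => 2 * B * C (Z 0 ω, X 0 ω) * h ^ r) (𝓝[>] 0) (𝓝 0) := by
        have : Tendsto (fun h : ℝ => 2 * B * C (Z 0 ω, X 0 ω) * h ^ r) (𝓝 0)
            (𝓝 (2 * B * C (Z 0 ω, X 0 ω) * 0 ^ r)) := by
          apply Continuous.tendsto; fun_prop
        rw [zero_pow (by omega), mul_zero] at this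
        exact this.mono_left nhdsWithin_le_nhds
      have hlim : Tendsto (fun h : ℝ => ∫ u, deriv G (-u / h) / h ∂(κ (Z 0 ω, X 0 ω)))
          (𝓝[>] 0) (𝓝 (g (Z 0 ω, X 0 ω) 0)) := by
        rw [tendsto_iff_norm_sub_tendsto_zero]
        refine squeeze_zero' (Eventually.of_forall fun _ => norm_nonneg _) ?_ hz
        filter_upwards [Ioo_mem_nhdsGT hε] with h hh using (hω h hh.1 hh.2).2
      exact hlim.comp hseq
  have hgb : ∀ᵐ ω ∂P, |g (Z 0 ω, X 0 ω) 0| ≤ C (Z 0 ω, X 0 ω) := by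
    refine ae_of_ae_map (p := fun w => |g w 0| ≤ C w) hWm.aemeasurable ?_
    filter_upwards [hbd] with w hw
    simpa using hw 0 (by omega) 0 hzero
  have hcm : ∀ (V : ℕ → Ω → Vec d), (∀ j, Measurable (V j)) → ∀ a, Measurable fun ω => V 0 ω a :=
    fun V hV a => (measurable_coord a).comp (hV 0)
  refine ⟨ε, hε, ∫ ω, 2 * B * (C (Z 0 ω, X 0 ω) * ‖Z 0 ω‖ * ‖X 0 ω‖) ∂P,
    fun h h0 hhε a b => ⟨(hslope h h0 hhε a b).1, ?_⟩⟩
  have hkm : StronglyMeasurable fun w => ∫ u, deriv G (-u / h) / h ∂(κ w) := by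
    have : StronglyMeasurable fun p : (Vec d × Vec d) × ℝ => deriv G (-p.2 / h) / h :=
      (((measurable_deriv G).comp (measurable_snd.neg.div_const _)).div_const _).stronglyMeasurable
    exact this.integral_condDistrib
  have hi1 : Integrable (fun ω => Z 0 ω a * X 0 ω b *
      ∫ u, deriv G (-u / h) / h ∂(κ (Z 0 ω, X 0 ω))) P := by
    refine (hdom.const_mul (2 * B)).mono' ?_ ?_
    · exact (((hcm Z hS.measurable_Z a).mul (hcm X hS.measurable_X b)).aestronglyMeasurable).mul
        (hkm.comp_measurable hWm).aestronglyMeasurable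
    · filter_upwards [hker'', hCn] with ω hω hC0
      rw [Real.norm_eq_abs, abs_mul]
      calc _ ≤ (‖Z 0 ω‖ * ‖X 0 ω‖) * (2 * B * C (Z 0 ω, X 0 ω)) := by
            refine mul_le_mul (hZX a b ω) ?_ (abs_nonneg _) (by positivity)
            exact (abs_integral_le_integral_abs).trans (hω h h0 hhε).1
        _ = _ := by ring
  have hi2 : Integrable (fun ω => Z 0 ω a * X 0 ω b * g (Z 0 ω, X 0 ω) 0) P := by
    refine hdom.mono' ?_ ?_
    · exact (((hcm Z hS.measurable_Z a).mul (hcm X hS.measurable_X b)).aestronglyMeasurable).mul hgm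
    · filter_upwards [hgb] with ω hω
      rw [Real.norm_eq_abs, abs_mul]
      calc _ ≤ (‖Z 0 ω‖ * ‖X 0 ω‖) * C (Z 0 ω, X 0 ω) :=
            mul_le_mul (hZX a b ω) hω (abs_nonneg _) (by positivity)
        _ = _ := by ring
  rw [(hslope h h0 hhε a b).2, sigmaZX, Matrix.of_apply, ← integral_sub hi1 hi2,
    ← integral_mul_const, ← Real.norm_eq_abs]
  refine norm_integral_le_of_norm_le ((hdom.const_mul (2 * B)).mul_const _) ?_
  filter_upwards [hker'', hCn] with ω hω hC0
  rw [← mul_sub, Real.norm_eq_abs, abs_mul]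
  calc _ ≤ (‖Z 0 ω‖ * ‖X 0 ω‖) * (2 * B * C (Z 0 ω, X 0 ω) * h ^ r) :=
        mul_le_mul (hZX a b ω) (hω h h0 hhε).2 (abs_nonneg _) (by positivity)
    _ = _ := by ring

/-- For n ≠ 0 the mean Jacobian depends on n only through h: it is the mean of an average of
identically distributed slopes, and the almost sure differentiability makes the partial derivatives
equal to that average. -/
theorem exists_jacobian_eq (hS : Sampling P q X Z Y β₀) (hG : SmoothingFunction r G)
    (hL : CondLawGivenZX P r X Z Y β₀ g C) :
    ∃ ε > 0, ∀ n : ℕ, n ≠ 0 → ∀ h, 0 < h → h < ε → ∀ a b,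
      Integrable (fun ω => jacobian q G X Z Y β₀ n h ω a b) P ∧
      meanJacobian P q G X Z Y β₀ n h a b
        = ∫ ω, slope G β₀ h a b (X 0 ω, Z 0 ω, Y 0 ω) ∂P := by
  obtain ⟨ε, hε, K, hK⟩ := exists_slope_bound hS hG hL
  obtain ⟨ε', hε', hf, hsm, hbd⟩ := hL.smooth
  refine ⟨min ε ε', lt_min hε hε', fun n hn h h0 hh a b => ?_⟩
  have hae := ae_differentiableAt_obs hS hG hf (hsm.mono fun w hw => hw.continuousOn) h0
    (hh.trans_le (min_le_right _ _))
  have hi0 := (hK h h0 (hh.trans_le (min_le_left _ _)) a b).1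
  have hij : ∀ j, Integrable (fun ω => slope G β₀ h a b (X j ω, Z j ω, Y j ω)) P := fun j =>
    hS.integrable_obs j (measurable_slope h a b) hi0
  have he : (fun ω => jacobian q G X Z Y β₀ n h ω a b) =ᵐ[P] fun ω =>
      (n : ℝ)⁻¹ * ∑ j ∈ Finset.range n, slope G β₀ h a b (X j ω, Z j ω, Y j ω) := by
    filter_upwards [hae] with ω hω using jacobian_eq_of_differentiableAt n h hω a b
  refine ⟨((integrable_finsetSum _ fun j _ => hij j).const_mul _).congr he.symm, ?_⟩
  rw [meanJacobian, Matrix.of_apply, integral_congr_ae he, integral_const_mul,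
    integral_finsetSum _ fun j _ => hij j]
  simp_rw [fun j => hS.integral_obs_eq j (measurable_slope (G := G) (β₀ := β₀) h a b)]
  rw [Finset.sum_const, Finset.card_range, nsmul_eq_mul, inv_mul_cancel_left₀]
  exact_mod_cast hn

end Jacobian

end SEE

namespace SEE

variable {Ω : Type*} [MeasurableSpace Ω] {d : ℕ}

/-! ### First and second moments of the smoothed scores -/

section Moments

variable {P : Measure Ω} [IsProbabilityMeasure P] {r : ℕ} {q : ℝ} {X Z : ℕ → Ω → Vec d}
  {Y : ℕ → Ω → ℝ} {β₀ : Vec d} {G : ℝ → ℝ} {f : Vec d → ℝ → ℝ}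

/-- One limit for both moments: the bias takes m = r - 1 with the defect, the variance m = 0 with
the difference of squared scores. One power of h comes from the substitution, m from the vanishing
moments, and 2BC|ψ| dominates. The case m = 1 is left out because the first derivative of f carries
no bound; r > 2 guarantees r - 1 ≠ 1. -/
theorem tendsto_inv_mul_integral_kernel (hS : Sampling P q X Z Y β₀) {ε : ℝ} (hε : 0 < ε)
    (hf : HasCondDensityNear P (err X Y β₀ 0) (Z 0) f ε)
    (hsm : ∀ᵐ z ∂(P.map (Z 0)), ContDiffOn ℝ r (f z) (Set.Ioo (-ε) ε)) {C : Vec d → ℝ}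
    (hbd : ∀ᵐ z ∂(P.map (Z 0)), ∀ s ≤ r, s ≠ 1 → ∀ u ∈ Set.Ioo (-ε) ε,
        |iteratedDeriv s (f z) u| ≤ C z)
    {k : ℝ → ℝ} {B : ℝ} {m : ℕ} (hm : m ≤ r) (hm1 : m ≠ 1) (hk : Measurable k)
    (hB : ∀ v, |k v| ≤ B) (hk1 : ∀ v, 1 < |v| → k v = 0)
    (hmom : ∀ i < m, ∫ v in (-1 : ℝ)..1, k v * v ^ i = 0)
    (hne : ∫ v in (-1 : ℝ)..1, k v * v ^ m ≠ 0)
    {ψ : Vec d → ℝ} (hψ : Measurable ψ) (hψC : Integrable (fun ω => C (Z 0 ω) * |ψ (Z 0 ω)|) P) :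
    Integrable (fun ω => ψ (Z 0 ω) * iteratedDeriv m (f (Z 0 ω)) 0) P ∧
    (∀ h, 0 < h → h < ε → Integrable (fun ω => ψ (Z 0 ω) * k (-err X Y β₀ 0 ω / h)) P) ∧
    Tendsto (fun h : ℝ => (h ^ (m + 1))⁻¹ * ∫ ω, ψ (Z 0 ω) * k (-err X Y β₀ 0 ω / h) ∂P) (𝓝[>] 0)
      (𝓝 ((-1) ^ m / m.factorial * (∫ v in (-1 : ℝ)..1, k v * v ^ m)
        * ∫ ω, ψ (Z 0 ω) * iteratedDeriv m (f (Z 0 ω)) 0 ∂P)) := by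
  have hZ := hS.measurable_Z 0
  have hB0 : 0 ≤ B := (abs_nonneg _).trans (hB 0)
  have hzero : (0 : ℝ) ∈ Set.Ioo (-ε) ε := ⟨by linarith, hε⟩
  have hker := hf.ae_integral_kernel_eq (hsm.mono fun w hw => hw.continuousOn)
  set κ := condDistrib (err X Y β₀ 0) (Z 0) P with hκ
  have hCn : ∀ᵐ z ∂(P.map (Z 0)), 0 ≤ C z := by
    filter_upwards [hbd] with w hw using (abs_nonneg _).trans (hw 0 (by omega) (by omega) 0 hzero)
  -- conditional integrals
  have hc1 : ∀ᵐ z ∂(P.map (Z 0)), ∀ h, 0 < h → h < ε →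
      ∫ u, |k (-u / h)| ∂(κ z) ≤ h * (2 * B * C z) ∧
      |(h ^ (m + 1))⁻¹ * ∫ u, k (-u / h) ∂(κ z)| ≤ 2 * B * C z := by
    filter_upwards [hker, hsm, hbd] with z hz hzs hzb h h0 hhε
    constructor
    · rw [hz (fun v => |k v|) h (fun v hv => by simp [hk1 v hv]) h0 hhε]
      refine mul_le_mul_of_nonneg_left ((le_abs_self _).trans ?_) h0.le
      have := abs_kernel_integral_sub_le (m := 0) (k := fun v => |k v|) (f := f z)
        (B := B) (C := C z) (hzs.of_le (by positivity))
        (fun u hu => by simpa using hzb 0 (by omega) (by omega) u hu)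
        (continuous_abs.measurable.comp hk) (fun v => by rw [abs_abs]; exact hB v) h0.le hhε
      simpa using this
    · rw [hz k h hk1 h0 hhε]
      have := abs_kernel_integral_sub_le (m := m) (k := k) (f := f z)
        (B := B) (C := C z) (hzs.of_le (by exact_mod_cast hm)) (hzb m hm hm1) hk hB h0.le hhε
      rw [Finset.sum_eq_zero fun i hi => by rw [hmom i (Finset.mem_range.1 hi), mul_zero],
        sub_zero] at this
      rw [pow_succ, mul_inv, mul_assoc, inv_mul_cancel_left₀ h0.ne', abs_mul, abs_inv,
        abs_of_pos (pow_pos h0 m), inv_mul_le_iff₀ (pow_pos h0 m)]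
      linarith
  have hc2 : ∀ᵐ z ∂(P.map (Z 0)), Tendsto (fun h : ℝ => (h ^ (m + 1))⁻¹ * ∫ u, k (-u / h) ∂(κ z))
      (𝓝[>] 0) (𝓝 ((-1) ^ m / m.factorial * (∫ v in (-1 : ℝ)..1, k v * v ^ m)
        * iteratedDeriv m (f z) 0)) := by
    filter_upwards [hker, hsm, hbd] with z hz hzs hzb
    have := tendsto_kernel_integral (m := m) hε (hzs.of_le (by exact_mod_cast hm)) (hzb m hm hm1)
      hk hB hmom
    rw [mul_right_comm] at this
    refine this.congr' ?_
    filter_upwards [Ioo_mem_nhdsGT hε] with h hh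
    rw [hz k h hk1 hh.1 hh.2, pow_succ, mul_inv, mul_assoc, inv_mul_cancel_left₀ hh.1.ne']
  have hc1' := ae_of_ae_map hZ.aemeasurable hc1
  have hc2' := ae_of_ae_map hZ.aemeasurable hc2
  have hCn' := ae_of_ae_map hZ.aemeasurable hCn
  have hkm : ∀ h : ℝ, Measurable fun ω => ∫ u, k (-u / h) ∂(κ (Z 0 ω)) := fun h => by
    have : StronglyMeasurable fun p : Vec d × ℝ => k (-p.2 / h) :=
      (hk.comp (measurable_snd.neg.div_const h)).stronglyMeasurable
    exact this.integral_condDistrib.measurable.comp hZ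
  have hE : ∀ h, 0 < h → h < ε → Integrable (fun ω => ψ (Z 0 ω) * k (-err X Y β₀ 0 ω / h)) P ∧
      ∫ ω, ψ (Z 0 ω) * k (-err X Y β₀ 0 ω / h) ∂P
        = ∫ ω, ψ (Z 0 ω) * ∫ u, k (-u / h) ∂(κ (Z 0 ω)) ∂P := fun h h0 hhε => by
    have := integrable_and_integral_eq_condDistrib (hS.measurable_err 0) hZ
      (Φ := fun p => ψ p.1 * k (-p.2 / h))
      ((hψ.comp measurable_fst).mul (hk.comp (measurable_snd.neg.div_const h)))
      (fun w => ⟨|ψ w| * B, fun u => by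
        rw [abs_mul]; exact mul_le_mul_of_nonneg_left (hB _) (abs_nonneg _)⟩)
      (D := fun w => h * (2 * B) * (C w * |ψ w|))
      (by
        filter_upwards [hc1] with z hz
        simp_rw [abs_mul]
        rw [integral_const_mul]
        calc _ ≤ |ψ z| * (h * (2 * B * C z)) :=
              mul_le_mul_of_nonneg_left (hz h h0 hhε).1 (abs_nonneg _)
          _ = _ := by ring)
      (hψC.const_mul _)
    simpa only [integral_const_mul] using this
  set c : ℝ := (-1) ^ m / m.factorial * (∫ v in (-1 : ℝ)..1, k v * v ^ m) with hc
  have hc0 : c ≠ 0 := by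
    refine mul_ne_zero (div_ne_zero (pow_ne_zero _ (by norm_num)) ?_) hne
    exact_mod_cast m.factorial_ne_zero
  have hseq : Tendsto (fun n : ℕ => ε / ((n : ℝ) + 2)) atTop (𝓝[>] 0) := by
    rw [tendsto_nhdsWithin_iff]
    refine ⟨?_, Eventually.of_forall fun n => by simp; positivity⟩
    exact (tendsto_const_nhds.div_atTop
      (tendsto_atTop_add_const_right _ 2 tendsto_natCast_atTop_atTop))
  -- Measurability of z ↦ f(z, ·) is not assumed. The derivative at 0 is recovered as an almost
  -- everywhere limit of kernel averages under `condDistrib`, which are measurable; dividing by c is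
  -- where the nonzero m-th moment enters.
  have hdm : AEStronglyMeasurable (fun ω => iteratedDeriv m (f (Z 0 ω)) 0) P := by
    refine aestronglyMeasurable_of_tendsto_ae atTop
      (f := fun (n : ℕ) ω => c⁻¹ * (((ε / ((n : ℝ) + 2)) ^ (m + 1))⁻¹ *
        ∫ u, k (-u / (ε / ((n : ℝ) + 2))) ∂(κ (Z 0 ω)))) ?_ ?_
    · intro n
      exact (((hkm _).const_mul _).const_mul _).aestronglyMeasurable
    · filter_upwards [hc2'] with ω hω
      have := (hω.comp hseq).const_mul c⁻¹
      rwa [inv_mul_cancel_left₀ hc0] at this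
  refine ⟨?_, fun h h0 hhε => (hE h h0 hhε).1, ?_⟩
  · refine hψC.mono' ((hψ.comp hZ).aestronglyMeasurable.mul hdm) ?_
    filter_upwards [ae_of_ae_map hZ.aemeasurable hbd] with ω hω
    rw [Real.norm_eq_abs, abs_mul, mul_comm]
    exact mul_le_mul_of_nonneg_right (hω m hm hm1 0 hzero) (abs_nonneg _)
  · rw [← integral_const_mul]
    have hev : ∀ᶠ h : ℝ in 𝓝[>] 0, h ∈ Set.Ioo 0 ε := Ioo_mem_nhdsGT hε
    have hcong : ∀ᶠ h : ℝ in 𝓝[>] 0,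
        ∫ ω, ψ (Z 0 ω) * ((h ^ (m + 1))⁻¹ * ∫ u, k (-u / h) ∂(κ (Z 0 ω))) ∂P
        = (h ^ (m + 1))⁻¹ * ∫ ω, ψ (Z 0 ω) * k (-err X Y β₀ 0 ω / h) ∂P := by
      filter_upwards [hev] with h hh
      rw [(hE h hh.1 hh.2).2, ← integral_const_mul]
      congr 1; funext ω; ring
    refine Tendsto.congr' hcong ?_
    refine tendsto_integral_filter_of_dominated_convergence
      (fun ω => 2 * B * (C (Z 0 ω) * |ψ (Z 0 ω)|)) ?_ ?_ (hψC.const_mul _) ?_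
    · exact Eventually.of_forall fun h =>
        ((hψ.comp hZ).mul ((hkm h).const_mul _)).aestronglyMeasurable
    · filter_upwards [hev] with h hh
      filter_upwards [hc1'] with ω hω
      rw [Real.norm_eq_abs, abs_mul]
      calc _ ≤ |ψ (Z 0 ω)| * (2 * B * C (Z 0 ω)) :=
            mul_le_mul_of_nonneg_left (hω h hh.1 hh.2).2 (abs_nonneg _)
        _ = _ := by ring
    · filter_upwards [hc2'] with ω hω
      have := hω.const_mul (ψ (Z 0 ω))
      rwa [show ψ (Z 0 ω) * (c * iteratedDeriv m (f (Z 0 ω)) 0)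
        = c * (ψ (Z 0 ω) * iteratedDeriv m (f (Z 0 ω)) 0) by ring] at this

/-- The unsmoothed indicator is invariant under the scaling by h, so the indicator inside the defect
at -U/h is 1{U < 0} for every bandwidth. -/
theorem indicator_err_neg {Ω : Type*} {X : ℕ → Ω → Vec d} {Y : ℕ → Ω → ℝ} {h : ℝ} (h0 : 0 < h) (ω
    : Ω) :
    Set.indicator {ω' | err X Y β₀ 0 ω' < 0} (1 : Ω → ℝ) ω
      = (Set.Ioi (0 : ℝ)).indicator 1 (-err X Y β₀ 0 ω / h) := by
  have : err X Y β₀ 0 ω < 0 ↔ 0 < -err X Y β₀ 0 ω / h := by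
    rw [lt_div_iff₀ h0, zero_mul, neg_pos]
  by_cases hω : err X Y β₀ 0 ω < 0
  · rw [Set.indicator_of_mem (by exact hω), Set.indicator_of_mem (by exact this.1 hω)]; rfl
  · rw [Set.indicator_of_notMem (by exact hω),
      Set.indicator_of_notMem (by exact fun hc => hω (this.2 hc))]

/-- `E[1{U < 0} ψ(Z)] = q E[ψ(Z)]`. -/
theorem integral_mul_indicator_err (hS : Sampling P q X Z Y β₀) (hq0 : 0 ≤ q)
    (hq : ∀ᵐ z ∂(P.map (Z 0)),
      condDistrib (err X Y β₀ 0) (Z 0) P z (Set.Iio 0) = ENNReal.ofReal q)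
    {ψ : Vec d → ℝ} (hψ : Measurable ψ) (hi : Integrable (fun ω => ψ (Z 0 ω)) P) :
    ∫ ω, ψ (Z 0 ω) * Set.indicator {ω' | err X Y β₀ 0 ω' < 0} (1 : Ω → ℝ) ω ∂P
      = q * ∫ ω, ψ (Z 0 ω) ∂P := by
  have hZ := hS.measurable_Z 0
  have hm : Measurable ((Set.Iio (0 : ℝ)).indicator (1 : ℝ → ℝ)) :=
    measurable_one.indicator measurableSet_Iio
  have hi1 : ∀ u : ℝ, |(Set.Iio (0 : ℝ)).indicator (1 : ℝ → ℝ) u| ≤ 1 := fun u => by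
    by_cases hu : u ∈ Set.Iio (0 : ℝ) <;> simp [hu]
  have hval : ∀ᵐ z ∂(P.map (Z 0)), ∫ u, (Set.Iio (0 : ℝ)).indicator (1 : ℝ → ℝ) u
      ∂(condDistrib (err X Y β₀ 0) (Z 0) P z) = q := by
    filter_upwards [hq] with z hz
    rw [integral_indicator_one measurableSet_Iio, measureReal_def, hz, ENNReal.toReal_ofReal hq0]
  have := (integrable_and_integral_eq_condDistrib (hS.measurable_err 0) hZ
      (Φ := fun p => ψ p.1 * (Set.Iio (0 : ℝ)).indicator 1 p.2)
      ((hψ.comp measurable_fst).mul (hm.comp measurable_snd))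
      (fun w => ⟨|ψ w| * 1, fun u => by
        rw [abs_mul]; exact mul_le_mul_of_nonneg_left (hi1 u) (abs_nonneg _)⟩)
      (D := fun w => |ψ w|)
      (by
        refine ae_of_all _ fun w => ?_
        simp_rw [abs_mul]
        rw [integral_const_mul]
        refine mul_le_of_le_one_right (abs_nonneg _) ?_
        refine (integral_mono_of_nonneg (ae_of_all _ fun _ => abs_nonneg _)
          (integrable_const 1) (ae_of_all _ hi1)).trans ?_
        simp) hi.abs).2
  simp only [integral_const_mul] at this
  have e : ∀ ω, Set.indicator {ω' | err X Y β₀ 0 ω' < 0} (1 : Ω → ℝ) ω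
      = (Set.Iio (0 : ℝ)).indicator 1 (err X Y β₀ 0 ω) := fun ω => rfl
  simp_rw [e]
  rw [this, ← integral_const_mul]
  refine integral_congr_ae ?_
  filter_upwards [ae_of_ae_map hZ.aemeasurable hval] with ω hω
  rw [hω, mul_comm]

end Moments

end SEE

namespace SEE

variable {Ω : Type*} [MeasurableSpace Ω] {d : ℕ}

/-! ### Scores -/

/-- The contribution `Z_a [G((X'β - Y) / h) - q]` of an observation `(X, Z, Y)` to `m_n(β)`. -/
def score (q : ℝ) (G : ℝ → ℝ) (h : ℝ) (β : Vec d) (a : Fin d) (x : Vec d × Vec d × ℝ) : ℝ :=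
  (G ((inner ℝ x.1 β - x.2.2) / h) - q) * x.2.1 a

theorem ee_apply {Ω : Type*} (q : ℝ) (G : ℝ → ℝ) (X Z : ℕ → Ω → Vec d) (Y : ℕ → Ω → ℝ) (n : ℕ)
    (h : ℝ) (β : Vec d) (ω : Ω) (a : Fin d) :
    ee q G X Z Y n h β ω a
      = (√(n : ℝ))⁻¹ * ∑ j ∈ Finset.range n, score q G h β a (X j ω, Z j ω, Y j ω) := by
  simp [ee, score, PiLp.smul_apply, Finset.sum_apply]

section Scores

variable {P : Measure Ω} {r : ℕ} {q : ℝ} {X Z : ℕ → Ω → Vec d}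
  {Y : ℕ → Ω → ℝ} {β₀ : Vec d} {G : ℝ → ℝ} {f : Vec d → ℝ → ℝ}

theorem measurable_score (hG : SmoothingFunction r G) (q h : ℝ) (β : Vec d) (a : Fin d) :
    Measurable (score q G h β a) := by
  refine ((hG.measurable.comp ?_).sub_const q).mul ((measurable_coord a).comp measurable_snd.fst)
  exact ((measurable_fst.inner measurable_const).sub measurable_snd.snd).div_const h

/-- The scores are uniformly bounded. -/
theorem exists_score_bound (hS : Sampling P q X Z Y β₀) (hI : Instruments P Z)
    (hG : SmoothingFunction r G) (hq0 : 0 < q) (hq1 : q < 1) :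
    ∃ b : ℝ, 1 ≤ b ∧ ∀ᵐ ω ∂P, ∀ (j : ℕ) (h : ℝ) (β : Vec d) (a : Fin d),
      |score q G h β a (X j ω, Z j ω, Y j ω)| ≤ b := by
  obtain ⟨B, hB1, hB, -, -⟩ := hG.exists_bound
  obtain ⟨M, hM⟩ := hI.bounded
  have hj : ∀ᵐ ω ∂P, ∀ j, ‖Z j ω‖ ≤ M := by
    rw [ae_all_iff]
    intro j
    exact hS.ae_obs j (p := fun x => ‖x.2.1‖ ≤ M)
      (measurableSet_le measurable_snd.fst.norm measurable_const) hM
  refine ⟨(B + 1) * max M 1, ?_, ?_⟩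
  · nlinarith [le_max_right M 1]
  · filter_upwards [hj] with ω hω j h β a
    rw [score, abs_mul]
    refine mul_le_mul ?_ ((abs_coord_le _ _).trans ((hω j).trans (le_max_left _ _)))
      (abs_nonneg _) (by linarith)
    refine (abs_sub _ _).trans ?_
    rw [abs_of_pos hq0]
    exact add_le_add (hB _) hq1.le

/-- The square root of the variance matrix is invertible. -/
theorem isUnit_det_sqrt (hI : Instruments P Z) (hq0 : 0 < q) (hq1 : q < 1)
    {S : Matrix (Fin d) (Fin d) ℝ} (hS : S * Sᵀ = asympVar P q Z) : IsUnit S.det := by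
  have h1 : (asympVar P q Z).det ≠ 0 := by
    rw [asympVar, Matrix.det_smul]
    have : q * (1 - q) ≠ 0 := (mul_pos hq0 (by linarith)).ne'
    exact mul_ne_zero (pow_ne_zero _ this) hI.nonsingular.ne_zero
  rw [← hS, Matrix.det_mul] at h1
  exact isUnit_iff_ne_zero.2 (left_ne_zero_of_mul h1)

theorem asympVar_apply (a b : Fin d) :
    asympVar P q Z a b = q * (1 - q) * ∫ ω, Z 0 ω a * Z 0 ω b ∂P := by
  simp [asympVar, secondMoment]

theorem Instruments.exists_bound (hI : Instruments P Z) :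
    ∃ M : ℝ, 1 ≤ M ∧ ∀ᵐ ω ∂P, ‖Z 0 ω‖ ≤ M := by
  obtain ⟨M, hM⟩ := hI.bounded
  exact ⟨max M 1, le_max_right _ _, hM.mono fun ω h => h.trans (le_max_left _ _)⟩

variable [IsProbabilityMeasure P]

theorem integrable_score (hS : Sampling P q X Z Y β₀) (hI : Instruments P Z)
    (hG : SmoothingFunction r G) (hq0 : 0 < q) (hq1 : q < 1) (j : ℕ) (h : ℝ) (β : Vec d)
    (a : Fin d) : Integrable (fun ω => score q G h β a (X j ω, Z j ω, Y j ω)) P := by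
  obtain ⟨b, -, hb⟩ := exists_score_bound hS hI hG hq0 hq1
  refine Integrable.of_bound
    ((measurable_score hG q h β a).comp (hS.measurable_obs j)).aestronglyMeasurable b ?_
  filter_upwards [hb] with ω hω using hω j h β a

theorem integrable_score_mul (hS : Sampling P q X Z Y β₀) (hI : Instruments P Z)
    (hG : SmoothingFunction r G) (hq0 : 0 < q) (hq1 : q < 1) (i j : ℕ) (h : ℝ) (β : Vec d)
    (a b : Fin d) : Integrable (fun ω => score q G h β a (X i ω, Z i ω, Y i ω) *
      score q G h β b (X j ω, Z j ω, Y j ω)) P := by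
  obtain ⟨K, hK1, hK⟩ := exists_score_bound hS hI hG hq0 hq1
  refine (integrable_score hS hI hG hq0 hq1 j h β b).bdd_mul
    ((measurable_score hG q h β a).comp (hS.measurable_obs i)).aestronglyMeasurable
    (c := K) ?_
  filter_upwards [hK] with ω hω using hω i h β a

/-- `E[Z_a (G(-U/h) - q)]`. -/
def meanScore (P : Measure Ω) (q : ℝ) (G : ℝ → ℝ) (X Z : ℕ → Ω → Vec d) (Y : ℕ → Ω → ℝ)
    (h : ℝ) (β : Vec d) (a : Fin d) : ℝ :=
  ∫ ω, score q G h β a (X 0 ω, Z 0 ω, Y 0 ω) ∂P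

/-- `E[Z_a Z_b (G(-U/h) - q)²]`. -/
def meanScoreSq (P : Measure Ω) (q : ℝ) (G : ℝ → ℝ) (X Z : ℕ → Ω → Vec d) (Y : ℕ → Ω → ℝ)
    (h : ℝ) (β : Vec d) (a b : Fin d) : ℝ :=
  ∫ ω, score q G h β a (X 0 ω, Z 0 ω, Y 0 ω) * score q G h β b (X 0 ω, Z 0 ω, Y 0 ω) ∂P

/-- The double sum divided by n has n diagonal terms, each with mean E[s_a s_b], and n(n-1)
off-diagonal ones, which factor by independence. -/
theorem integral_ee_mul_ee (hS : Sampling P q X Z Y β₀) (hI : Instruments P Z)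
    (hG : SmoothingFunction r G) (hq0 : 0 < q) (hq1 : q < 1) {n : ℕ} (hn : n ≠ 0) (h : ℝ)
    (β : Vec d) (a b : Fin d) :
    Integrable (fun ω => ee q G X Z Y n h β ω a * ee q G X Z Y n h β ω b) P ∧
    ∫ ω, ee q G X Z Y n h β ω a * ee q G X Z Y n h β ω b ∂P
      = meanScoreSq P q G X Z Y h β a b
        + ((n : ℝ) - 1) * (meanScore P q G X Z Y h β a * meanScore P q G X Z Y h β b) := by
  have hnn : (√(n : ℝ))⁻¹ * (√(n : ℝ))⁻¹ = (n : ℝ)⁻¹ := by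
    rw [← mul_inv, Real.mul_self_sqrt (Nat.cast_nonneg n)]
  have e : ∀ ω, ee q G X Z Y n h β ω a * ee q G X Z Y n h β ω b
      = (n : ℝ)⁻¹ * ∑ i ∈ Finset.range n, ∑ j ∈ Finset.range n,
        score q G h β a (X i ω, Z i ω, Y i ω) * score q G h β b (X j ω, Z j ω, Y j ω) := fun ω => by
    rw [ee_apply, ee_apply, ← Finset.sum_mul_sum, ← hnn]; ring
  simp_rw [e]
  have hint := fun i j => integrable_score_mul hS hI hG hq0 hq1 i j h β a b
  refine ⟨(integrable_finsetSum _ fun i _ => integrable_finsetSum _ fun j _ =>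
    hint i j).const_mul _, ?_⟩
  rw [integral_const_mul, integral_finsetSum _ fun i _ => integrable_finsetSum _ fun j _ => hint
      i j]
  simp_rw [fun i => integral_finsetSum (Finset.range n) fun j _ => hint i j]
  -- Every entry is the product of means plus a correction on the diagonal, so the double sum never
  -- has to be split.
  have hval : ∀ i j, ∫ ω, score q G h β a (X i ω, Z i ω, Y i ω) *
      score q G h β b (X j ω, Z j ω, Y j ω) ∂P
      = (if i = j then meanScoreSq P q G X Z Y h β a b
          - meanScore P q G X Z Y h β a * meanScore P q G X Z Y h β b else 0)
        + meanScore P q G X Z Y h β a * meanScore P q G X Z Y h β b := fun i j => by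
    have hma := measurable_score hG q h β a
    have hmb := measurable_score hG q h β b
    split_ifs with hij
    · subst hij
      rw [sub_add_cancel]
      exact hS.integral_obs_eq i (hma.mul hmb)
    · rw [zero_add, meanScore, meanScore, ← hS.integral_obs_eq i hma, ← hS.integral_obs_eq j hmb]
      exact ((hS.indep.indepFun hij).comp hma hmb).integral_fun_mul_eq_mul_integral
        (hma.comp (hS.measurable_obs i)).aestronglyMeasurable
        (hmb.comp (hS.measurable_obs j)).aestronglyMeasurable
  simp_rw [hval, Finset.sum_add_distrib]
  simp only [Finset.sum_ite_eq, Finset.sum_const, Finset.card_range, nsmul_eq_mul]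
  rw [Finset.sum_congr rfl (g := fun _ => meanScoreSq P q G X Z Y h β a b
          - meanScore P q G X Z Y h β a * meanScore P q G X Z Y h β b)
          (fun i hi => by rw [if_pos hi])]
  simp only [Finset.sum_const, Finset.card_range, nsmul_eq_mul]
  have : (n : ℝ) ≠ 0 := by exact_mod_cast hn
  field_simp
  ring

theorem integral_Z (hS : Sampling P q X Z Y β₀) (hI : Instruments P Z) (a : Fin d) :
    Integrable (fun ω => Z 0 ω a) P := by
  obtain ⟨M, -, hM⟩ := hI.exists_bound
  refine Integrable.of_bound ((measurable_coord a).comp (hS.measurable_Z 0)).aestronglyMeasurable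
      M ?_
  filter_upwards [hM] with ω hω using (abs_coord_le _ _).trans hω

theorem integral_ZZ (hS : Sampling P q X Z Y β₀) (hI : Instruments P Z) (a b : Fin d) :
    Integrable (fun ω => Z 0 ω a * Z 0 ω b) P := by
  obtain ⟨M, -, hM⟩ := hI.exists_bound
  refine (integral_Z hS hI b).bdd_mul
    ((measurable_coord a).comp (hS.measurable_Z 0)).aestronglyMeasurable (c := M) ?_
  filter_upwards [hM] with ω hω using (abs_coord_le _ _).trans hω

/-- The bias: `E[Z_a (G(-U/h) - q)] = (-h)^r (V^{1/2} E(B))_a + o(h^r)`. -/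
theorem tendsto_meanScore (hS : Sampling P q X Z Y β₀) (hI : Instruments P Z)
    (hG : SmoothingFunction r G) (hL : CondLawGivenZ P q r X Z Y β₀ f) (hr : 2 < r)
    (hq0 : 0 < q) {S : Matrix (Fin d) (Fin d) ℝ} (hSu : IsUnit S.det) (a : Fin d) :
    Tendsto (fun h : ℝ => (h ^ r)⁻¹ * meanScore P q G X Z Y h β₀ a) (𝓝[>] 0)
      (𝓝 ((-1) ^ r * (S *ᵥ meanB P r G Z f S) a)) := by
  obtain ⟨ε, hε, hf, -, hsm, C, hbd, hC1, hC2⟩ := hL.smooth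
  obtain ⟨B, hB1, hB, hB', -⟩ := hG.exists_bound
  have hr1 : r - 1 + 1 = r := by omega
  have hrr : ((r - 1 : ℕ) : ℝ) + 1 = r := by exact_mod_cast hr1
  have hr0 : (r : ℝ) ≠ 0 := by exact_mod_cast (by omega : r ≠ 0)
  have hmomr : ∫ v in (-1 : ℝ)..1, defect G v * v ^ (r - 1)
      = -(1 / r) * ∫ v in (-1 : ℝ)..1, deriv G v * v ^ r := by
    rw [hG.integral_defect_mul_pow, hr1, hrr]; simp_rw [mul_comm]
  have hmain := fun c => tendsto_inv_mul_integral_kernel (m := r - 1) (k := defect G) (B := B + 1)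
    (ψ := fun z => z c) hS hε
    hf hsm hbd (by omega) (by omega) hG.measurable_defect
    (fun v => (abs_sub _ _).trans (add_le_add (hB v) (by
      by_cases hv : v ∈ Set.Ioi (0 : ℝ) <;> simp [hv])))
    (fun v hv => hG.defect_eq_zero hv) (fun i hi => hG.integral_defect_mul_pow_eq_zero hi)
    (by
      rw [hmomr]
      refine mul_ne_zero (neg_ne_zero.2 (one_div_ne_zero hr0)) ?_
      simp_rw [mul_comm (deriv G _)]
      exact hG.moment_ne_zero)
    (measurable_coord c)
    -- C itself need not be measurable; only C‖Z‖ is known to be. Hence C|Z_c| is written as C‖Z‖ ·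
    -- |Z_c|/‖Z‖, which also holds at Z = 0 because division by zero yields 0.
    (hC1.mono' (hC1.aestronglyMeasurable.congr (ae_of_all _ fun _ => rfl) |> fun h => by
        have h2 : AEStronglyMeasurable (fun ω => |Z 0 ω c| / ‖Z 0 ω‖) P :=
          ((((measurable_coord c).comp (hS.measurable_Z 0)).norm).div
            (hS.measurable_Z 0).norm).aestronglyMeasurable
        refine (h.mul h2).congr (ae_of_all _ fun ω => ?_)
        simp only [Pi.mul_apply]
        by_cases hz : ‖Z 0 ω‖ = 0
        · have := abs_coord_le (Z 0 ω) c
          have h3 : |Z 0 ω c| = 0 := le_antisymm (this.trans hz.le) (abs_nonneg _)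
          rw [h3, hz]; simp
        · field_simp) (by
        have hCn : ∀ᵐ ω ∂P, 0 ≤ C (Z 0 ω) := by
          refine ae_of_ae_map (p := fun z => 0 ≤ C z) (hS.measurable_Z 0).aemeasurable ?_
          filter_upwards [hbd] with z hz
          exact (abs_nonneg _).trans (hz 0 (by omega) (by omega) 0 ⟨by linarith, hε⟩)
        filter_upwards [hCn] with ω hω
        rw [norm_mul, Real.norm_of_nonneg hω, Real.norm_eq_abs, abs_abs]
        exact mul_le_mul_of_nonneg_left (abs_coord_le _ _) hω))
  -- the limit in terms of `E(B)`
  have hlim : (-1) ^ r * (S *ᵥ meanB P r G Z f S) a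
      = (-1) ^ (r - 1) / (r - 1).factorial * (∫ v in (-1 : ℝ)..1, defect G v * v ^ (r - 1))
        * ∫ ω, Z 0 ω a * iteratedDeriv (r - 1) (f (Z 0 ω)) 0 ∂P := by
    have hB2 : meanB P r G Z f S = (1 / (r.factorial : ℝ) * ∫ v in (-1 : ℝ)..1, deriv G v * v ^ r) •
        (S⁻¹ *ᵥ fun c => ∫ ω, Z 0 ω c * iteratedDeriv (r - 1) (f (Z 0 ω)) 0 ∂P) := by
      funext b
      simp only [meanB, vecB, Matrix.mulVec, dotProduct, Pi.smul_apply, smul_eq_mul]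
      rw [← Finset.sum_congr rfl fun c _ => integral_const_mul _ _,
        ← integral_finsetSum _ fun c _ => ((hmain c).1.const_mul _), ← integral_const_mul]
      congr 1; funext ω
      simp_rw [Finset.mul_sum]
      exact Finset.sum_congr rfl fun c _ => by ring
    rw [hB2, Matrix.mulVec_smul, Matrix.mulVec_mulVec, Matrix.mul_nonsing_inv _ hSu,
      Matrix.one_mulVec, hmomr]
    simp only [Pi.smul_apply, smul_eq_mul]
    -- Matching constants: r! = r (r-1)! absorbs the 1/r of the moment of the defect, and (-1)^r =
    -- -(-1)^{r-1} absorbs its sign.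
    have hfac : (r.factorial : ℝ) = r * (r - 1).factorial := by
      exact_mod_cast (Nat.mul_factorial_pred (by omega)).symm
    have hpow : (-1 : ℝ) ^ r = -(-1) ^ (r - 1) := by
      conv_lhs => rw [← hr1, pow_succ]
      ring
    have hf0 : ((r - 1).factorial : ℝ) ≠ 0 := by exact_mod_cast (r - 1).factorial_ne_zero
    rw [hfac, hpow]
    field_simp
  rw [hlim]
  have h3 := (hmain a).2.2
  rw [hr1] at h3
  refine h3.congr' ?_
  filter_upwards [Ioo_mem_nhdsGT hε] with h hh
  congr 1
  have hi1 := (hmain a).2.1 h hh.1 hh.2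
  have hi2 := integral_mul_indicator_err hS hq0.le hL.quantile (measurable_coord a)
    (integral_Z hS hI a)
  have hZa := integral_Z hS hI a
  have hiI : Integrable (fun ω => Z 0 ω a *
      Set.indicator {ω' | err X Y β₀ 0 ω' < 0} (1 : Ω → ℝ) ω) P := by
    refine hZa.mul_bdd (c := 1) ?_ ?_
    · exact (measurable_one.indicator
        ((hS.measurable_err 0) measurableSet_Iio)).aestronglyMeasurable
    · refine ae_of_all _ fun ω => ?_
      by_cases hω : ω ∈ {ω' | err X Y β₀ 0 ω' < 0} <;> simp [hω]
  -- The smoothed score is the defect part plus the unsmoothed score; the latter has mean zero by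
  -- the quantile condition.
  have e : ∀ ω, score q G h β₀ a (X 0 ω, Z 0 ω, Y 0 ω)
      = Z 0 ω a * defect G (-err X Y β₀ 0 ω / h)
        + (Z 0 ω a * Set.indicator {ω' | err X Y β₀ 0 ω' < 0} (1 : Ω → ℝ) ω - q * Z 0 ω a) :=
    fun ω => by
      rw [indicator_err_neg hh.1, defect, score, err, neg_sub]; ring
  simp_rw [meanScore, e]
  have hi3 : Integrable (fun ω => Z 0 ω a *
      Set.indicator {ω' | err X Y β₀ 0 ω' < 0} (1 : Ω → ℝ) ω - q * Z 0 ω a) P :=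
    hiI.sub (hZa.const_mul q)
  rw [integral_add hi1 hi3, integral_sub hiI (hZa.const_mul q), hi2,
    integral_const_mul, sub_self, add_zero]

/-- The variance: `E[Z Z' (G(-U/h) - q)²] = V - h V^{1/2} E(AA') (V^{1/2})' + o(h)`. -/
theorem tendsto_meanScoreSq (hS : Sampling P q X Z Y β₀) (hI : Instruments P Z)
    (hG : SmoothingFunction r G) (hL : CondLawGivenZ P q r X Z Y β₀ f) (hr : 2 < r)
    (hq0 : 0 < q) (hq1 : q < 1) {S : Matrix (Fin d) (Fin d) ℝ} (hSu : IsUnit S.det)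
    (a b : Fin d) :
    Tendsto (fun h : ℝ => h⁻¹ * (meanScoreSq P q G X Z Y h β₀ a b - asympVar P q Z a b)) (𝓝[>] 0)
      (𝓝 (-(S * meanAA P G Z f S * Sᵀ) a b)) := by
  obtain ⟨ε, hε, hf, -, hsm, C, hbd, hC1, hC2⟩ := hL.smooth
  obtain ⟨B, hB1, hB, hB', -⟩ := hG.exists_bound
  -- Squared smoothed score minus squared unsmoothed score: supported in [-1, 1], so it is an
  -- admissible kernel.
  set k : ℝ → ℝ := fun v => (G v - q) ^ 2 - ((Set.Ioi (0 : ℝ)).indicator 1 v - q) ^ 2 with hk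
  have hI1 : ∀ v : ℝ, |(Set.Ioi (0 : ℝ)).indicator (1 : ℝ → ℝ) v| ≤ 1 := fun v => by
    by_cases hv : v ∈ Set.Ioi (0 : ℝ) <;> simp [hv]
  have hIsq : ∀ v : ℝ, (Set.Ioi (0 : ℝ)).indicator (1 : ℝ → ℝ) v ^ 2
      = (Set.Ioi (0 : ℝ)).indicator (1 : ℝ → ℝ) v := fun v => by
    by_cases hv : v ∈ Set.Ioi (0 : ℝ) <;> simp [hv]
  have hkm : Measurable k :=
    ((hG.measurable.sub_const q).pow_const 2).sub
      (((measurable_one.indicator measurableSet_Ioi).sub_const q).pow_const 2)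
  have hkB : ∀ v, |k v| ≤ (B + 1) * (B + 1 + 2) := fun v => by
    have e : k v = defect G v * (G v + (Set.Ioi (0 : ℝ)).indicator 1 v - 2 * q) := by
      simp only [hk, defect]; ring
    rw [e, abs_mul]
    refine mul_le_mul ((abs_sub _ _).trans (add_le_add (hB v) (hI1 v))) ?_ (abs_nonneg _)
      (by linarith)
    refine (abs_sub _ _).trans (add_le_add ((abs_add_le _ _).trans (add_le_add (hB v) (hI1 v))) ?_)
    rw [abs_of_pos (by linarith)]; linarith
  have hk1 : ∀ v, 1 < |v| → k v = 0 := fun v hv => by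
    have := hG.defect_eq_zero hv
    rw [defect, sub_eq_zero] at this
    simp only [hk, this, sub_self]
  -- Expanding, k = G² - 1{v > 0} - 2q · defect. The defect integrates to 0 because the first moment
  -- of G' vanishes, so q drops out and ∫G² - 1 remains.
  have hkint : ∫ v in (-1 : ℝ)..1, k v * v ^ 0 = -(1 - ∫ u in (-1 : ℝ)..1, G u ^ 2) := by
    have e : ∀ v, k v * v ^ 0 = G v ^ 2 - ((Set.Ioi (0 : ℝ)).indicator 1 v * v ^ 0
        + 2 * q * (defect G v * v ^ 0)) := fun v => by
      simp only [hk, defect, pow_zero, mul_one]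
      linear_combination -(hIsq v)
    have hi1 : IntervalIntegrable (fun v => (Set.Ioi (0 : ℝ)).indicator (1 : ℝ → ℝ) v * v ^ 0)
      volume (-1) 1 := SmoothingFunction.intervalIntegrable_indicator _ _ (continuous_pow 0)
    have hi2 : IntervalIntegrable (fun v => defect G v * v ^ 0) volume (-1) 1 := by
      simp_rw [defect, sub_mul]
      exact ((hG.continuous.mul (continuous_pow 0)).intervalIntegrable _ _).sub hi1
    have hi3 : IntervalIntegrable (fun v => (Set.Ioi (0 : ℝ)).indicator (1 : ℝ → ℝ) v * v ^ 0
        + 2 * q * (defect G v * v ^ 0)) volume (-1) 1 := hi1.add (hi2.const_mul _)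
    have hi4 : IntervalIntegrable (fun v => G v ^ 2) volume (-1) 1 :=
      (hG.continuous.pow 2).intervalIntegrable _ _
    simp_rw [e]
    rw [intervalIntegral.integral_sub hi4 hi3, intervalIntegral.integral_add hi1 (hi2.const_mul _),
      intervalIntegral.integral_const_mul, hG.integral_defect_mul_pow_eq_zero (by omega),
      SmoothingFunction.integral_indicator_mul_pow]
    simp
  have hCn : ∀ᵐ ω ∂P, 0 ≤ C (Z 0 ω) := by
    refine ae_of_ae_map (p := fun z => 0 ≤ C z) (hS.measurable_Z 0).aemeasurable ?_
    filter_upwards [hbd] with z hz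
    exact (abs_nonneg _).trans (hz 0 (by omega) (by omega) 0 ⟨by linarith, hε⟩)
  have hf0 : ∀ᵐ ω ∂P, 0 ≤ f (Z 0 ω) 0 := by
    refine ae_of_ae_map (p := fun z => 0 ≤ f z 0) (hS.measurable_Z 0).aemeasurable ?_
    filter_upwards [hf] with z hz using hz.1 0 ⟨by linarith, hε⟩
  have hCi : ∀ c e : Fin d, Integrable (fun ω => C (Z 0 ω) * |Z 0 ω c * Z 0 ω e|) P := fun c e => by
    refine hC2.mono' ?_ ?_
    -- Again only the product C‖Z‖² is known to be measurable, so the bound is written as that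
    -- product times a measurable ratio.
    · have h2 : AEStronglyMeasurable (fun ω => |Z 0 ω c * Z 0 ω e| / ‖Z 0 ω‖ ^ 2) P :=
        ((((measurable_coord c).comp (hS.measurable_Z 0)).mul
          ((measurable_coord e).comp (hS.measurable_Z 0))).norm.div
            ((hS.measurable_Z 0).norm.pow_const 2)).aestronglyMeasurable
      refine (hC2.aestronglyMeasurable.mul h2).congr (ae_of_all _ fun ω => ?_)
      simp only [Pi.mul_apply]
      by_cases hz : ‖Z 0 ω‖ = 0
      · have := abs_coord_le (Z 0 ω) c
        have h3 : Z 0 ω c = 0 := abs_eq_zero.1 (le_antisymm (this.trans hz.le) (abs_nonneg _))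
        rw [h3, hz]; simp
      · field_simp
    · filter_upwards [hCn] with ω hω
      rw [norm_mul, Real.norm_of_nonneg hω, Real.norm_eq_abs, abs_abs, abs_mul, sq]
      exact mul_le_mul_of_nonneg_left (mul_le_mul (abs_coord_le _ _) (abs_coord_le _ _)
        (abs_nonneg _) (norm_nonneg _)) hω
  have hmain := fun c e => tendsto_inv_mul_integral_kernel (m := 0) (k := k)
    (ψ := fun z => z c * z e) hS hε hf hsm hbd (by omega) (by omega) hkm hkB hk1 (by simp)
    (by rw [hkint]; exact neg_ne_zero.2 hG.variance_reduction.ne')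
    ((measurable_coord c).mul (measurable_coord e)) (hCi c e)
  simp only [iteratedDeriv_zero, pow_zero, Nat.factorial_zero, Nat.cast_one, div_one,
    one_mul, zero_add, pow_one] at hmain
  simp only [pow_zero] at hkint
  rw [hkint] at hmain
  have hlim : -(S * meanAA P G Z f S * Sᵀ) a b
      = -(1 - ∫ u in (-1 : ℝ)..1, G u ^ 2) * ∫ ω, Z 0 ω a * Z 0 ω b * f (Z 0 ω) 0 ∂P := by
    have hA : meanAA P G Z f S = S⁻¹ * ((1 - ∫ u in (-1 : ℝ)..1, G u ^ 2) •
        Matrix.of fun c e => ∫ ω, Z 0 ω c * Z 0 ω e * f (Z 0 ω) 0 ∂P) * S⁻¹ᵀ := by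
      ext c e
      simp only [meanAA, Matrix.of_apply, Matrix.mul_apply, Matrix.smul_apply, smul_eq_mul,
        Matrix.transpose_apply, Finset.sum_mul]
      have e1 : ∀ j i, S⁻¹ c i * ((1 - ∫ u in (-1 : ℝ)..1, G u ^ 2)
          * ∫ ω, Z 0 ω i * Z 0 ω j * f (Z 0 ω) 0 ∂P) * S⁻¹ e j
          = ∫ ω, S⁻¹ c i * S⁻¹ e j * (1 - ∫ u in (-1 : ℝ)..1, G u ^ 2)
            * (Z 0 ω i * Z 0 ω j * f (Z 0 ω) 0) ∂P := fun j i => by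
        rw [integral_const_mul]; ring
      simp_rw [e1]
      simp_rw [← fun j => integral_finsetSum Finset.univ fun i _ => ((hmain i j).1.const_mul
          (S⁻¹ c i * S⁻¹ e j * (1 - ∫ u in (-1 : ℝ)..1, G u ^ 2)))]
      rw [← integral_finsetSum _ fun j _ => integrable_finsetSum _ fun i _ =>
        ((hmain i j).1.const_mul _)]
      refine integral_congr_ae ?_
      filter_upwards [hf0] with ω hω
      simp only [vecA, Pi.smul_apply, smul_eq_mul, Matrix.mulVec, dotProduct]
      have e2 : ∀ x y : ℝ, √(1 - ∫ u in (-1 : ℝ)..1, G u ^ 2) * √(f (Z 0 ω) 0) * x *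
          (√(1 - ∫ u in (-1 : ℝ)..1, G u ^ 2) * √(f (Z 0 ω) 0) * y)
          = (1 - ∫ u in (-1 : ℝ)..1, G u ^ 2) * f (Z 0 ω) 0 * (y * x) := fun x y => by
        have h1 := Real.mul_self_sqrt hG.variance_reduction.le
        have h2 := Real.mul_self_sqrt hω
        linear_combination (√(f (Z 0 ω) 0) * √(f (Z 0 ω) 0) * x * y) * h1
          + (1 - ∫ u in (-1 : ℝ)..1, G u ^ 2) * x * y * h2
      rw [e2, Finset.sum_mul_sum, Finset.mul_sum]
      refine Finset.sum_congr rfl fun j _ => ?_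
      rw [Finset.mul_sum]
      exact Finset.sum_congr rfl fun i _ => by ring
    have hST : Sᵀ.det = S.det := Matrix.det_transpose S
    rw [hA, ← Matrix.mul_assoc, ← Matrix.mul_assoc, Matrix.mul_nonsing_inv _ hSu, Matrix.one_mul,
      Matrix.mul_assoc, Matrix.transpose_nonsing_inv,
      Matrix.nonsing_inv_mul _ (by rw [hST]; exact hSu), Matrix.mul_one, Matrix.smul_apply,
          Matrix.of_apply, smul_eq_mul, neg_mul]
  rw [hlim]
  refine (hmain a b).2.2.congr' ?_
  filter_upwards [Ioo_mem_nhdsGT hε] with h hh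
  congr 1
  have hi1 := (hmain a b).2.1 h hh.1 hh.2
  have hZZ := integral_ZZ hS hI a b
  have hi2 := integral_mul_indicator_err hS hq0.le hL.quantile
    ((measurable_coord a).mul (measurable_coord b)) hZZ
  have hiI : Integrable (fun ω => Z 0 ω a * Z 0 ω b *
      Set.indicator {ω' | err X Y β₀ 0 ω' < 0} (1 : Ω → ℝ) ω) P := by
    refine hZZ.mul_bdd (c := 1) ?_ ?_
    · exact (measurable_one.indicator
        ((hS.measurable_err 0) measurableSet_Iio)).aestronglyMeasurable
    · refine ae_of_all _ fun ω => ?_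
      by_cases hω : ω ∈ {ω' | err X Y β₀ 0 ω' < 0} <;> simp [hω]
  -- Since an indicator is its own square, (1{U<0} - q)² = (1 - 2q) 1{U<0} + q², whose conditional
  -- mean is q(1 - q). This is the source of V.
  have e : ∀ ω, score q G h β₀ a (X 0 ω, Z 0 ω, Y 0 ω) * score q G h β₀ b (X 0 ω, Z 0 ω, Y 0 ω)
      = Z 0 ω a * Z 0 ω b * k (-err X Y β₀ 0 ω / h)
        + ((1 - 2 * q) * (Z 0 ω a * Z 0 ω b *
          Set.indicator {ω' | err X Y β₀ 0 ω' < 0} (1 : Ω → ℝ) ω)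
          + q ^ 2 * (Z 0 ω a * Z 0 ω b)) :=
    fun ω => by
      rw [indicator_err_neg hh.1, score, score, err, neg_sub]
      simp only [hk]
      have := hIsq ((inner ℝ (X 0 ω) β₀ - Y 0 ω) / h)
      linear_combination (Z 0 ω a * Z 0 ω b) * this
  have hi3 : Integrable (fun ω => (1 - 2 * q) * (Z 0 ω a * Z 0 ω b *
      Set.indicator {ω' | err X Y β₀ 0 ω' < 0} (1 : Ω → ℝ) ω)
      + q ^ 2 * (Z 0 ω a * Z 0 ω b)) P := (hiI.const_mul _).add (hZZ.const_mul _)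
  simp only [Pi.mul_apply] at hi2
  simp_rw [meanScoreSq, e]
  rw [integral_add hi1 hi3, integral_add (hiI.const_mul _) (hZZ.const_mul _), integral_const_mul,
      integral_const_mul, hi2,
    asympVar_apply]
  ring

end Scores

end SEE

namespace SEE

/-! ### Entrywise asymptotics of matrix products -/

section MatrixAsymptotics

variable {d : ℕ} {A B : ℕ → Matrix (Fin d) (Fin d) ℝ} {u v : ℕ → ℝ} {l : Filter ℕ}

theorem isBigO_matrix_mul (hA : ∀ a b, (fun n => A n a b) =O[l] u)
    (hB : ∀ a b, (fun n => B n a b) =O[l] v) (a b : Fin d) :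
    (fun n => (A n * B n) a b) =O[l] fun n => u n * v n := by
  simp only [Matrix.mul_apply]
  exact IsBigO.fun_sum fun c _ => (hA a c).mul (hB c b)

theorem isLittleO_matrix_mul_left (hA : ∀ a b, (fun n => A n a b) =o[l] u)
    (hB : ∀ a b, (fun n => B n a b) =O[l] v) (a b : Fin d) :
    (fun n => (A n * B n) a b) =o[l] fun n => u n * v n := by
  simp only [Matrix.mul_apply]
  exact IsLittleO.fun_sum fun c _ => (hA a c).mul_isBigO (hB c b)

theorem isLittleO_matrix_mul_right (hA : ∀ a b, (fun n => A n a b) =O[l] u)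
    (hB : ∀ a b, (fun n => B n a b) =o[l] v) (a b : Fin d) :
    (fun n => (A n * B n) a b) =o[l] fun n => u n * v n := by
  simp only [Matrix.mul_apply]
  exact IsLittleO.fun_sum fun c _ => (hA a c).mul_isLittleO (hB c b)

end MatrixAsymptotics

variable {Ω : Type*} [MeasurableSpace Ω] {d : ℕ}

/-! ### Expansion of the approximate MSE -/

section AMSE

variable {P : Measure Ω} [IsProbabilityMeasure P] {r : ℕ} {q : ℝ} {X Z : ℕ → Ω → Vec d}
  {Y : ℕ → Ω → ℝ} {β₀ : Vec d} {G : ℝ → ℝ} {f : Vec d → ℝ → ℝ} {g : Vec d × Vec d → ℝ → ℝ}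
  {C : Vec d × Vec d → ℝ} {h : ℕ → ℝ}

theorem isBigO_meanJacobian_sub (hS : Sampling P q X Z Y β₀) (hG : SmoothingFunction r G)
    (hL : CondLawGivenZX P r X Z Y β₀ g C) (h_pos : ∀ n, 0 < h n)
    (h_zero : Tendsto h atTop (𝓝 0)) (a b : Fin d) :
    (fun n => (meanJacobian P q G X Z Y β₀ n (h n) - sigmaZX P X Z g) a b)
      =O[atTop] fun n => h n ^ r := by
  obtain ⟨ε, hε, K, hK⟩ := exists_slope_bound hS hG hL
  obtain ⟨ε', hε', hJ⟩ := exists_jacobian_eq hS hG hL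
  refine IsBigO.of_bound K ?_
  filter_upwards [h_zero.eventually (gt_mem_nhds hε), h_zero.eventually (gt_mem_nhds hε'),
    eventually_ne_atTop 0] with n h1 h2 hn
  rw [Matrix.sub_apply, (hJ n hn (h n) (h_pos n) h2 a b).2, Real.norm_eq_abs, Real.norm_eq_abs,
    abs_of_pos (pow_pos (h_pos n) r)]
  exact (hK (h n) (h_pos n) h1 a b).2

theorem tendsto_meanJacobian (hS : Sampling P q X Z Y β₀) (hG : SmoothingFunction r G)
    (hL : CondLawGivenZX P r X Z Y β₀ g C) (h_pos : ∀ n, 0 < h n)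
    (h_zero : Tendsto h atTop (𝓝 0)) :
    Tendsto (fun n => meanJacobian P q G X Z Y β₀ n (h n)) atTop (𝓝 (sigmaZX P X Z g)) := by
  refine tendsto_pi_nhds.2 fun a => tendsto_pi_nhds.2 fun b => ?_
  have h1 := isBigO_meanJacobian_sub hS hG hL h_pos h_zero a b
  have h2 : Tendsto (fun n => h n ^ r) atTop (𝓝 0) := by
    have := h_zero.pow r
    rwa [zero_pow (by have := hL.order; omega)] at this
  have h3 := h1.trans_tendsto h2
  have h4 := h3.add_const (sigmaZX P X Z g a b)
  simpa using h4

theorem eventually_isUnit_meanJacobian (hS : Sampling P q X Z Y β₀) (hG : SmoothingFunction r G)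
    (hL : CondLawGivenZX P r X Z Y β₀ g C) (h_pos : ∀ n, 0 < h n)
    (h_zero : Tendsto h atTop (𝓝 0)) :
    ∀ᶠ n in atTop, IsUnit (meanJacobian P q G X Z Y β₀ n (h n)).det := by
  have h1 := ((continuous_id.matrix_det).tendsto (sigmaZX P X Z g)).comp
    (tendsto_meanJacobian (q := q) hS hG hL h_pos h_zero)
  filter_upwards [h1.eventually_ne hL.nonsingular.ne_zero] with n hn
  exact isUnit_iff_ne_zero.2 hn

theorem tendsto_meanJacobian_inv (hS : Sampling P q X Z Y β₀) (hG : SmoothingFunction r G)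
    (hL : CondLawGivenZX P r X Z Y β₀ g C) (h_pos : ∀ n, 0 < h n)
    (h_zero : Tendsto h atTop (𝓝 0)) (a b : Fin d) :
    Tendsto (fun n => (meanJacobian P q G X Z Y β₀ n (h n))⁻¹ a b) atTop
      (𝓝 ((sigmaZX P X Z g)⁻¹ a b)) := by
  have h1 : ContinuousAt Inv.inv (sigmaZX P X Z g) := by
    refine continuousAt_matrix_inv _ ?_
    have : (Ring.inverse : ℝ → ℝ) = Inv.inv := by funext x; exact Ring.inverse_eq_inv x
    rw [this]
    exact continuousAt_inv₀ hL.nonsingular.ne_zero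
  have h2 := h1.tendsto.comp (tendsto_meanJacobian (q := q) hS hG hL h_pos h_zero)
  exact tendsto_pi_nhds.1 (tendsto_pi_nhds.1 h2 a) b

theorem memLp_leadingTerm (hS : Sampling P q X Z Y β₀) (hI : Instruments P Z)
    (hG : SmoothingFunction r G) (hq0 : 0 < q) (hq1 : q < 1) (n : ℕ) (h : ℝ) :
    MemLp (leadingTerm P q G X Z Y β₀ n h) 2 P := by
  obtain ⟨K, hK1, hK⟩ := exists_score_bound hS hI hG hq0 hq1
  have hscore : ∀ a j, MemLp (fun ω => score q G h β₀ a (X j ω, Z j ω, Y j ω)) 2 P := fun a j => by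
    refine MemLp.of_bound
      ((measurable_score hG q h β₀ a).comp (hS.measurable_obs j)).aestronglyMeasurable K ?_
    filter_upwards [hK] with ω hω using hω j h β₀ a
  have hcoord : ∀ a, MemLp (fun ω => ee q G X Z Y n h β₀ ω a) 2 P := fun a => by
    simp_rw [ee_apply]
    exact (memLp_finsetSum (Finset.range n) fun j _ => hscore a j).const_mul _
  refine MemLp.of_eval_piLp fun a => ?_
  have hL : ∀ ω, leadingTerm P q G X Z Y β₀ n h ω a
      = -∑ i, (meanJacobian P q G X Z Y β₀ n h)⁻¹ a i * ee q G X Z Y n h β₀ ω i := fun ω => rfl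
  simp_rw [hL]
  exact (memLp_finsetSum Finset.univ fun j _ => (hcoord j).const_mul _).neg

theorem amse_eq (hS : Sampling P q X Z Y β₀) (hI : Instruments P Z)
    (hG : SmoothingFunction r G) (hq0 : 0 < q) (hq1 : q < 1) {n : ℕ} (hn : n ≠ 0) (h : ℝ) :
    amse P q G X Z Y β₀ n h = (meanJacobian P q G X Z Y β₀ n h)⁻¹ *
      (Matrix.of fun a b => meanScoreSq P q G X Z Y h β₀ a b
        + ((n : ℝ) - 1) * (meanScore P q G X Z Y h β₀ a * meanScore P q G X Z Y h β₀ b)) *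
      ((meanJacobian P q G X Z Y β₀ n h)⁻¹)ᵀ := by
  ext a b
  have hm := fun c e => integral_ee_mul_ee hS hI hG hq0 hq1 hn h β₀ c e
  set J := (meanJacobian P q G X Z Y β₀ n h)⁻¹ with hJ
  have hL : ∀ ω, leadingTerm P q G X Z Y β₀ n h ω a * leadingTerm P q G X Z Y β₀ n h ω b
      = ∑ i, ∑ j, J a i * J b j * (ee q G X Z Y n h β₀ ω i * ee q G X Z Y n h β₀ ω j) := fun ω => by
    have h1 : ∀ c, leadingTerm P q G X Z Y β₀ n h ω c
      = -∑ i, J c i * ee q G X Z Y n h β₀ ω i := fun c => rfl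
    rw [h1, h1, neg_mul_neg, Finset.sum_mul_sum]
    exact Finset.sum_congr rfl fun i _ => Finset.sum_congr rfl fun j _ => by ring
  rw [amse, Matrix.of_apply, integral_congr_ae (ae_of_all _ hL),
    integral_finsetSum _ fun i _ => integrable_finsetSum _ fun j _ => (hm i j).1.const_mul _,
    Matrix.mul_apply]
  simp_rw [Matrix.mul_apply, Finset.sum_mul]
  rw [Finset.sum_comm]
  refine Finset.sum_congr rfl fun i _ => ?_
  rw [integral_finsetSum _ fun j _ => (hm i j).1.const_mul _]
  refine Finset.sum_congr rfl fun j _ => ?_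
  rw [integral_const_mul, (hm i j).2, Matrix.of_apply, Matrix.transpose_apply]; ring

/-- The second-moment matrix of `m_n(β₀)`, up to `o(h + n h^{2r})`. -/
theorem isLittleO_secondMoment_ee (hS : Sampling P q X Z Y β₀) (hI : Instruments P Z)
    (hG : SmoothingFunction r G) (hL : CondLawGivenZ P q r X Z Y β₀ f) (hr : 2 < r)
    (hq0 : 0 < q) (hq1 : q < 1) (h_pos : ∀ n, 0 < h n) (h_zero : Tendsto h atTop (𝓝 0))
    {S : Matrix (Fin d) (Fin d) ℝ} (hSu : IsUnit S.det) (a b : Fin d) :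
    (fun n : ℕ => meanScoreSq P q G X Z Y (h n) β₀ a b
        + ((n : ℝ) - 1) * (meanScore P q G X Z Y (h n) β₀ a * meanScore P q G X Z Y (h n) β₀ b)
        - (asympVar P q Z a b + (n : ℝ) * h n ^ (2 * r) *
          ((S *ᵥ meanB P r G Z f S) a * (S *ᵥ meanB P r G Z f S) b)
          - h n * (S * meanAA P G Z f S * Sᵀ) a b))
      =o[atTop] fun n : ℕ => h n + (n : ℝ) * h n ^ (2 * r) := by
  have hh : Tendsto h atTop (𝓝[>] 0) :=
    tendsto_nhdsWithin_iff.2 ⟨h_zero, Eventually.of_forall h_pos⟩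
  have hδ1 : h =O[atTop] fun n : ℕ => h n + (n : ℝ) * h n ^ (2 * r) := by
    refine IsBigO.of_bound 1 (Eventually.of_forall fun n => ?_)
    have := h_pos n
    rw [Real.norm_of_nonneg this.le, Real.norm_of_nonneg (by positivity), one_mul]
    exact le_add_of_nonneg_right (by positivity)
  have hδ2 : (fun n : ℕ => (n : ℝ) * h n ^ (2 * r)) =O[atTop]
      fun n : ℕ => h n + (n : ℝ) * h n ^ (2 * r) := by
    refine IsBigO.of_bound 1 (Eventually.of_forall fun n => ?_)
    have := h_pos n
    rw [Real.norm_of_nonneg (by positivity), Real.norm_of_nonneg (by positivity), one_mul]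
    exact le_add_of_nonneg_left this.le
  set β := S *ᵥ meanB P r G Z f S with hβ
  set μ := fun n a => meanScore P q G X Z Y (h n) β₀ a with hμ
  have hA := (tendsto_meanScoreSq hS hI hG hL hr hq0 hq1 hSu a b).comp hh
  have hB := ((tendsto_meanScore hS hI hG hL hr hq0 hSu a).comp hh).mul
    ((tendsto_meanScore hS hI hG hL hr hq0 hSu b).comp hh)
  have hsq : (-1 : ℝ) ^ r * β a * ((-1) ^ r * β b) = β a * β b := by
    have : ((-1 : ℝ) ^ r) * (-1) ^ r = 1 := by rw [← mul_pow]; norm_num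
    linear_combination (β a * β b) * this
  rw [hsq] at hB
  have o1 : (fun n => h n * ((h n)⁻¹ * (meanScoreSq P q G X Z Y (h n) β₀ a b - asympVar P q Z a b)
      - -(S * meanAA P G Z f S * Sᵀ) a b)) =o[atTop]
      fun n : ℕ => h n + (n : ℝ) * h n ^ (2 * r) := by
    have := (isBigO_refl h atTop).mul_isLittleO ((isLittleO_one_iff ℝ).2
      (tendsto_sub_nhds_zero_iff.2 hA))
    simp only [mul_one] at this
    exact this.trans_isBigO hδ1
  have o2 : (fun n : ℕ => (n : ℝ) * h n ^ (2 * r) * ((h n ^ r)⁻¹ * μ n a * ((h n ^ r)⁻¹ * μ n b)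
      - β a * β b)) =o[atTop] fun n : ℕ => h n + (n : ℝ) * h n ^ (2 * r) := by
    have := (isBigO_refl (fun n : ℕ => (n : ℝ) * h n ^ (2 * r)) atTop).mul_isLittleO
      ((isLittleO_one_iff ℝ).2 (tendsto_sub_nhds_zero_iff.2 hB))
    simp only [mul_one] at this
    exact this.trans_isBigO hδ2
  -- The factor is n - 1 rather than n; the difference contributes O(h^{2r}), which is o(h).
  have o3 : (fun n : ℕ => h n ^ (2 * r) * ((h n ^ r)⁻¹ * μ n a * ((h n ^ r)⁻¹ * μ n b)))
      =o[atTop] fun n : ℕ => h n + (n : ℝ) * h n ^ (2 * r) := by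
    have h1 : (fun n : ℕ => h n ^ (2 * r)) =o[atTop] h := by
      have : (fun x : ℝ => x ^ (2 * r)) =o[𝓝 0] fun x : ℝ => x ^ 1 :=
        isLittleO_pow_pow (by omega)
      simp only [pow_one] at this
      exact this.comp_tendsto h_zero
    have := h1.mul_isBigO (hB.isBigO_one ℝ)
    simp only [mul_one] at this
    exact this.trans_isBigO hδ1
  refine ((o1.add o2).sub o3).congr_left fun n => ?_
  have hn0 : h n ≠ 0 := (h_pos n).ne'
  have hnr : h n ^ (2 * r) * ((h n ^ r)⁻¹ * μ n a * ((h n ^ r)⁻¹ * μ n b)) = μ n a * μ n b := by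
    rw [two_mul, pow_add]; field_simp
  have hn1 : h n * ((h n)⁻¹ * (meanScoreSq P q G X Z Y (h n) β₀ a b - asympVar P q Z a b))
      = meanScoreSq P q G X Z Y (h n) β₀ a b - asympVar P q Z a b := mul_inv_cancel_left₀ hn0 _
  linear_combination hn1 + ((n : ℝ) - 1) * hnr

/-- Let J be the mean Jacobian, Ξ = Σ_ZX⁻¹, E = E[m_n m_n'], T the expansion of E and δ = h +
nh^{2r}. Then J⁻¹ = Ξ + O(h^r), E = T + o(δ) and T = V + O(δ). With R₁ = J⁻¹VJ⁻ᵀ - ΞVΞᵀ = O(h^r),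
what remains is J⁻¹(E - T)J⁻ᵀ + (J⁻¹ - Ξ)(T - V)J⁻ᵀ + Ξ(T - V)(J⁻¹ - Ξ)ᵀ, and each term is o(δ). It
does not matter whether δ tends to 0. -/
theorem amse_expansion (hq0 : 0 < q) (hq1 : q < 1) (hS : Sampling P q X Z Y β₀)
    (hI : Instruments P Z) (hLZ : CondLawGivenZ P q r X Z Y β₀ f) (hG : SmoothingFunction r G)
    (hL : CondLawGivenZX P r X Z Y β₀ g C)
    (h_pos : ∀ n, 0 < h n) (h_zero : Tendsto h atTop (𝓝 0))
    {S : Matrix (Fin d) (Fin d) ℝ} (hSV : S * Sᵀ = asympVar P q Z) :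
    ∃ R₁ R₂ : ℕ → Matrix (Fin d) (Fin d) ℝ,
      (∀ᶠ n : ℕ in atTop, amse P q G X Z Y β₀ n (h n) =
        (sigmaZX P X Z g)⁻¹ * S *
          (1 + ((n : ℝ) * h n ^ (2 * r)) •
              Matrix.vecMulVec (meanB P r G Z f S) (meanB P r G Z f S)
            - h n • meanAA P G Z f S) *
          Sᵀ * ((sigmaZX P X Z g)ᵀ)⁻¹ + R₁ n + R₂ n) ∧
      (∀ a b, (fun n => R₁ n a b) =O[atTop] fun n => h n ^ r) ∧
      (∀ a b, (fun n => R₂ n a b) =o[atTop]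
        fun n : ℕ => h n + (n : ℝ) * h n ^ (2 * r)) := by
  have hr := hL.order
  have hSu := isUnit_det_sqrt hI hq0 hq1 hSV
  set δ := fun n : ℕ => h n + (n : ℝ) * h n ^ (2 * r) with hδ
  set Ξ := (sigmaZX P X Z g)⁻¹ with hXi
  set Ji := fun n => (meanJacobian P q G X Z Y β₀ n (h n))⁻¹ with hJi
  set V := asympVar P q Z with hV
  set E : ℕ → Matrix (Fin d) (Fin d) ℝ := fun n => Matrix.of fun a b =>
    meanScoreSq P q G X Z Y (h n) β₀ a b
      + ((n : ℝ) - 1) * (meanScore P q G X Z Y (h n) β₀ a * meanScore P q G X Z Y (h n) β₀ b)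
    with hE
  set T : ℕ → Matrix (Fin d) (Fin d) ℝ := fun n => S *
    (1 + ((n : ℝ) * h n ^ (2 * r)) • Matrix.vecMulVec (meanB P r G Z f S) (meanB P r G Z f S)
      - h n • meanAA P G Z f S) * Sᵀ with hT
  have hTapply : ∀ n a b, T n a b = V a b + (n : ℝ) * h n ^ (2 * r) *
          ((S *ᵥ meanB P r G Z f S) a * (S *ᵥ meanB P r G Z f S) b)
          - h n * (S * meanAA P G Z f S * Sᵀ) a b := fun n a b => by
    have : T n = V + ((n : ℝ) * h n ^ (2 * r)) •
        Matrix.vecMulVec (S *ᵥ meanB P r G Z f S) (S *ᵥ meanB P r G Z f S)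
        - h n • (S * meanAA P G Z f S * Sᵀ) := by
      simp only [hT]
      rw [Matrix.mul_sub, Matrix.sub_mul, Matrix.mul_add, Matrix.add_mul, Matrix.mul_one, hSV,
        Matrix.mul_smul, Matrix.smul_mul, Matrix.mul_smul, Matrix.smul_mul, Matrix.mul_vecMulVec,
        Matrix.vecMulVec_mul, Matrix.vecMul_transpose]
    rw [this]
    simp [Matrix.vecMulVec_apply]
  have hET : ∀ a b, (fun n => (E n - T n) a b) =o[atTop] δ := fun a b => by
    refine (isLittleO_secondMoment_ee hS hI hG hLZ hr hq0 hq1 h_pos h_zero hSu a b).congr_left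
      fun n => ?_
    rw [Matrix.sub_apply, hTapply]; rfl
  have hTV : ∀ a b, (fun n => (T n - V) a b) =O[atTop] δ := fun a b => by
    have hδ1 : h =O[atTop] δ := by
      refine IsBigO.of_bound 1 (Eventually.of_forall fun n => ?_)
      have := h_pos n
      simp only [hδ]
      rw [Real.norm_of_nonneg this.le, Real.norm_of_nonneg (by positivity), one_mul]
      exact le_add_of_nonneg_right (by positivity)
    have hδ2 : (fun n : ℕ => (n : ℝ) * h n ^ (2 * r)) =O[atTop] δ := by
      refine IsBigO.of_bound 1 (Eventually.of_forall fun n => ?_)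
      have := h_pos n
      simp only [hδ]
      rw [Real.norm_of_nonneg (by positivity), Real.norm_of_nonneg (by positivity), one_mul]
      exact le_add_of_nonneg_left this.le
    have h1 := hδ2.const_mul_left
      ((S *ᵥ meanB P r G Z f S) a * (S *ᵥ meanB P r G Z f S) b)
    have h2 := hδ1.const_mul_left ((S * meanAA P G Z f S * Sᵀ) a b)
    refine (h1.sub h2).congr_left fun n => ?_
    rw [Matrix.sub_apply, hTapply]; ring
  have hJi1 : ∀ a b, (fun n => Ji n a b) =O[atTop] fun _ => (1 : ℝ) := fun a b =>
    (tendsto_meanJacobian_inv hS hG hL h_pos h_zero a b).isBigO_one ℝ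
  have hJiT : ∀ a b, (fun n => (Ji n)ᵀ a b) =O[atTop] fun _ => (1 : ℝ) := fun a b => hJi1 b a
  have hc : ∀ M : Matrix (Fin d) (Fin d) ℝ, ∀ a b,
      (fun _ : ℕ => M a b) =O[atTop] fun _ => (1 : ℝ) := fun M a b =>
    isBigO_const_const _ one_ne_zero _
  have hD : ∀ a b, (fun n => (Ji n - Ξ) a b) =O[atTop] fun n => h n ^ r := fun a b => by
    have h1 := isBigO_matrix_mul (isBigO_matrix_mul hJi1
      (isBigO_meanJacobian_sub (q := q) hS hG hL h_pos h_zero)) (hc Ξ) a b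
    simp only [one_mul, mul_one] at h1
    refine (h1.neg_left).congr' ?_ EventuallyEq.rfl
    filter_upwards [eventually_isUnit_meanJacobian (q := q) hS hG hL h_pos h_zero] with n hn
    -- The resolvent identity carries the rate of J - Σ_ZX over to the inverses.
    have : Ji n * (meanJacobian P q G X Z Y β₀ n (h n) - sigmaZX P X Z g) * Ξ = -(Ji n - Ξ) := by
      simp only [hJi, hXi]
      rw [Matrix.mul_sub, Matrix.nonsing_inv_mul _ hn, Matrix.sub_mul, Matrix.one_mul,
        Matrix.mul_assoc, Matrix.mul_nonsing_inv _ hL.nonsingular, Matrix.mul_one]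
      abel
    rw [this]; simp
  have hDT : ∀ a b, (fun n => (Ji n - Ξ)ᵀ a b) =O[atTop] fun n => h n ^ r := fun a b => hD b a
  have hhr : (fun n => h n ^ r) =o[atTop] fun _ => (1 : ℝ) := by
    rw [isLittleO_one_iff]
    have := h_zero.pow r
    rwa [zero_pow (by omega)] at this
  set R₁ : ℕ → Matrix (Fin d) (Fin d) ℝ := fun n => Ji n * V * (Ji n)ᵀ - Ξ * V * Ξᵀ with hR₁
  refine ⟨R₁, fun n => amse P q G X Z Y β₀ n (h n) - Ξ * T n * Ξᵀ - R₁ n,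
    Eventually.of_forall fun n => ?_, fun a b => ?_, fun a b => ?_⟩
  · have : Ξ * S * (1 + ((n : ℝ) * h n ^ (2 * r)) •
        Matrix.vecMulVec (meanB P r G Z f S) (meanB P r G Z f S) - h n • meanAA P G Z f S) *
          Sᵀ * ((sigmaZX P X Z g)ᵀ)⁻¹ = Ξ * T n * Ξᵀ := by
      rw [← Matrix.transpose_nonsing_inv]
      simp only [hT, Matrix.mul_assoc, ← hXi]
    rw [this]
    beta_reduce
    abel
  · have h1 := isBigO_matrix_mul (isBigO_matrix_mul hD (hc V)) hJiT a b
    have h2 := isBigO_matrix_mul (hc (Ξ * V)) hDT a b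
    simp only [one_mul, mul_one] at h1 h2
    refine (h1.add h2).congr_left fun n => ?_
    rw [← Matrix.add_apply]
    refine congrArg (fun M : Matrix (Fin d) (Fin d) ℝ => M a b) ?_
    simp only [hR₁, Matrix.transpose_sub, Matrix.sub_mul, Matrix.mul_sub]
    abel
  · have h1 := isLittleO_matrix_mul_left (isLittleO_matrix_mul_right hJi1 hET) hJiT a b
    have hD0 : ∀ a b, (fun n => (Ji n - Ξ) a b) =o[atTop] fun _ => (1 : ℝ) := fun a b =>
      (hD a b).trans_isLittleO hhr
    have hDT0 : ∀ a b, (fun n => (Ji n - Ξ)ᵀ a b) =o[atTop] fun _ => (1 : ℝ) := fun a b =>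
      hD0 b a
    have h2 := isLittleO_matrix_mul_left (isLittleO_matrix_mul_left hD0 hTV) hJiT a b
    have h3 := isLittleO_matrix_mul_right (isBigO_matrix_mul (hc Ξ) hTV) hDT0 a b
    simp only [one_mul, mul_one] at h1 h2 h3
    refine ((h1.add h2).add h3).congr' ?_ EventuallyEq.rfl
    filter_upwards [eventually_ne_atTop 0] with n hn
    rw [amse_eq hS hI hG hq0 hq1 hn, ← Matrix.add_apply, ← Matrix.add_apply]
    refine congrArg (fun M : Matrix (Fin d) (Fin d) ℝ => M a b) ?_
    change _ = Ji n * E n * (Ji n)ᵀ - Ξ * T n * Ξᵀ - R₁ n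
    simp only [hR₁, Matrix.transpose_sub, Matrix.sub_mul, Matrix.mul_sub]
    abel

end AMSE

end SEE

namespace SEE

/-! ### An exponential inequality -/

section Bernstein

variable {Ω : Type*} [MeasurableSpace Ω] {P : Measure Ω} [IsProbabilityMeasure P]

/-- On |x| ≤ 1 one has e^x ≤ 1 + x + x²; the mean-zero condition removes the linear term, and 1 + y
≤ e^y. -/
theorem mgf_le_exp_of_bounded {W : Ω → ℝ} (hm : Measurable W) {b s2 l : ℝ}
    (hb : ∀ᵐ ω ∂P, |W ω| ≤ b) (h0 : ∫ ω, W ω ∂P = 0) (hs : ∫ ω, W ω ^ 2 ∂P ≤ s2)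
    (hl : 0 ≤ l) (hlb : l * b ≤ 1) : mgf W P l ≤ Real.exp (l ^ 2 * s2) := by
  have hi : Integrable W P := Integrable.of_bound hm.aestronglyMeasurable b hb
  have hi2 : Integrable (fun ω => W ω ^ 2) P := by
    refine Integrable.of_bound (hm.pow_const 2).aestronglyMeasurable (b ^ 2) ?_
    filter_upwards [hb] with ω hω
    rw [norm_pow]; exact pow_le_pow_left₀ (norm_nonneg _) hω 2
  have hi3 : Integrable (fun ω => 1 + l * W ω + l ^ 2 * W ω ^ 2) P :=
    ((integrable_const 1).add (hi.const_mul l)).add (hi2.const_mul _)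
  have hi4 : Integrable (fun ω => 1 + l * W ω) P := (integrable_const 1).add (hi.const_mul l)
  calc mgf W P l ≤ ∫ ω, (1 + l * W ω + l ^ 2 * W ω ^ 2) ∂P := by
        refine integral_mono_of_nonneg (ae_of_all _ fun _ => (Real.exp_pos _).le) hi3 ?_
        filter_upwards [hb] with ω hω
        have h1 : |l * W ω| ≤ 1 := by
          rw [abs_mul, abs_of_nonneg hl]
          exact (mul_le_mul_of_nonneg_left hω hl).trans hlb
        have := (abs_le.1 (Real.abs_exp_sub_one_sub_id_le h1)).2
        rw [mul_pow] at this
        linarith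
    _ = 1 + l ^ 2 * ∫ ω, W ω ^ 2 ∂P := by
        rw [integral_add hi4 (hi2.const_mul _), integral_add (integrable_const 1) (hi.const_mul l),
          integral_const_mul, integral_const_mul, h0]
        simp
    _ ≤ 1 + l ^ 2 * s2 := by gcongr
    _ ≤ Real.exp (l ^ 2 * s2) := by linarith [Real.add_one_le_exp (l ^ 2 * s2)]

/-- Chernoff's bound. The exponent l is left free: it is chosen below so that n l² s2 stays bounded,
and then l t alone decides the decay. -/
theorem measure_sum_ge_le_of_bounded {W : ℕ → Ω → ℝ} (hind : iIndepFun W P)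
    (hm : ∀ j, Measurable (W j)) {b s2 l : ℝ} (hb : ∀ j, ∀ᵐ ω ∂P, |W j ω| ≤ b)
    (h0 : ∀ j, ∫ ω, W j ω ∂P = 0) (hs : ∀ j, ∫ ω, W j ω ^ 2 ∂P ≤ s2)
    (hl : 0 ≤ l) (hlb : l * b ≤ 1) (n : ℕ) (t : ℝ) :
    P.real {ω | t ≤ ∑ j ∈ Finset.range n, W j ω} ≤ Real.exp (n * l ^ 2 * s2 - l * t) := by
  have hexp : ∀ j, Integrable (fun ω => Real.exp (l * W j ω)) P := fun j => by
    refine Integrable.of_bound (hm j |>.const_mul l).exp.aestronglyMeasurable (Real.exp 1) ?_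
    filter_upwards [hb j] with ω hω
    rw [Real.norm_of_nonneg (Real.exp_pos _).le, Real.exp_le_exp]
    exact (mul_le_mul_of_nonneg_left ((le_abs_self _).trans hω) hl).trans hlb
  have h1 := measure_ge_le_exp_mul_mgf (μ := P) (X := ∑ j ∈ Finset.range n, W j) t hl
    (hind.integrable_exp_mul_sum hm fun j _ => hexp j)
  rw [hind.mgf_sum hm] at h1
  simp only [Finset.sum_apply] at h1
  refine h1.trans ?_
  calc Real.exp (-l * t) * ∏ j ∈ Finset.range n, mgf (W j) P l
      ≤ Real.exp (-l * t) * ∏ _j ∈ Finset.range n, Real.exp (l ^ 2 * s2) := by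
        refine mul_le_mul_of_nonneg_left ?_ (Real.exp_pos _).le
        exact Finset.prod_le_prod (fun _ _ => mgf_nonneg)
          fun j _ => mgf_le_exp_of_bounded (hm j) (hb j) (h0 j) (hs j) hl hlb
    _ = Real.exp (n * l ^ 2 * s2 - l * t) := by
        rw [Finset.prod_const, Finset.card_range, ← Real.exp_nat_mul, ← Real.exp_add]
        congr 1; ring

theorem measure_abs_sum_ge_le_of_bounded {W : ℕ → Ω → ℝ} (hind : iIndepFun W P)
    (hm : ∀ j, Measurable (W j)) {b s2 l : ℝ} (hb : ∀ j, ∀ᵐ ω ∂P, |W j ω| ≤ b)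
    (h0 : ∀ j, ∫ ω, W j ω ∂P = 0) (hs : ∀ j, ∫ ω, W j ω ^ 2 ∂P ≤ s2)
    (hl : 0 ≤ l) (hlb : l * b ≤ 1) (n : ℕ) (t : ℝ) :
    P {ω | t ≤ |∑ j ∈ Finset.range n, W j ω|}
      ≤ ENNReal.ofReal (2 * Real.exp (n * l ^ 2 * s2 - l * t)) := by
  have h1 := measure_sum_ge_le_of_bounded hind hm hb h0 hs hl hlb n t
  have h2 := measure_sum_ge_le_of_bounded (W := fun j ω => -W j ω)
    (hind.comp (fun _ x => -x) fun _ => measurable_neg) (fun j => (hm j).neg) (b := b) (s2 := s2)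
    (fun j => by simpa using hb j) (fun j => by rw [integral_neg, h0, neg_zero])
    (fun j => by simpa using hs j) hl hlb n t
  have hsub : {ω | t ≤ |∑ j ∈ Finset.range n, W j ω|}
      ⊆ {ω | t ≤ ∑ j ∈ Finset.range n, W j ω} ∪ {ω | t ≤ ∑ j ∈ Finset.range n, -W j ω} := by
    intro ω hω
    rcases le_abs.1 (show t ≤ |∑ j ∈ Finset.range n, W j ω| from hω) with h | h
    · exact Or.inl h
    · refine Or.inr ?_
      rw [← Finset.sum_neg_distrib] at h
      exact h
  have h3 : P.real {ω | t ≤ |∑ j ∈ Finset.range n, W j ω|}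
      ≤ 2 * Real.exp (n * l ^ 2 * s2 - l * t) :=
    ((measureReal_mono hsub).trans (measureReal_union_le _ _)).trans (by linarith)
  rw [← ofReal_measureReal]
  exact ENNReal.ofReal_le_ofReal h3

end Bernstein

/-! ### Uniform deviations -/

/-- Round each coordinate down to the lattice of mesh m. The coordinate errors are at most m, so the
Euclidean error is at most √d · m ≤ d · m. -/
theorem exists_grid {d : ℕ} (c : Vec d) (N : ℕ) {m : ℝ} (hm : 0 < m) :
    ∃ T : Finset (Vec d), T.card ≤ (2 * N + 1) ^ d ∧
      ∀ β : Vec d, ‖β - c‖ ≤ N * m → ∃ γ ∈ T, ‖β - γ‖ ≤ d * m := by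
  classical
  refine ⟨(Fintype.piFinset fun _ : Fin d => Finset.Icc (-(N : ℤ)) N).image
    fun k => c + WithLp.toLp 2 fun i => (k i : ℝ) * m, ?_, fun β hβ => ?_⟩
  · refine Finset.card_image_le.trans ?_
    rw [Fintype.card_piFinset_const, Int.card_Icc]
    refine Nat.pow_le_pow_left ?_ _
    omega
  · refine ⟨_, Finset.mem_image.2 ⟨fun i => ⌊(β i - c i) / m⌋, ?_, rfl⟩, ?_⟩
    · rw [Fintype.mem_piFinset]
      intro i
      have h1 : |β i - c i| ≤ N * m := (abs_coord_le (β - c) i).trans hβ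
      have h2 := abs_le.1 h1
      rw [Finset.mem_Icc]
      constructor
      · rw [Int.le_floor, le_div_iff₀ hm]; push_cast; linarith [h2.1]
      · have : (⌊(β i - c i) / m⌋ : ℝ) ≤ N :=
          (Int.floor_le _).trans ((div_le_iff₀ hm).2 h2.2)
        exact_mod_cast this
    · have hc : ∀ i, |(β - (c + WithLp.toLp 2 fun i => (⌊(β i - c i) / m⌋ : ℝ) * m)) i| ≤ m :=
        fun i => by
          have e : (β - (c + WithLp.toLp 2 fun i => (⌊(β i - c i) / m⌋ : ℝ) * m)) i
              = Int.fract ((β i - c i) / m) * m := by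
            simp only [PiLp.sub_apply, PiLp.add_apply, Int.fract, sub_mul, div_mul_cancel₀ _ hm.ne']
            ring
          rw [e, abs_mul, abs_of_pos hm, abs_of_nonneg (Int.fract_nonneg _)]
          exact mul_le_of_le_one_left hm.le (Int.fract_lt_one _).le
      rw [EuclideanSpace.norm_eq]
      refine Real.sqrt_le_iff.2 ⟨by positivity, ?_⟩
      calc _ ≤ ∑ _i : Fin d, m ^ 2 := Finset.sum_le_sum fun i _ => by
            rw [Real.norm_eq_abs]; exact pow_le_pow_left₀ (abs_nonneg _) (hc i) 2
        _ = d * m ^ 2 := by simp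
        _ ≤ (d * m) ^ 2 := by
            rw [mul_pow]
            refine mul_le_mul_of_nonneg_right ?_ (by positivity)
            exact_mod_cast Nat.le_self_pow (by norm_num) d

/-- The union bound over the grid: a number of points polynomial in n loses against exp(-n^κ/2). -/
theorem tendsto_card_mul_exp_neg (d : ℕ) {κ : ℝ} (hκ : 0 < κ) (K : ℝ) :
    Tendsto (fun n : ℕ => ((2 * (n : ℝ) ^ 4 + 1) ^ d) * (2 * Real.exp (K - (n : ℝ) ^ κ / 2)))
      atTop (𝓝 0) := by
  have h1 : Tendsto (fun n : ℕ => (n : ℝ) ^ κ) atTop atTop :=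
    (tendsto_rpow_atTop hκ).comp tendsto_natCast_atTop_atTop
  have h2 := ((tendsto_rpow_mul_exp_neg_mul_atTop_nhds_zero (4 * d / κ) (1 / 2)
    (by norm_num)).comp h1).const_mul (3 ^ d * (2 * Real.exp K))
  rw [mul_zero] at h2
  refine squeeze_zero' (Eventually.of_forall fun n => by positivity) ?_ h2
  filter_upwards [eventually_ge_atTop 1] with n hn
  have hn1 : (1 : ℝ) ≤ n := by exact_mod_cast hn
  have hpow : ((n : ℝ) ^ κ) ^ (4 * d / κ) = ((n : ℝ) ^ 4) ^ d := by
    rw [← Real.rpow_mul (by linarith), mul_div_cancel₀ _ hκ.ne', ← pow_mul]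
    exact_mod_cast Real.rpow_natCast (n : ℝ) (4 * d)
  simp only [Function.comp_apply]
  rw [hpow]
  calc (2 * (n : ℝ) ^ 4 + 1) ^ d * (2 * Real.exp (K - (n : ℝ) ^ κ / 2))
      ≤ (3 * (n : ℝ) ^ 4) ^ d * (2 * Real.exp (K - (n : ℝ) ^ κ / 2)) := by
        refine mul_le_mul_of_nonneg_right (pow_le_pow_left₀ (by positivity) ?_ d) (by positivity)
        have : (1 : ℝ) ≤ (n : ℝ) ^ 4 := one_le_pow₀ hn1
        linarith
    _ = _ := by
        rw [sub_eq_add_neg, Real.exp_add, mul_pow,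
          show -(1 / 2) * (n : ℝ) ^ κ = -((n : ℝ) ^ κ / 2) by ring]
        ring

variable {Ω : Type*} [MeasurableSpace Ω] {d : ℕ}

/-- A bounded process that is Lipschitz in the parameter deviates uniformly over a ball from its
mean by at most `t n`, up to an event of vanishing probability. -/
theorem tendsto_measure_uniform_deviation {P : Measure Ω} [IsProbabilityMeasure P] {q : ℝ}
    {X Z : ℕ → Ω → Vec d} {Y : ℕ → Ω → ℝ} {β₀ : Vec d} (hS : Sampling P q X Z Y β₀)
    (hX : Integrable (fun ω => ‖X 0 ω‖) P)
    {w : ℕ → Vec d → Vec d × Vec d × ℝ → ℝ} (hw : ∀ n β, Measurable (w n β))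
    {h ρ s2 l t : ℕ → ℝ} {b R K κ L : ℝ} (hb1 : 1 ≤ b) (hκ : 0 < κ) (hL : 0 ≤ L) (c : Vec d)
    (hb : ∀ᵐ ω ∂P, ∀ n β j, |w n β (X j ω, Z j ω, Y j ω)| ≤ b)
    (hlip : ∀ᵐ ω ∂P, ∀ n β γ j, |w n β (X j ω, Z j ω, Y j ω) - w n γ (X j ω, Z j ω, Y j ω)|
      ≤ L / h n * ‖X j ω‖ * ‖β - γ‖)
    (h_pos : ∀ n, 0 < h n) (hnh : Tendsto (fun n : ℕ => (n : ℝ) * h n) atTop atTop)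
    (hρR : ∀ᶠ n in atTop, ρ n ≤ R) (hρ : ∀ᶠ n : ℕ in atTop, (n : ℝ)⁻¹ ≤ ρ n)
    (hs2 : ∀ᶠ n in atTop, ∀ β, ‖β - c‖ ≤ 2 * ρ n →
      ∫ ω, w n β (X 0 ω, Z 0 ω, Y 0 ω) ^ 2 ∂P ≤ s2 n)
    (hl0 : ∀ n, 0 ≤ l n) (hlb : ∀ᶠ n in atTop, l n * (2 * b) ≤ 1)
    (hK : ∀ᶠ n : ℕ in atTop, (n : ℝ) * l n ^ 2 * s2 n ≤ K)
    (hlt : ∀ᶠ n : ℕ in atTop, (n : ℝ) ^ κ ≤ l n * t n) :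
    Tendsto (fun n => P {ω | ∃ β, ‖β - c‖ ≤ ρ n ∧
      t n < |∑ j ∈ Finset.range n, (w n β (X j ω, Z j ω, Y j ω)
        - ∫ ω', w n β (X 0 ω', Z 0 ω', Y 0 ω') ∂P)|}) atTop (𝓝 0) := by
  have hobs := fun n β j => (hw n β).comp (hS.measurable_obs j)
  have hwi : ∀ n β j, Integrable (fun ω => w n β (X j ω, Z j ω, Y j ω)) P := fun n β j => by
    refine Integrable.of_bound (hobs n β j).aestronglyMeasurable b ?_
    filter_upwards [hb] with ω hω using hω n β j
  set m : ℕ → Vec d → ℝ := fun n β => ∫ ω, w n β (X 0 ω, Z 0 ω, Y 0 ω) ∂P with hm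
  have hmb : ∀ n β, |m n β| ≤ b := fun n β => by
    have := norm_integral_le_of_norm_le_const (μ := P) (C := b)
      (f := fun ω => w n β (X 0 ω, Z 0 ω, Y 0 ω)) (by filter_upwards [hb] with ω hω using hω n β 0)
    simpa using this
  set EX := ∫ ω, ‖X 0 ω‖ ∂P with hEX
  have hEX0 : 0 ≤ EX := integral_nonneg fun _ => norm_nonneg _
  have hXj : ∀ j, Integrable (fun ω => ‖X j ω‖) P := fun j =>
    hS.integrable_obs j (F := fun x => ‖x.1‖) measurable_fst.norm hX
  have hEXj : ∀ j, ∫ ω, ‖X j ω‖ ∂P = EX := fun j =>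
    hS.integral_obs_eq j (F := fun x => ‖x.1‖) measurable_fst.norm
  have hmlip : ∀ n β γ, |m n β - m n γ| ≤ L / h n * EX * ‖β - γ‖ := fun n β γ => by
    simp only [hm]
    rw [← integral_sub (hwi n β 0) (hwi n γ 0), hEX, ← integral_const_mul, ← integral_mul_const,
      ← Real.norm_eq_abs]
    refine norm_integral_le_of_norm_le ((hX.const_mul _).mul_const _) ?_
    filter_upwards [hlip] with ω hω using hω n β γ 0
  -- deviations at a single point
  have hpt : ∀ᶠ n in atTop, ∀ β, ‖β - c‖ ≤ 2 * ρ n →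
      P {ω | t n / 2 ≤ |∑ j ∈ Finset.range n, (w n β (X j ω, Z j ω, Y j ω) - m n β)|}
        ≤ ENNReal.ofReal (2 * Real.exp (K - (n : ℝ) ^ κ / 2)) := by
    filter_upwards [hs2, hlb, hK, hlt] with n hs2 hlb hK hlt β hβ
    refine (measure_abs_sum_ge_le_of_bounded
      (W := fun j ω => w n β (X j ω, Z j ω, Y j ω) - m n β)
      (hS.indep.comp (fun _ x => w n β x - m n β) fun _ => (hw n β).sub_const _)
      (fun j => (hobs n β j).sub_const _) (b := 2 * b) (s2 := s2 n) ?_ ?_ ?_ (hl0 n) hlb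
      n (t n / 2)).trans ?_
    · intro j
      filter_upwards [hb] with ω hω
      refine (abs_sub _ _).trans ?_
      linarith [hω n β j, hmb n β]
    · intro j
      rw [integral_sub (hwi n β j) (integrable_const _), hS.integral_obs_eq j (hw n β)]
      simp [hm]
    · intro j
      have h1 := hS.integral_obs_eq j (F := fun x => (w n β x - m n β) ^ 2)
        (((hw n β).sub_const _).pow_const 2)
      rw [h1]
      have hsq : Integrable (fun ω => w n β (X 0 ω, Z 0 ω, Y 0 ω) ^ 2) P := by
        refine Integrable.of_bound ((hobs n β 0).pow_const 2).aestronglyMeasurable (b ^ 2) ?_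
        filter_upwards [hb] with ω hω
        rw [norm_pow]; exact pow_le_pow_left₀ (norm_nonneg _) (hω n β 0) 2
      have e : ∀ ω, (w n β (X 0 ω, Z 0 ω, Y 0 ω) - m n β) ^ 2
          = w n β (X 0 ω, Z 0 ω, Y 0 ω) ^ 2
            - (2 * m n β * w n β (X 0 ω, Z 0 ω, Y 0 ω) - m n β ^ 2) := fun ω => by ring
      have hi2 : Integrable (fun ω => 2 * m n β * w n β (X 0 ω, Z 0 ω, Y 0 ω) - m n β ^ 2) P :=
        ((hwi n β 0).const_mul _).sub (integrable_const _)
      simp_rw [e]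
      rw [integral_sub hsq hi2, integral_sub ((hwi n β 0).const_mul _) (integrable_const _),
        integral_const_mul]
      have h3 := hs2 β hβ
      have h4 : ∫ ω, w n β (X 0 ω, Z 0 ω, Y 0 ω) ∂P = m n β := rfl
      rw [h4]
      simp only [integral_const, probReal_univ, one_smul]
      nlinarith [sq_nonneg (m n β)]
    · refine ENNReal.ofReal_le_ofReal (mul_le_mul_of_nonneg_left ?_ (by norm_num))
      rw [Real.exp_le_exp]
      linarith
  -- oscillation between grid points
  set osc : ℕ → ℝ := fun n => L / h n * (d * ((n : ℝ) ^ 3)⁻¹) with hosc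
  have hosc0 : ∀ n, 0 ≤ osc n := fun n => by
    have := (h_pos n).le
    simp only [hosc]; positivity
  -- Forced by the hypotheses: l ≤ 1 while l t ≥ n^κ ≥ 1. It gives Markov's inequality below a
  -- threshold of at least 1/2.
  have ht1 : ∀ᶠ n in atTop, 1 ≤ t n := by
    filter_upwards [hlb, hlt, eventually_ge_atTop 1] with n h1 h2 hn
    have h3 : (1 : ℝ) ≤ (n : ℝ) ^ κ := Real.one_le_rpow (by exact_mod_cast hn) hκ.le
    have h4 : l n ≤ 1 := by nlinarith [hl0 n]
    by_contra! hcon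
    nlinarith [hl0 n]
  -- X may be unbounded, so the oscillation is controlled by Markov's inequality with E‖X‖. The mesh
  -- n⁻³ makes n · osc of order 1/(n · nh), which tends to 0.
  have hmark : ∀ᶠ n in atTop,
      P {ω | t n / 2 ≤ ∑ j ∈ Finset.range n, osc n * (‖X j ω‖ + EX)}
        ≤ ENNReal.ofReal (4 * EX * n * osc n) := by
    filter_upwards [ht1] with n ht
    have hij : ∀ j, Integrable (fun ω => osc n * (‖X j ω‖ + EX)) P := fun j =>
      ((hXj j).add (integrable_const _)).const_mul _
    have hi : Integrable (fun ω => ∑ j ∈ Finset.range n, osc n * (‖X j ω‖ + EX)) P :=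
      integrable_finsetSum _ fun j _ => hij j
    have h1 := mul_meas_ge_le_integral_of_nonneg (μ := P)
      (f := fun ω => ∑ j ∈ Finset.range n, osc n * (‖X j ω‖ + EX))
      (ae_of_all _ fun ω => Finset.sum_nonneg fun j _ => by
        have := hosc0 n; positivity) hi (t n / 2)
    have h2 : ∫ ω, ∑ j ∈ Finset.range n, osc n * (‖X j ω‖ + EX) ∂P = 2 * EX * n * osc n := by
      rw [integral_finsetSum _ fun j _ => hij j]
      have : ∀ j, ∫ ω, osc n * (‖X j ω‖ + EX) ∂P = osc n * (2 * EX) := fun j => by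
        rw [integral_const_mul, integral_add (hXj j) (integrable_const _), hEXj]
        simp only [integral_const, probReal_univ, one_smul]; ring
      simp_rw [this]
      rw [Finset.sum_const, Finset.card_range, nsmul_eq_mul]; ring
    rw [h2] at h1
    rw [← ofReal_measureReal]
    refine ENNReal.ofReal_le_ofReal ?_
    have h3 : (0 : ℝ) ≤ P.real {ω | t n / 2 ≤ ∑ j ∈ Finset.range n, osc n * (‖X j ω‖ + EX)} :=
      measureReal_nonneg
    nlinarith
  have hosc_lim : Tendsto (fun n : ℕ => 4 * EX * n * osc n) atTop (𝓝 0) := by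
    have h1 : Tendsto (fun n : ℕ => 4 * EX * L * d * (((n : ℝ) * h n)⁻¹ * (n : ℝ)⁻¹)) atTop
        (𝓝 0) := by
      have := ((tendsto_inv_atTop_zero.comp hnh).mul
        (tendsto_inv_atTop_zero.comp (tendsto_natCast_atTop_atTop (R := ℝ)))).const_mul
        (4 * EX * L * d)
      simpa using this
    refine h1.congr' ?_
    filter_upwards [eventually_ne_atTop 0] with n hn
    have hn' : (n : ℝ) ≠ 0 := by exact_mod_cast hn
    have := (h_pos n).ne'
    simp only [hosc]
    field_simp
  have hfin : ∀ᶠ n : ℕ in atTop, P {ω | ∃ β, ‖β - c‖ ≤ ρ n ∧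
      t n < |∑ j ∈ Finset.range n, (w n β (X j ω, Z j ω, Y j ω) - m n β)|}
      ≤ ENNReal.ofReal (((2 * (n : ℝ) ^ 4 + 1) ^ d) * (2 * Real.exp (K - (n : ℝ) ^ κ / 2)))
        + ENNReal.ofReal (4 * EX * n * osc n) := by
    filter_upwards [hpt, hmark, hρR, hρ, eventually_ge_atTop 1, eventually_ge_atTop d,
      tendsto_natCast_atTop_atTop.eventually_ge_atTop R] with n hpt hmark hρR hρ hn1 hnd hnR
    have hn0 : (0 : ℝ) < n := by exact_mod_cast hn1
    have hn1' : (1 : ℝ) ≤ n := by exact_mod_cast hn1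
    have hmesh : 0 < ((n : ℝ) ^ 3)⁻¹ := by positivity
    -- With n⁴ steps of size n⁻³ the grid covers radius n, which eventually exceeds the bound R on
    -- ρ.
    obtain ⟨T, hTc, hT⟩ := exists_grid c (n ^ 4) hmesh
    have hcov : ((n ^ 4 : ℕ) : ℝ) * ((n : ℝ) ^ 3)⁻¹ = n := by
      push_cast; field_simp
    rw [hcov] at hT
    -- Since the mesh error is at most 1/n ≤ ρ, the grid point next to a β in the ρ-ball lies in the
    -- 2ρ-ball; this is why the second moments are bounded on the doubled radius.
    have hdm : (d : ℝ) * ((n : ℝ) ^ 3)⁻¹ ≤ ρ n := by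
      refine le_trans ?_ hρ
      rw [← div_eq_mul_inv, ← one_div, div_le_div_iff₀ (by positivity) hn0]
      have : (d : ℝ) ≤ n := by exact_mod_cast hnd
      nlinarith [mul_nonneg hn0.le hn0.le, mul_nonneg (mul_nonneg hn0.le hn0.le) (sub_nonneg.2
          hn1')]
    classical
    set T' := T.filter fun γ => ‖γ - c‖ ≤ 2 * ρ n with hT'
    have hsub : {ω | ∃ β, ‖β - c‖ ≤ ρ n ∧
        t n < |∑ j ∈ Finset.range n, (w n β (X j ω, Z j ω, Y j ω) - m n β)|}
        ≤ᵐ[P] ((⋃ γ ∈ T',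
          {ω | t n / 2 ≤ |∑ j ∈ Finset.range n, (w n γ (X j ω, Z j ω, Y j ω) - m n γ)|}) ∪
          {ω | t n / 2 ≤ ∑ j ∈ Finset.range n, osc n * (‖X j ω‖ + EX)} : Set Ω) := by
      filter_upwards [hlip] with ω hω hbad
      obtain ⟨β, hβ, hdev⟩ := hbad
      obtain ⟨γ, hγT, hγ⟩ := hT β (hβ.trans (hρR.trans hnR))
      have hγc : ‖γ - c‖ ≤ 2 * ρ n := by
        have e : γ - c = (β - c) - (β - γ) := by abel
        rw [e]
        refine (norm_sub_le _ _).trans ?_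
        linarith
      by_contra hcon
      have h1' : |∑ j ∈ Finset.range n, (w n γ (X j ω, Z j ω, Y j ω) - m n γ)| < t n / 2 :=
        not_le.1 fun hle => hcon (Or.inl (Set.mem_biUnion
          (Finset.mem_coe.2 (Finset.mem_filter.2 ⟨hγT, hγc⟩)) hle))
      have h2' : ∑ j ∈ Finset.range n, osc n * (‖X j ω‖ + EX) < t n / 2 :=
        not_le.1 fun hle => hcon (Or.inr hle)
      have h3 : |∑ j ∈ Finset.range n, (w n β (X j ω, Z j ω, Y j ω) - m n β)
          - ∑ j ∈ Finset.range n, (w n γ (X j ω, Z j ω, Y j ω) - m n γ)|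
          ≤ ∑ j ∈ Finset.range n, osc n * (‖X j ω‖ + EX) := by
        rw [← Finset.sum_sub_distrib]
        refine (Finset.abs_sum_le_sum_abs _ _).trans (Finset.sum_le_sum fun j _ => ?_)
        have e : w n β (X j ω, Z j ω, Y j ω) - m n β - (w n γ (X j ω, Z j ω, Y j ω) - m n γ)
            = (w n β (X j ω, Z j ω, Y j ω) - w n γ (X j ω, Z j ω, Y j ω)) - (m n β - m n γ) := by
          ring
        rw [e]
        refine (abs_sub _ _).trans ((add_le_add (hω n β γ j) (hmlip n β γ)).trans ?_)
        have hLh : 0 ≤ L / h n := div_nonneg hL (h_pos n).le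
        calc L / h n * ‖X j ω‖ * ‖β - γ‖ + L / h n * EX * ‖β - γ‖
            = L / h n * (‖X j ω‖ + EX) * ‖β - γ‖ := by ring
          _ ≤ L / h n * (‖X j ω‖ + EX) * (d * ((n : ℝ) ^ 3)⁻¹) :=
              mul_le_mul_of_nonneg_left hγ (by positivity)
          _ = osc n * (‖X j ω‖ + EX) := by simp only [hosc]; ring
      have h4 := abs_sub_abs_le_abs_sub
        (∑ j ∈ Finset.range n, (w n β (X j ω, Z j ω, Y j ω) - m n β))
        (∑ j ∈ Finset.range n, (w n γ (X j ω, Z j ω, Y j ω) - m n γ))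
      linarith
    refine (measure_mono_ae hsub).trans ((measure_union_le _ _).trans (add_le_add ?_ hmark))
    refine (measure_biUnion_finset_le _ _).trans ?_
    refine (Finset.sum_le_card_nsmul _ _ _ fun γ hγ => hpt γ (Finset.mem_filter.1 hγ).2).trans ?_
    have hmul : ENNReal.ofReal (((2 * (n : ℝ) ^ 4 + 1) ^ d) * (2 * Real.exp (K - (n : ℝ) ^ κ / 2)))
        = ENNReal.ofReal ((2 * (n : ℝ) ^ 4 + 1) ^ d) *
          ENNReal.ofReal (2 * Real.exp (K - (n : ℝ) ^ κ / 2)) :=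
      ENNReal.ofReal_mul (by positivity)
    rw [nsmul_eq_mul, hmul]
    refine mul_le_mul' ?_ le_rfl
    have hcard : (T'.card : ℝ) ≤ (2 * (n : ℝ) ^ 4 + 1) ^ d := by
      exact_mod_cast (Finset.card_filter_le _ _).trans hTc
    rw [← ENNReal.ofReal_natCast]
    exact ENNReal.ofReal_le_ofReal hcard
  refine tendsto_of_tendsto_of_tendsto_of_le_of_le' tendsto_const_nhds ?_
    (Eventually.of_forall fun _ => zero_le) hfin
  have h1 := ENNReal.tendsto_ofReal (tendsto_card_mul_exp_neg d hκ K)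
  have h2 := ENNReal.tendsto_ofReal hosc_lim
  simpa using h1.add h2

end SEE

namespace SEE

/-! ### Smoothed increments against a density -/

namespace SmoothingFunction

variable {r : ℕ} {G : ℝ → ℝ}

/-- When |u| ≥ |t| + h, both arguments are at least 1 or both are at most -1, where G is constant.
-/
theorem increment_eq_zero (hG : SmoothingFunction r G) {h t u : ℝ} (h0 : 0 < h)
    (hu : |t| + h ≤ |u|) : G ((t - u) / h) - G (-u / h) = 0 := by
  have ht := abs_le.1 (le_refl |t|)
  have ht0 := abs_nonneg t
  rcases le_abs.1 hu with hu | hu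
  · rw [hG.eq_zero _ (by rw [div_le_iff₀ h0]; linarith),
      hG.eq_zero _ (by rw [div_le_iff₀ h0]; linarith), sub_self]
  · rw [hG.eq_one _ (by rw [le_div_iff₀ h0]; linarith),
      hG.eq_one _ (by rw [le_div_iff₀ h0]; linarith), sub_self]

/-- Integrate by parts against the primitive F of p: ∫ k p = -∫ k' F, where k' is the difference of
two rescaled copies of G'; substituting in each leaves F(t - hv) - F(-hv). The increment in t is
thereby moved from G, which has no second derivative, to the smooth p. -/
theorem setIntegral_increment_eq (hG : SmoothingFunction r G) {p : ℝ → ℝ} {ε h t C : ℝ}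
    (hp : ContinuousOn p (Set.Ioo (-ε) ε)) (hC : ∀ u ∈ Set.Ioo (-ε) ε, |p u| ≤ C)
    (h0 : 0 < h) (hε : |t| + h < ε) :
    ∫ u in Set.Ioo (-ε) ε, (G ((t - u) / h) - G (-u / h)) * p u
      = ∫ v in (-1 : ℝ)..1, deriv G v * ∫ u in (-(h * v))..(t - h * v), p u := by
  obtain ⟨L, hL⟩ := hG.lipschitz
  have ht0 := abs_nonneg t
  -- A radius strictly between |t| + h and ε: the increment vanishes at ±e, so there are no boundary
  -- terms, and F is Lipschitz on the closed interval inside the window.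
  set e := (|t| + h + ε) / 2 with he
  have he1 : |t| + h < e := by rw [he]; linarith
  have he2 : e < ε := by rw [he]; linarith
  have he0 : 0 < e := by linarith
  have hsub : Set.uIcc (-e) e ⊆ Set.Ioo (-ε) ε := by
    rw [Set.uIcc_of_le (by linarith)]
    exact fun u hu => ⟨by linarith [hu.1], by linarith [hu.2]⟩
  have hzero : (0 : ℝ) ∈ Set.Ioo (-ε) ε := ⟨by linarith, by linarith⟩
  have hint : ∀ a ∈ Set.Ioo (-ε) ε, ∀ b ∈ Set.Ioo (-ε) ε, IntervalIntegrable p volume a b :=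
    fun a ha b hb => (hp.mono (Set.ordConnected_Ioo.uIcc_subset ha hb)).intervalIntegrable
  set F : ℝ → ℝ := fun x => ∫ u in (0 : ℝ)..x, p u with hF
  have hFsub : ∀ a ∈ Set.Ioo (-ε) ε, ∀ b ∈ Set.Ioo (-ε) ε, F b - F a = ∫ u in a..b, p u :=
    fun a ha b hb =>
      intervalIntegral.integral_interval_sub_left (hint 0 hzero b hb) (hint 0 hzero a ha)
  have hC0 : 0 ≤ C := (abs_nonneg _).trans (hC 0 hzero)
  have hFlip : LipschitzOnWith ⟨C, hC0⟩ F (Set.uIcc (-e) e) := by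
    refine LipschitzOnWith.of_dist_le_mul fun x hx y hy => ?_
    rw [Real.dist_eq, Real.dist_eq, hFsub y (hsub hy) x (hsub hx)]
    have := intervalIntegral.norm_integral_le_of_norm_le_const (a := y) (b := x) (C := C) (f := p)
      fun u hu => hC u (Set.ordConnected_Ioo.uIcc_subset (hsub hy) (hsub hx)
        (Set.uIoc_subset_uIcc hu))
    exact this
  have hFd : ∀ u ∈ Set.Ioo (-ε) ε, deriv F u = p u := fun u hu => by
    have hcont : ContinuousAt p u := hp.continuousAt (isOpen_Ioo.mem_nhds hu)
    exact (intervalIntegral.integral_hasDerivAt_right (hint 0 hzero u hu)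
      (hp.stronglyMeasurableAtFilter isOpen_Ioo u hu) hcont).deriv
  set k : ℝ → ℝ := fun u => G ((t - u) / h) - G (-u / h) with hk
  have haff : ∀ s : ℝ, ∃ K, LipschitzWith K fun u : ℝ => G ((s - u) / h) := fun s => by
    refine ⟨L * ⟨h⁻¹, (inv_pos.2 h0).le⟩, hL.comp (LipschitzWith.of_dist_le_mul fun u v => ?_)⟩
    rw [Real.dist_eq, Real.dist_eq, ← sub_div, sub_sub_sub_cancel_left, abs_div, abs_of_pos h0,
      abs_sub_comm, div_eq_inv_mul]
    rfl
  have hkd : ∀ᵐ u : ℝ, deriv k u = -(deriv G ((t - u) / h) / h) + deriv G (-u / h) / h := by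
    obtain ⟨K1, hK1⟩ := haff t
    obtain ⟨K2, hK2⟩ := haff 0
    have hder : ∀ s u : ℝ, deriv (fun u : ℝ => G ((s - u) / h)) u
        = -(deriv G ((s - u) / h) / h) := fun s u => by
      have h1 : (fun u : ℝ => G ((s - u) / h)) = fun u => (fun y => G (h⁻¹ * y)) (s - u) := by
        funext u; simp only [div_eq_inv_mul]
      rw [h1]
      refine (deriv_comp_const_sub (fun y => G (h⁻¹ * y)) s u).trans ?_
      rw [deriv_comp_mul_left, smul_eq_mul, div_eq_inv_mul, div_eq_inv_mul]
    filter_upwards [hK1.ae_differentiableAt_real, hK2.ae_differentiableAt_real] with u h1 h2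
    have h3 : k = fun u => G ((t - u) / h) - G ((0 - u) / h) := by
      funext u; simp only [hk, zero_sub]
    rw [h3, deriv_fun_sub h1 h2, hder, hder, zero_sub]; ring
  have hkac : AbsolutelyContinuousOnInterval k (-e) e := by
    obtain ⟨K1, hK1⟩ := haff t
    obtain ⟨K2, hK2⟩ := haff 0
    simp only [zero_sub] at hK2
    exact (hK1.lipschitzOnWith (s := Set.uIcc (-e) e)).absolutelyContinuousOnInterval.fun_sub
      (hK2.lipschitzOnWith (s := Set.uIcc (-e) e)).absolutelyContinuousOnInterval
  have hparts := hkac.integral_mul_deriv_eq_deriv_mul hFlip.absolutelyContinuousOnInterval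
  have hke : k e = 0 := hG.increment_eq_zero h0 (by rw [abs_of_pos he0]; exact he1.le)
  have hke' : k (-e) = 0 := hG.increment_eq_zero h0 (by rw [abs_neg, abs_of_pos he0]; exact he1.le)
  rw [hke, hke', zero_mul, zero_mul, sub_zero, zero_sub] at hparts
  have hl1 : ∫ u in Set.Ioo (-ε) ε, k u * p u = ∫ u in (-e)..e, k u * deriv F u := by
    rw [intervalIntegral.integral_of_le (by linarith), ← integral_Icc_eq_integral_Ioc]
    rw [← setIntegral_eq_of_subset_of_forall_sdiff_eq_zero measurableSet_Ioo
      (show Set.Icc (-e) e ⊆ Set.Ioo (-ε) ε by rwa [Set.uIcc_of_le (by linarith)] at hsub)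
      (f := fun u => k u * deriv F u)]
    · refine setIntegral_congr_fun measurableSet_Ioo fun u hu => ?_
      simp only [hFd u hu]
    · intro u hu
      have : |t| + h ≤ |u| := by
        by_contra! hcon
        exact hu.2 (abs_le.1 (hcon.trans he1).le)
      simp only [hk, hG.increment_eq_zero h0 this, zero_mul]
  have hFc : ContinuousOn F (Set.uIcc (-e) e) := hFlip.continuousOn
  have hdint : ∀ s : ℝ, IntervalIntegrable (fun u => deriv G ((s - u) / h) * F u) volume (-e) e :=
    fun s => by
      refine IntervalIntegrable.mul_continuousOn ?_ hFc
      refine (intervalIntegrable_const (c := (L : ℝ))).mono_fun' ?_ ?_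
      · exact ((measurable_deriv G).comp ((measurable_const.sub measurable_id).div_const h)
          ).aestronglyMeasurable
      · exact ae_of_all _ fun u => norm_deriv_le_of_lipschitz hL
  have hl2 : ∀ s : ℝ, |s| ≤ |t| → ∫ u in (-e)..e, deriv G ((s - u) / h) * F u
      = h * ∫ v in (-1 : ℝ)..1, deriv G v * F (s - h * v) := fun s hs => by
    rw [intervalIntegral.integral_of_le (by linarith), integral_Ioc_eq_integral_Ioo]
    exact setIntegral_shifted_kernel_eq (fun v hv => hG.deriv_eq_zero hv) h0 (by linarith)
  have hmem : ∀ s : ℝ, |s| ≤ |t| → ∀ v ∈ Set.uIcc (-1 : ℝ) 1, s - h * v ∈ Set.uIcc (-e) e :=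
    fun s hs v hv => by
      rw [Set.uIcc_of_le (by norm_num)] at hv
      rw [Set.uIcc_of_le (by linarith)]
      have := abs_le.1 hs
      constructor <;> nlinarith [hv.1, hv.2]
  have hvint : ∀ s : ℝ, |s| ≤ |t| →
      IntervalIntegrable (fun v => deriv G v * F (s - h * v)) volume (-1) 1 := fun s hs => by
    refine IntervalIntegrable.mul_continuousOn ?_ (hFc.comp (by fun_prop) (hmem s hs))
    refine (intervalIntegrable_const (c := (L : ℝ))).mono_fun'
      (measurable_deriv G).aestronglyMeasurable ?_
    exact ae_of_all _ fun u => norm_deriv_le_of_lipschitz hL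
  change ∫ u in Set.Ioo (-ε) ε, k u * p u = _
  rw [hl1, hparts]
  have hl3 : ∫ u in (-e)..e, deriv k u * F u
      = ∫ u in (-e)..e, (h⁻¹ * (deriv G ((0 - u) / h) * F u)
        - h⁻¹ * (deriv G ((t - u) / h) * F u)) := by
    refine intervalIntegral.integral_congr_ae ?_
    filter_upwards [hkd] with u hu _
    rw [hu, zero_sub]; ring
  rw [hl3, intervalIntegral.integral_sub ((hdint 0).const_mul _) ((hdint t).const_mul _),
    intervalIntegral.integral_const_mul, intervalIntegral.integral_const_mul,
    hl2 0 (by simp), hl2 t le_rfl,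
    inv_mul_cancel_left₀ h0.ne', inv_mul_cancel_left₀ h0.ne', neg_sub,
    ← intervalIntegral.integral_sub (hvint t le_rfl) (hvint 0 (by simp))]
  refine intervalIntegral.integral_congr fun v hv => ?_
  have h1 := hsub (hmem t le_rfl v hv)
  have h2 := hsub (hmem 0 (by simp) v hv)
  rw [← mul_sub, hFsub _ h2 _ h1, zero_sub]

/-- Second-order Taylor bound for the smoothed distribution function. -/
theorem abs_setIntegral_increment_sub_le (hG : SmoothingFunction r G) {p : ℝ → ℝ} {ε h t B C : ℝ}
    (hp : ContDiffOn ℝ 1 p (Set.Ioo (-ε) ε)) (hC : ∀ u ∈ Set.Ioo (-ε) ε, |p u| ≤ C)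
    (hC' : ∀ u ∈ Set.Ioo (-ε) ε, |deriv p u| ≤ C) (hB : ∀ v, |deriv G v| ≤ B)
    (h0 : 0 < h) (hε : |t| + h < ε) :
    |(∫ u in Set.Ioo (-ε) ε, (G ((t - u) / h) - G (-u / h)) * p u)
      - t * ∫ u in Set.Ioo (-ε) ε, (deriv G (-u / h) / h) * p u| ≤ 2 * B * C * t ^ 2 := by
  have ht0 := abs_nonneg t
  have hB0 : 0 ≤ B := (abs_nonneg _).trans (hB 0)
  have hmem : ∀ s : ℝ, |s| ≤ |t| → ∀ v ∈ Set.uIcc (-1 : ℝ) 1, s - h * v ∈ Set.Ioo (-ε) ε :=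
    fun s hs v hv => by
      rw [Set.uIcc_of_le (by norm_num)] at hv
      have := abs_le.1 hs
      constructor <;> nlinarith [hv.1, hv.2]
  rw [hG.setIntegral_increment_eq hp.continuousOn hC h0 hε,
    setIntegral_kernel_eq (k := fun v => deriv G v / h) (fun v hv => by
      simp only [hG.deriv_eq_zero hv, zero_div]) h0 (by linarith)]
  have e1 : t * (h * ∫ v in (-1 : ℝ)..1, deriv G v / h * p (-(h * v)))
      = ∫ v in (-1 : ℝ)..1, deriv G v * (t * p (-(h * v))) := by
    rw [← intervalIntegral.integral_const_mul, ← intervalIntegral.integral_const_mul]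
    congr 1; funext v; field_simp
  have hmem0 : ∀ v ∈ Set.uIcc (-1 : ℝ) 1, -(h * v) ∈ Set.Ioo (-ε) ε := fun v hv => by
    simpa using hmem 0 (by simp) v hv
  have hkint : IntervalIntegrable (deriv G) volume (-1) 1 :=
    (intervalIntegrable_const (c := B)).mono_fun' (measurable_deriv G).aestronglyMeasurable
      (ae_of_all _ hB)
  have hpI : ∀ a ∈ Set.Ioo (-ε) ε, ∀ b ∈ Set.Ioo (-ε) ε, IntervalIntegrable p volume a b :=
    fun a ha b hb => (hp.continuousOn.mono
      (Set.ordConnected_Ioo.uIcc_subset ha hb)).intervalIntegrable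
  have hzero : (0 : ℝ) ∈ Set.Ioo (-ε) ε := ⟨by linarith, by linarith⟩
  have hFc : ContinuousOn (fun v => ∫ u in (-(h * v))..(t - h * v), p u) (Set.uIcc (-1) 1) := by
    have hF : ContinuousOn (fun x => ∫ u in (0 : ℝ)..x, p u) (Set.Ioo (-ε) ε) := fun x hx =>
      (intervalIntegral.integral_hasDerivAt_right (hpI 0 hzero x hx)
        (hp.continuousOn.stronglyMeasurableAtFilter isOpen_Ioo x hx)
        (hp.continuousOn.continuousAt
          (isOpen_Ioo.mem_nhds hx))).continuousAt.continuousWithinAt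
    refine ((hF.comp (by fun_prop) (hmem t le_rfl)).sub (hF.comp (by fun_prop) hmem0)).congr ?_
    intro v hv
    exact (intervalIntegral.integral_interval_sub_left (hpI 0 hzero _ (hmem t le_rfl v hv))
      (hpI 0 hzero _ (hmem0 v hv))).symm
  have hpc : ContinuousOn (fun v : ℝ => t * p (-(h * v))) (Set.uIcc (-1) 1) :=
    (hp.continuousOn.comp (by fun_prop) hmem0).const_smul t
  rw [e1, ← intervalIntegral.integral_sub (hkint.mul_continuousOn hFc)
    (hkint.mul_continuousOn hpc)]
  have := intervalIntegral.norm_integral_le_of_norm_le_const (a := (-1 : ℝ)) (b := 1)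
    (C := B * (C * t ^ 2)) (f := fun v => deriv G v * (∫ u in (-(h * v))..(t - h * v), p u)
      - deriv G v * (t * p (-(h * v)))) ?_
  · rw [Real.norm_eq_abs] at this
    refine this.trans (le_of_eq ?_)
    norm_num; ring
  · intro v hv
    have hv' := Set.uIoc_subset_uIcc hv
    have ha := hmem0 v hv'
    have hb := hmem t le_rfl v hv'
    rw [← mul_sub, norm_mul]
    refine mul_le_mul (hB v) ?_ (norm_nonneg _) hB0
    -- Subtracting the linear term leaves p(u) - p(-hv), at most C|t| over an interval of length
    -- |t|, whence t² with no power of 1/h.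
    have e2 : (∫ u in (-(h * v))..(t - h * v), p u) - t * p (-(h * v))
        = ∫ u in (-(h * v))..(t - h * v), (p u - p (-(h * v))) := by
      rw [intervalIntegral.integral_sub (hpI _ ha _ hb) intervalIntegrable_const]
      simp
    rw [e2]
    have h3 := intervalIntegral.norm_integral_le_of_norm_le_const (a := -(h * v)) (b := t - h * v)
      (C := C * |t|) (f := fun u => p u - p (-(h * v))) ?_
    · refine h3.trans (le_of_eq ?_)
      rw [show t - h * v - -(h * v) = t by ring, mul_assoc, abs_mul_abs_self, sq]
    · intro u hu
      have hu' := Set.uIoc_subset_uIcc hu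
      have huI := Set.ordConnected_Ioo.uIcc_subset ha hb hu'
      have h4 := (convex_Ioo (-ε) ε).norm_image_sub_le_of_norm_deriv_le (f := p) (C := C)
        (fun y hy => (hp.differentiableOn one_ne_zero).differentiableAt (isOpen_Ioo.mem_nhds hy))
        (fun y hy => hC' y hy) ha huI
      refine h4.trans (mul_le_mul_of_nonneg_left ?_ ((abs_nonneg _).trans (hC _ ha)))
      have h5 := Set.abs_sub_left_of_mem_uIcc hu'
      rw [Real.norm_eq_abs]
      refine h5.trans (le_of_eq ?_)
      rw [show t - h * v - -(h * v) = t by ring]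

/-- The increment is at most B|t|/h and at most 2B, and is supported on an interval of length 2(|t|
+ h). The first bound serves |t| ≤ h, the second |t| ≥ h; both give a multiple of t²/h. -/
theorem setIntegral_increment_sq_le (hG : SmoothingFunction r G) {p : ℝ → ℝ} {ε h t B C : ℝ}
    (hC : ∀ u ∈ Set.Ioo (-ε) ε, |p u| ≤ C) (hB1 : ∀ v, |G v| ≤ B)
    (hB2 : ∀ v w, |G v - G w| ≤ B * |v - w|) (h0 : 0 < h) (hε : |t| + h < ε) :
    |∫ u in Set.Ioo (-ε) ε, (G ((t - u) / h) - G (-u / h)) ^ 2 * p u|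
      ≤ 16 * B ^ 2 * C * (t ^ 2 / h) := by
  have ht0 := abs_nonneg t
  have hB0 : 0 ≤ B := (abs_nonneg _).trans (hB1 0)
  have hC0 : 0 ≤ C := (abs_nonneg _).trans (hC 0 ⟨by linarith, by linarith⟩)
  have hd : ∀ u, |G ((t - u) / h) - G (-u / h)| ≤ B * (|t| / h) := fun u => by
    refine (hB2 _ _).trans (le_of_eq ?_)
    rw [← sub_div, show t - u - -u = t by ring, abs_div, abs_of_pos h0]
  have hd2 : ∀ u, |G ((t - u) / h) - G (-u / h)| ≤ 2 * B := fun u =>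
    (abs_sub _ _).trans (by linarith [hB1 ((t - u) / h), hB1 (-u / h)])
  have e1 : ∫ u in Set.Ioo (-ε) ε, (G ((t - u) / h) - G (-u / h)) ^ 2 * p u
      = ∫ u in Set.Icc (-(|t| + h)) (|t| + h), (G ((t - u) / h) - G (-u / h)) ^ 2 * p u := by
    refine setIntegral_eq_of_subset_of_forall_sdiff_eq_zero measurableSet_Ioo ?_ ?_
    · exact fun u hu => ⟨by linarith [hu.1], by linarith [hu.2]⟩
    · intro u hu
      have : |t| + h ≤ |u| := by
        by_contra! hcon
        exact hu.2 (abs_le.1 hcon.le)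
      rw [hG.increment_eq_zero h0 this]; ring
  have key : ∀ D : ℝ, (∀ u, |G ((t - u) / h) - G (-u / h)| ≤ D) →
      |∫ u in Set.Ioo (-ε) ε, (G ((t - u) / h) - G (-u / h)) ^ 2 * p u|
        ≤ D ^ 2 * C * (2 * (|t| + h)) := fun D hD => by
    rw [e1, ← Real.norm_eq_abs]
    have := norm_setIntegral_le_of_norm_le_const (μ := volume) (s := Set.Icc (-(|t| + h)) (|t| + h))
      (f := fun u => (G ((t - u) / h) - G (-u / h)) ^ 2 * p u) (C := D ^ 2 * C)
      (by rw [Real.volume_Icc]; exact ENNReal.ofReal_lt_top) (fun u hu => by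
        rw [norm_mul, norm_pow]
        refine mul_le_mul (pow_le_pow_left₀ (norm_nonneg _) (hD u) 2)
          (hC u ⟨by linarith [hu.1], by linarith [hu.2]⟩) (norm_nonneg _) (by positivity))
    refine this.trans (le_of_eq ?_)
    rw [measureReal_def, Real.volume_Icc, ENNReal.toReal_ofReal (by linarith)]
    ring
  have hsq : |t| ^ 2 = t ^ 2 := sq_abs t
  have hBC : 0 ≤ B ^ 2 * C := by positivity
  rcases le_total |t| h with hth | hth
  · refine (key _ hd).trans ?_
    rw [← hsq, mul_pow, div_pow]
    have : B ^ 2 * (|t| ^ 2 / h ^ 2) * C * (2 * (|t| + h))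
        = B ^ 2 * C * (|t| ^ 2 / h) * ((2 * (|t| + h)) / h) := by field_simp
    rw [this, show 16 * B ^ 2 * C * (|t| ^ 2 / h) = B ^ 2 * C * (|t| ^ 2 / h) * 16 by ring]
    refine mul_le_mul_of_nonneg_left ?_ (by positivity)
    rw [div_le_iff₀ h0]; linarith
  · refine (key _ hd2).trans ?_
    rw [← hsq]
    have h1 : |t| ≤ |t| ^ 2 / h := by
      rw [le_div_iff₀ h0, sq]; exact mul_le_mul_of_nonneg_left hth ht0
    calc (2 * B) ^ 2 * C * (2 * (|t| + h)) ≤ (2 * B) ^ 2 * C * (4 * |t|) := by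
          refine mul_le_mul_of_nonneg_left (by linarith) (by positivity)
      _ = 16 * B ^ 2 * C * |t| := by ring
      _ ≤ _ := mul_le_mul_of_nonneg_left h1 (by positivity)

end SmoothingFunction

end SEE

namespace SEE

/-! ### Increments of the mean score -/

variable {Ω : Type*} [MeasurableSpace Ω] {d : ℕ}

section Increments

variable {P : Measure Ω} [IsProbabilityMeasure P] {r : ℕ} {q : ℝ} {X Z : ℕ → Ω → Vec d}
  {Y : ℕ → Ω → ℝ} {β₀ : Vec d} {G : ℝ → ℝ} {g : Vec d × Vec d → ℝ → ℝ} {C : Vec d × Vec d → ℝ}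
  {𝓑 : Set (Vec d)}

/-- Conditional first and second moments of smoothed increments. -/
theorem exists_condDistrib_increment_le {𝓦 : Type*} [MeasurableSpace 𝓦] {U : Ω → ℝ} {W : Ω → 𝓦}
    {g : 𝓦 → ℝ → ℝ} {C : 𝓦 → ℝ} {ε : ℝ} (hε : 0 < ε) (hG : SmoothingFunction r G) (hr : 2 < r)
    (hf : HasCondDensityNear P U W g ε)
    (hsm : ∀ᵐ w ∂(P.map W), ContDiffOn ℝ r (g w) (Set.Ioo (-ε) ε))
    (hbd : ∀ᵐ w ∂(P.map W), ∀ s ≤ r, ∀ u ∈ Set.Ioo (-ε) ε, |iteratedDeriv s (g w) u| ≤ C w) :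
    ∃ K : ℝ, 0 ≤ K ∧ ∀ᵐ w ∂(P.map W), 0 ≤ C w ∧ ∀ h t, 0 < h → h < ε / 2 → h ≤ 1 →
      ∫ u, |G ((t - u) / h) - G (-u / h) - t * (deriv G (-u / h) / h)| ∂(condDistrib U W P w)
        ≤ K * (1 + |t| * C w) ∧
      |∫ u, (G ((t - u) / h) - G (-u / h) - t * (deriv G (-u / h) / h)) ∂(condDistrib U W P w)|
        ≤ K * (1 + C w) * t ^ 2 ∧
      ∫ u, (G ((t - u) / h) - G (-u / h)) ^ 2 ∂(condDistrib U W P w)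
        ≤ K * (1 + C w) * (t ^ 2 / h) := by
  obtain ⟨B, hB1, hB, hB', hBL⟩ := hG.exists_bound
  have hB0 : 0 ≤ B := by linarith
  -- The sum of the constants of all cases: 2B for the L¹ bound and for small t, 8B/ε² and 4B/ε for
  -- the linearization at large t, 16B² and 16B²/ε² for the squares at small and large t.
  refine ⟨2 * B + 8 * B / ε ^ 2 + 4 * B / ε + 16 * B ^ 2 + 16 * B ^ 2 / ε ^ 2, by positivity, ?_⟩
  set K := 2 * B + 8 * B / ε ^ 2 + 4 * B / ε + 16 * B ^ 2 + 16 * B ^ 2 / ε ^ 2 with hK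
  have p1 : 0 ≤ 8 * B / ε ^ 2 := by positivity
  have p2 : 0 ≤ 4 * B / ε := by positivity
  have p3 : 0 ≤ 16 * B ^ 2 := by positivity
  have p4 : 0 ≤ 16 * B ^ 2 / ε ^ 2 := by positivity
  filter_upwards [hf.ae_integral_eq (hsm.mono fun w hw => hw.continuousOn), hsm, hbd,
    ae_condDistrib_slope_le hG hr hf hsm hbd hB'] with w hw hws hwb hwk
  have hC0 : 0 ≤ C w := (abs_nonneg _).trans (hwb 0 (by omega) 0 ⟨by linarith, hε⟩)
  refine ⟨hC0, fun h t h0 hhε hh1 => ?_⟩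
  have hp0 : ∀ u ∈ Set.Ioo (-ε) ε, |g w u| ≤ C w := fun u hu => by
    simpa using hwb 0 (by omega) u hu
  have hp1 : ∀ u ∈ Set.Ioo (-ε) ε, |deriv (g w) u| ≤ C w := fun u hu => by
    simpa using hwb 1 (by omega) u hu
  have hmG : ∀ s : ℝ, Measurable fun u : ℝ => G ((s - u) / h) := fun s =>
    hG.measurable.comp ((measurable_const.sub measurable_id).div_const h)
  have hmG0 : Measurable fun u : ℝ => G (-u / h) :=
    hG.measurable.comp (measurable_id.neg.div_const h)
  have hmd : Measurable fun u : ℝ => deriv G (-u / h) / h :=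
    ((measurable_deriv G).comp (measurable_id.neg.div_const h)).div_const h
  have hbi : ∀ u, |G ((t - u) / h) - G (-u / h)| ≤ 2 * B := fun u =>
    (abs_sub _ _).trans (by linarith [hB ((t - u) / h), hB (-u / h)])
  have hbd' : ∀ u, |deriv G (-u / h) / h| ≤ B / h := fun u => by
    rw [abs_div, abs_of_pos h0]; exact div_le_div_of_nonneg_right (hB' _) h0.le
  set κ := condDistrib U W P w with hκ
  have hiI : Integrable (fun u => G ((t - u) / h) - G (-u / h)) κ :=
    Integrable.of_bound ((hmG t).sub hmG0).aestronglyMeasurable (2 * B) (ae_of_all _ hbi)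
  have hiD : Integrable (fun u => deriv G (-u / h) / h) κ :=
    Integrable.of_bound hmd.aestronglyMeasurable (B / h) (ae_of_all _ hbd')
  have ht0 := abs_nonneg t
  have habs : ∫ u, |G ((t - u) / h) - G (-u / h) - t * (deriv G (-u / h) / h)| ∂κ
      ≤ 2 * B + |t| * (2 * B * C w) := by
    have h1 : Integrable (fun u => 2 * B + |t| * |deriv G (-u / h) / h|) κ :=
      (integrable_const _).add (hiD.abs.const_mul _)
    calc _ ≤ ∫ u, (2 * B + |t| * |deriv G (-u / h) / h|) ∂κ := by
          refine integral_mono (hiI.sub (hiD.const_mul t)).abs h1 fun u => ?_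
          refine (abs_sub _ _).trans (add_le_add (hbi u) (le_of_eq (abs_mul _ _)))
      _ = 2 * B + |t| * ∫ u, |deriv G (-u / h) / h| ∂κ := by
          rw [integral_add (integrable_const _) (hiD.abs.const_mul _), integral_const_mul |t|]
          simp
      _ ≤ _ := by
          gcongr
          exact (hwk h h0 (by linarith)).1
  have htC := mul_nonneg ht0 hC0
  refine ⟨habs.trans ?_, ?_, ?_⟩
  · calc 2 * B + |t| * (2 * B * C w) = 2 * B * (1 + |t| * C w) := by ring
      _ ≤ _ := mul_le_mul_of_nonneg_right (by linarith) (by linarith)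
  · by_cases ht : |t| < ε / 2
    · rw [hw _ (fun u hu => ?_)]
      · have hpb : ∀ φ : ℝ → ℝ, Measurable φ → ∀ D, (∀ u, |φ u| ≤ D) →
            IntegrableOn (fun u => φ u * g w u) (Set.Ioo (-ε) ε) := fun φ hφ D hD => by
          refine Integrable.of_bound (C := D * C w)
            (hφ.aestronglyMeasurable.mul
              (hws.continuousOn.aestronglyMeasurable measurableSet_Ioo)) ?_
          filter_upwards [ae_restrict_mem measurableSet_Ioo] with u hu
          rw [norm_mul]
          exact mul_le_mul (hD u) (hp0 u hu) (norm_nonneg _) ((abs_nonneg _).trans (hD u))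
        have e1 : ∀ u, (G ((t - u) / h) - G (-u / h) - t * (deriv G (-u / h) / h)) * g w u
            = (G ((t - u) / h) - G (-u / h)) * g w u - t * (deriv G (-u / h) / h * g w u) :=
          fun u => by ring
        simp_rw [e1]
        rw [integral_sub (hpb (fun u => G ((t - u) / h) - G (-u / h)) ((hmG t).sub hmG0) _ hbi)
          ((hpb (fun u => deriv G (-u / h) / h) hmd _ hbd').const_mul t), integral_const_mul]
        refine (hG.abs_setIntegral_increment_sub_le (hws.of_le (by exact_mod_cast (by omega)))
          hp0 hp1 hB' h0 (by linarith)).trans ?_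
        refine mul_le_mul_of_nonneg_right ?_ (sq_nonneg t)
        calc 2 * B * C w ≤ 2 * B * (1 + C w) := by nlinarith
          _ ≤ _ := mul_le_mul_of_nonneg_right (by linarith) (by linarith)
      · have hu' : ε ≤ |u| := by
          by_contra! hcon
          exact hu (abs_lt.1 hcon)
        rw [hG.increment_eq_zero h0 (by linarith), hG.deriv_eq_zero]
        · simp
        · rw [abs_div, abs_neg, abs_of_pos h0, lt_div_iff₀ h0]; linarith
    -- For |t| ≥ ε/2 the increment may leave the window where a density exists, but then 1 ≤ 4t²/ε²,
    -- so the crude bound is already quadratic in t.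
    · push Not at ht
      refine (abs_integral_le_integral_abs.trans habs).trans ?_
      have h1 : |t| ≤ 2 / ε * t ^ 2 := by
        rw [← sq_abs, sq, ← mul_assoc]
        refine le_mul_of_one_le_left ht0 ?_
        rw [div_mul_eq_mul_div, le_div_iff₀ hε]; linarith
      have h2 : 1 ≤ 4 / ε ^ 2 * t ^ 2 := by
        rw [← sq_abs t, div_mul_eq_mul_div, le_div_iff₀ (by positivity)]
        nlinarith
      have ht2 := sq_nonneg t
      calc 2 * B + |t| * (2 * B * C w)
          ≤ 2 * B * (4 / ε ^ 2 * t ^ 2) + (2 / ε * t ^ 2) * (2 * B * C w) :=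
            add_le_add (le_mul_of_one_le_right (by linarith) h2)
              (mul_le_mul_of_nonneg_right h1 (by positivity))
        _ = (8 * B / ε ^ 2 + 4 * B / ε * C w) * t ^ 2 := by ring
        _ ≤ _ := by
            refine mul_le_mul_of_nonneg_right ?_ ht2
            nlinarith [mul_nonneg p1 hC0, mul_nonneg p3 hC0, mul_nonneg p4 hC0,
              mul_nonneg hB0 hC0]
  · have ht2 : 0 ≤ t ^ 2 / h := by positivity
    by_cases ht : |t| < ε / 2
    · rw [hw _ (fun u hu => ?_)]
      · refine (le_abs_self _).trans
          ((hG.setIntegral_increment_sq_le hp0 hB hBL h0 (by linarith)).trans ?_)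
        refine mul_le_mul_of_nonneg_right ?_ ht2
        nlinarith [mul_nonneg p1 hC0, mul_nonneg p2 hC0, mul_nonneg p4 hC0, mul_nonneg hB0 hC0]
      · have hu' : ε ≤ |u| := by
          by_contra! hcon
          exact hu (abs_lt.1 hcon)
        rw [hG.increment_eq_zero h0 (by linarith)]; ring
    · push Not at ht
      have h1 : ∫ u, (G ((t - u) / h) - G (-u / h)) ^ 2 ∂κ ≤ (2 * B) ^ 2 := by
        have := norm_integral_le_of_norm_le_const (μ := κ) (C := (2 * B) ^ 2)
          (f := fun u => (G ((t - u) / h) - G (-u / h)) ^ 2) (ae_of_all _ fun u => by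
            rw [norm_pow]; exact pow_le_pow_left₀ (norm_nonneg _) (hbi u) 2)
        simpa using (le_abs_self _).trans this
      have h2 : 1 ≤ 4 / ε ^ 2 * (t ^ 2 / h) := by
        have h3 : t ^ 2 ≤ t ^ 2 / h := by
          rw [le_div_iff₀ h0]; nlinarith [sq_nonneg t]
        rw [div_mul_eq_mul_div, le_div_iff₀ (by positivity)]
        rw [← sq_abs t] at h3 ⊢
        nlinarith
      calc _ ≤ (2 * B) ^ 2 := h1
        _ ≤ (2 * B) ^ 2 * (4 / ε ^ 2 * (t ^ 2 / h)) := le_mul_of_one_le_right (by positivity) h2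
        _ = 16 * B ^ 2 / ε ^ 2 * (t ^ 2 / h) := by ring
        _ ≤ _ := by
            refine mul_le_mul_of_nonneg_right ?_ ht2
            nlinarith [mul_nonneg p1 hC0, mul_nonneg p2 hC0, mul_nonneg p3 hC0,
              mul_nonneg p4 hC0, mul_nonneg hB0 hC0]

theorem integrable_norm_X (hS : Sampling P q X Z Y β₀) (hR : RemainderRegularity P X Z Y 𝓑 C) :
    Integrable (fun ω => ‖X 0 ω‖) P := by
  refine (hR.third_moment.add (integrable_const 1)).mono' (hS.measurable_X
      0).norm.aestronglyMeasurable
    (ae_of_all _ fun ω => ?_)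
  have h0 := norm_nonneg (X 0 ω)
  rw [norm_norm]
  simp only [Pi.add_apply]
  nlinarith [sq_nonneg (‖X 0 ω‖ - 1), mul_nonneg h0 (sq_nonneg (‖X 0 ω‖ - 1)), sq_nonneg ‖X 0 ω‖]

theorem integrable_norm_mul_sq (hS : Sampling P q X Z Y β₀) (hI : Instruments P Z)
    (hL : CondLawGivenZX P r X Z Y β₀ g C) (hR : RemainderRegularity P X Z Y 𝓑 C)
    (hC : ∀ᵐ ω ∂P, 0 ≤ C (Z 0 ω, X 0 ω)) :
    Integrable (fun ω => (1 + C (Z 0 ω, X 0 ω)) * ‖Z 0 ω‖ * ‖X 0 ω‖ ^ 2) P := by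
  obtain ⟨M, hM1, hM⟩ := hI.exists_bound
  have hXm := (hS.measurable_X 0).norm
  have hZm := (hS.measurable_Z 0).norm
  have h1 : Integrable (fun ω => ‖Z 0 ω‖ * ‖X 0 ω‖ ^ 2) P := by
    refine ((hR.third_moment.add (integrable_const 1)).const_mul M).mono'
      (hZm.mul (hXm.pow_const 2)).aestronglyMeasurable ?_
    filter_upwards [hM] with ω hω
    have h0 := norm_nonneg (X 0 ω)
    rw [Real.norm_of_nonneg (by positivity)]
    refine mul_le_mul hω ?_ (by positivity) (by linarith)
    simp only [Pi.add_apply]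
    nlinarith [sq_nonneg (‖X 0 ω‖ - 1), mul_nonneg h0 (sq_nonneg (‖X 0 ω‖ - 1))]
  -- Interpolation x² ≤ x + x³ between the two dominated moments. The grouping inherits
  -- measurability from C‖Z‖‖X‖, as C alone need not be measurable.
  have h2 : Integrable (fun ω => C (Z 0 ω, X 0 ω) * ‖Z 0 ω‖ * ‖X 0 ω‖ * ‖X 0 ω‖) P := by
    refine (hL.dominated.add hR.third_moment_dominated).mono'
      (hL.dominated.aestronglyMeasurable.mul hXm.aestronglyMeasurable) ?_
    filter_upwards [hC] with ω hω
    have h0 := norm_nonneg (X 0 ω)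
    have h3 : 0 ≤ C (Z 0 ω, X 0 ω) * ‖Z 0 ω‖ := by positivity
    rw [Real.norm_of_nonneg (by positivity)]
    simp only [Pi.add_apply]
    rw [mul_assoc, ← mul_add]
    refine mul_le_mul_of_nonneg_left ?_ h3
    nlinarith [sq_nonneg (‖X 0 ω‖ - 1), mul_nonneg h0 (sq_nonneg (‖X 0 ω‖ - 1))]
  refine (h1.add h2).congr (ae_of_all _ fun ω => ?_)
  simp only [Pi.add_apply]; ring

/-- The mean score is quadratically close to its linearization, and the increments of the score
have second moments of order `‖Δ‖² / h`. -/
theorem exists_increment_bounds (hS : Sampling P q X Z Y β₀) (hI : Instruments P Z)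
    (hG : SmoothingFunction r G) (hq0 : 0 < q) (hq1 : q < 1)
    (hL : CondLawGivenZX P r X Z Y β₀ g C) (hR : RemainderRegularity P X Z Y 𝓑 C) :
    ∃ ε > 0, ∃ K, 1 ≤ K ∧ ∀ h, 0 < h → h < ε → ∀ (Δ : Vec d) (a : Fin d),
      |meanScore P q G X Z Y h (β₀ + Δ) a - meanScore P q G X Z Y h β₀ a
        - ∑ b, (∫ ω, slope G β₀ h a b (X 0 ω, Z 0 ω, Y 0 ω) ∂P) * Δ b| ≤ K * ‖Δ‖ ^ 2 ∧
      ∫ ω, (score q G h (β₀ + Δ) a (X 0 ω, Z 0 ω, Y 0 ω)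
        - score q G h β₀ a (X 0 ω, Z 0 ω, Y 0 ω)) ^ 2 ∂P ≤ K * (‖Δ‖ ^ 2 / h) := by
  obtain ⟨ε₁, hε₁, K₁, hK₁⟩ := exists_slope_bound hS hG hL
  obtain ⟨ε, hε, hf, hsm, hbd⟩ := hL.smooth
  obtain ⟨K, hK0, hK⟩ := exists_condDistrib_increment_le hε hG hL.order hf hsm hbd
  obtain ⟨M, hM1, hM⟩ := hI.exists_bound
  obtain ⟨B, hB1, hB, hB', hBL⟩ := hG.exists_bound
  have hWm : Measurable fun ω => (Z 0 ω, X 0 ω) := (hS.measurable_Z 0).prodMk (hS.measurable_X 0)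
  have hKω := ae_of_ae_map hWm.aemeasurable hK
  have hC0 : ∀ᵐ ω ∂P, 0 ≤ C (Z 0 ω, X 0 ω) := hKω.mono fun ω hω => hω.1
  have hE := integrable_norm_mul_sq hS hI hL hR hC0
  set E := ∫ ω, (1 + C (Z 0 ω, X 0 ω)) * ‖Z 0 ω‖ * ‖X 0 ω‖ ^ 2 ∂P with hEdef
  have hE0 : 0 ≤ E := integral_nonneg_of_ae (by
    filter_upwards [hC0] with ω hω
    positivity)
  have hZi : Integrable (fun ω => ‖Z 0 ω‖) P :=
    Integrable.of_bound (hS.measurable_Z 0).norm.aestronglyMeasurable M (by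
      filter_upwards [hM] with ω hω
      rwa [norm_norm])
  have htle : ∀ (x Δ : Vec d), inner ℝ x Δ ^ 2 ≤ ‖x‖ ^ 2 * ‖Δ‖ ^ 2 := fun x Δ => by
    rw [← mul_pow, ← sq_abs]
    exact pow_le_pow_left₀ (abs_nonneg _) (abs_real_inner_le_norm x Δ) 2
  set κ := condDistrib (err X Y β₀ 0) (fun ω => (Z 0 ω, X 0 ω)) P with hκ
  refine ⟨min (min (ε / 2) 1) ε₁, by positivity, 1 + M * K * E + K * E, ?_, ?_⟩
  · have : 0 ≤ M * K * E := by positivity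
    have : 0 ≤ K * E := by positivity
    linarith
  intro h h0 hh Δ a
  have hh1 : h < ε / 2 := hh.trans_le ((min_le_left _ _).trans (min_le_left _ _))
  have hh2 : h ≤ 1 := (hh.trans_le ((min_le_left _ _).trans (min_le_right _ _))).le
  have hh3 : h < ε₁ := hh.trans_le (min_le_right _ _)
  have hinc : ∀ ω, (inner ℝ (X 0 ω) (β₀ + Δ) - Y 0 ω) / h
      = (inner ℝ (X 0 ω) Δ - err X Y β₀ 0 ω) / h := fun ω => by
    rw [err, inner_add_right]; ring
  have hinc0 : ∀ ω, (inner ℝ (X 0 ω) β₀ - Y 0 ω) / h = -err X Y β₀ 0 ω / h := fun ω => by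
    rw [err]; ring
  have hmt : Measurable fun p : (Vec d × Vec d) × ℝ => (inner ℝ p.1.2 Δ : ℝ) :=
    measurable_fst.snd.inner measurable_const
  have hmi : Measurable fun p : (Vec d × Vec d) × ℝ =>
      G ((inner ℝ p.1.2 Δ - p.2) / h) - G (-p.2 / h) :=
    (hG.measurable.comp ((hmt.sub measurable_snd).div_const h)).sub
      (hG.measurable.comp (measurable_snd.neg.div_const h))
  have hmz : Measurable fun p : (Vec d × Vec d) × ℝ => p.1.1 a :=
    (measurable_coord a).comp measurable_fst.fst
  have hbi : ∀ t u : ℝ, |G ((t - u) / h) - G (-u / h)| ≤ 2 * B := fun t u =>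
    (abs_sub _ _).trans (by linarith [hB ((t - u) / h), hB (-u / h)])
  have hΔ2 := sq_nonneg ‖Δ‖
  constructor
  · obtain ⟨-, hi2⟩ := integrable_and_integral_eq_condDistrib (hS.measurable_err 0) hWm
      (Φ := fun p => p.1.1 a * (G ((inner ℝ p.1.2 Δ - p.2) / h) - G (-p.2 / h)
        - inner ℝ p.1.2 Δ * (deriv G (-p.2 / h) / h)))
      (hmz.mul (hmi.sub (hmt.mul
        (((measurable_deriv G).comp (measurable_snd.neg.div_const h)).div_const h))))
      (fun w => ⟨|w.1 a| * (2 * B + |inner ℝ w.2 Δ| * (B / h)), fun u => by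
        rw [abs_mul]
        refine mul_le_mul_of_nonneg_left ?_ (abs_nonneg _)
        refine (abs_sub _ _).trans (add_le_add (hbi _ u) ?_)
        rw [abs_mul, abs_div, abs_of_pos h0]
        exact mul_le_mul_of_nonneg_left (div_le_div_of_nonneg_right (hB' _) h0.le) (abs_nonneg _)⟩)
      (D := fun w => K * ‖w.1‖ + K * ‖Δ‖ * (C w * ‖w.1‖ * ‖w.2‖))
      (by
        filter_upwards [hK] with w hw
        simp_rw [abs_mul (w.1 a)]
        rw [integral_const_mul]
        calc _ ≤ ‖w.1‖ * (K * (1 + |inner ℝ w.2 Δ| * C w)) :=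
              mul_le_mul (abs_coord_le _ _) (hw.2 h (inner ℝ w.2 Δ) h0 hh1 hh2).1
                (integral_nonneg fun _ => abs_nonneg _) (norm_nonneg _)
          _ ≤ ‖w.1‖ * (K * (1 + (‖w.2‖ * ‖Δ‖) * C w)) := by
              have := abs_real_inner_le_norm w.2 Δ
              have := hw.1
              gcongr
          _ = _ := by ring)
      ((hZi.const_mul K).add (hL.dominated.const_mul _))
    have hsc := fun β => integrable_score hS hI hG hq0 hq1 0 h β a
    have hsl := fun b => (hK₁ h h0 hh3 a b).1
    have hsum : Integrable (fun ω => ∑ b, slope G β₀ h a b (X 0 ω, Z 0 ω, Y 0 ω) * Δ b) P :=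
      integrable_finsetSum _ fun b _ => (hsl b).mul_const _
    have hdiff : Integrable (fun ω => score q G h (β₀ + Δ) a (X 0 ω, Z 0 ω, Y 0 ω)
        - score q G h β₀ a (X 0 ω, Z 0 ω, Y 0 ω)) P := (hsc _).sub (hsc _)
    have e1 : meanScore P q G X Z Y h (β₀ + Δ) a - meanScore P q G X Z Y h β₀ a
        - ∑ b, (∫ ω, slope G β₀ h a b (X 0 ω, Z 0 ω, Y 0 ω) ∂P) * Δ b
        = ∫ ω, Z 0 ω a * (G ((inner ℝ (X 0 ω) Δ - err X Y β₀ 0 ω) / h) - G (-err X Y β₀ 0 ω / h)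
          - inner ℝ (X 0 ω) Δ * (deriv G (-err X Y β₀ 0 ω / h) / h)) ∂P := by
      simp_rw [← integral_mul_const]
      rw [← integral_finsetSum _ fun b _ => (hsl b).mul_const _, meanScore, meanScore,
        ← integral_sub (hsc _) (hsc _), ← integral_sub hdiff hsum]
      refine integral_congr_ae (ae_of_all _ fun ω => ?_)
      simp only [score, slope, hinc, hinc0]
      have : (inner ℝ (X 0 ω) Δ : ℝ) = ∑ b, X 0 ω b * Δ b := by
        simp [PiLp.inner_apply, mul_comm]
      rw [this, mul_sub, Finset.sum_mul, Finset.mul_sum]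
      congr 1
      · ring
      · exact Finset.sum_congr rfl fun b _ => by ring
    rw [e1, hi2, ← Real.norm_eq_abs]
    have := norm_integral_le_of_norm_le
      (f := fun ω => ∫ u, Z 0 ω a * (G ((inner ℝ (X 0 ω) Δ - u) / h) - G (-u / h)
          - inner ℝ (X 0 ω) Δ * (deriv G (-u / h) / h)) ∂(κ (Z 0 ω, X 0 ω)))
      (hE.mul_const (K * ‖Δ‖ ^ 2)) (by
        filter_upwards [hKω] with ω hω
        rw [integral_const_mul, norm_mul]
        have h1 := (hω.2 h (inner ℝ (X 0 ω) Δ) h0 hh1 hh2).2.1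
        have h2 := hω.1
        calc _ ≤ ‖Z 0 ω‖ * (K * (1 + C (Z 0 ω, X 0 ω)) * inner ℝ (X 0 ω) Δ ^ 2) :=
              mul_le_mul (abs_coord_le _ _) h1 (abs_nonneg _) (norm_nonneg _)
          _ ≤ ‖Z 0 ω‖ * (K * (1 + C (Z 0 ω, X 0 ω)) * (‖X 0 ω‖ ^ 2 * ‖Δ‖ ^ 2)) := by
              gcongr
              exact htle _ _
          _ = _ := by ring)
    refine this.trans ?_
    rw [integral_mul_const, ← hEdef, ← mul_assoc]
    refine mul_le_mul_of_nonneg_right ?_ hΔ2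
    have : 0 ≤ M * K * E := by positivity
    nlinarith
  · have hpt : ∀ w : Vec d × Vec d, ∀ u : ℝ,
        |(|w.1 a| * (G ((inner ℝ w.2 Δ - u) / h) - G (-u / h)) ^ 2)|
          = |w.1 a| * (G ((inner ℝ w.2 Δ - u) / h) - G (-u / h)) ^ 2 := fun w u =>
      abs_of_nonneg (by positivity)
    have hcond : ∀ᵐ w ∂(P.map fun ω => (Z 0 ω, X 0 ω)),
        ∫ u, |w.1 a| * (G ((inner ℝ w.2 Δ - u) / h) - G (-u / h)) ^ 2 ∂(κ w)
          ≤ (1 + C w) * ‖w.1‖ * ‖w.2‖ ^ 2 * (K * (‖Δ‖ ^ 2 / h)) := by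
      filter_upwards [hK] with w hw
      have h2 := hw.1
      rw [integral_const_mul]
      calc _ ≤ ‖w.1‖ * (K * (1 + C w) * (inner ℝ w.2 Δ ^ 2 / h)) :=
            mul_le_mul (abs_coord_le _ _) (hw.2 h (inner ℝ w.2 Δ) h0 hh1 hh2).2.2
              (integral_nonneg fun _ => sq_nonneg _) (norm_nonneg _)
        _ ≤ ‖w.1‖ * (K * (1 + C w) * (‖w.2‖ ^ 2 * ‖Δ‖ ^ 2 / h)) := by
            gcongr
            exact htle _ _
        _ = _ := by ring
    obtain ⟨hi1, hi2⟩ := integrable_and_integral_eq_condDistrib (hS.measurable_err 0) hWm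
      (Φ := fun p => |p.1.1 a| * (G ((inner ℝ p.1.2 Δ - p.2) / h) - G (-p.2 / h)) ^ 2)
      (hmz.norm.mul (hmi.pow_const 2))
      (fun w => ⟨|w.1 a| * (2 * B) ^ 2, fun u => by
        rw [hpt]
        refine mul_le_mul_of_nonneg_left ?_ (abs_nonneg _)
        rw [← sq_abs]
        exact pow_le_pow_left₀ (abs_nonneg _) (hbi _ u) 2⟩)
      (D := fun w => (1 + C w) * ‖w.1‖ * ‖w.2‖ ^ 2 * (K * (‖Δ‖ ^ 2 / h)))
      (by simpa only [hpt] using hcond)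
      (hE.mul_const _)
    have h3 : ∫ ω, |Z 0 ω a| * (G ((inner ℝ (X 0 ω) Δ - err X Y β₀ 0 ω) / h)
        - G (-err X Y β₀ 0 ω / h)) ^ 2 ∂P ≤ E * (K * (‖Δ‖ ^ 2 / h)) := by
      rw [hi2, hEdef, ← integral_mul_const]
      refine integral_mono_of_nonneg (ae_of_all _ fun ω => integral_nonneg fun u => by positivity)
        (hE.mul_const _) (ae_of_ae_map hWm.aemeasurable hcond)
    have h4 : ∫ ω, (score q G h (β₀ + Δ) a (X 0 ω, Z 0 ω, Y 0 ω)
        - score q G h β₀ a (X 0 ω, Z 0 ω, Y 0 ω)) ^ 2 ∂P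
        ≤ ∫ ω, M * (|Z 0 ω a| * (G ((inner ℝ (X 0 ω) Δ - err X Y β₀ 0 ω) / h)
        - G (-err X Y β₀ 0 ω / h)) ^ 2) ∂P := by
      refine integral_mono_of_nonneg (ae_of_all _ fun ω => sq_nonneg _) (hi1.const_mul M) ?_
      filter_upwards [hM] with ω hω
      simp only [score, hinc, hinc0]
      have h5 : |Z 0 ω a| ≤ M := (abs_coord_le _ _).trans hω
      -- Bounded instruments trade one factor of Z for M, since the available moments of C contain
      -- only one power of ‖Z‖.
      have h6 : Z 0 ω a ^ 2 ≤ M * |Z 0 ω a| := by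
        rw [← sq_abs, sq]; exact mul_le_mul_of_nonneg_right h5 (abs_nonneg _)
      have h7 := sq_nonneg (G ((inner ℝ (X 0 ω) Δ - err X Y β₀ 0 ω) / h)
        - G (-err X Y β₀ 0 ω / h))
      calc _ = Z 0 ω a ^ 2 * (G ((inner ℝ (X 0 ω) Δ - err X Y β₀ 0 ω) / h)
            - G (-err X Y β₀ 0 ω / h)) ^ 2 := by ring
        _ ≤ _ := by
            rw [← mul_assoc]
            exact mul_le_mul_of_nonneg_right h6 h7
    rw [integral_const_mul] at h4
    refine h4.trans ((mul_le_mul_of_nonneg_left h3 (by linarith)).trans ?_)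
    rw [← mul_assoc, ← mul_assoc]
    refine mul_le_mul_of_nonneg_right ?_ (by positivity)
    have : 0 ≤ K * E := by positivity
    nlinarith

end Increments

end SEE

namespace SEE

/-! ### Identification in the limit -/

variable {Ω : Type*} [MeasurableSpace Ω] {d : ℕ}

section Consistency

variable {P : Measure Ω} {r : ℕ} {q : ℝ} {X Z : ℕ → Ω → Vec d}
  {Y : ℕ → Ω → ℝ} {β₀ : Vec d} {G : ℝ → ℝ} {C : Vec d × Vec d → ℝ} {𝓑 : Set (Vec d)}

theorem exists_score_lipschitz (hS : Sampling P q X Z Y β₀) (hI : Instruments P Z)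
    (hG : SmoothingFunction r G) :
    ∃ L : ℝ, 0 ≤ L ∧ ∀ᵐ ω ∂P, ∀ (j : ℕ) (h : ℝ), 0 < h → ∀ (β γ : Vec d) (a : Fin d),
      |score q G h β a (X j ω, Z j ω, Y j ω) - score q G h γ a (X j ω, Z j ω, Y j ω)|
        ≤ L / h * ‖X j ω‖ * ‖β - γ‖ := by
  obtain ⟨B, hB1, -, -, hBL⟩ := hG.exists_bound
  obtain ⟨M, hM1, hM⟩ := hI.exists_bound
  have hj : ∀ᵐ ω ∂P, ∀ j, ‖Z j ω‖ ≤ M := by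
    rw [ae_all_iff]
    intro j
    exact hS.ae_obs j (p := fun x => ‖x.2.1‖ ≤ M)
      (measurableSet_le measurable_snd.fst.norm measurable_const) hM
  refine ⟨B * M, by nlinarith, ?_⟩
  filter_upwards [hj] with ω hω j h h0 β γ a
  rw [score, score, ← sub_mul, sub_sub_sub_cancel_right, abs_mul]
  have h1 := hBL ((inner ℝ (X j ω) β - Y j ω) / h) ((inner ℝ (X j ω) γ - Y j ω) / h)
  rw [← sub_div, sub_sub_sub_cancel_right, ← inner_sub_right, abs_div, abs_of_pos h0] at h1
  have h2 := abs_real_inner_le_norm (X j ω) (β - γ)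
  calc _ ≤ (B * ((‖X j ω‖ * ‖β - γ‖) / h)) * M := by
        refine mul_le_mul (h1.trans ?_) ((abs_coord_le _ _).trans (hω j)) (abs_nonneg _)
          (by positivity)
        gcongr
    _ = _ := by ring

variable [IsProbabilityMeasure P]

/-- Off the null event Y = X'β, the G-term equals exactly 0 or 1 for all (h, β') near (0, β), so
bounded convergence applies. The limit is taken jointly in (h, β') so that compactness can replace
uniform convergence. -/
theorem tendsto_meanScore_prod (hS : Sampling P q X Z Y β₀) (hI : Instruments P Z)
    (hG : SmoothingFunction r G) (hq0 : 0 < q) (hq1 : q < 1) {β : Vec d}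
    (hβ : P {ω | Y 0 ω = inner ℝ (X 0 ω) β} = 0) (a : Fin d) :
    Tendsto (fun p : ℝ × Vec d => meanScore P q G X Z Y p.1 p.2 a) (𝓝[>] 0 ×ˢ 𝓝 β)
      (𝓝 (∫ ω, (Set.indicator {ω' | Y 0 ω' < inner ℝ (X 0 ω') β} 1 ω - q) * Z 0 ω a ∂P)) := by
  obtain ⟨b, -, hb⟩ := exists_score_bound hS hI hG hq0 hq1
  refine tendsto_integral_filter_of_dominated_convergence (fun _ => b) ?_ ?_
    (integrable_const b) ?_
  · exact Eventually.of_forall fun p =>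
      ((measurable_score hG q p.1 p.2 a).comp (hS.measurable_obs 0)).aestronglyMeasurable
  · refine Eventually.of_forall fun p => ?_
    filter_upwards [hb] with ω hω using hω 0 p.1 p.2 a
  · have hne : ∀ᵐ ω ∂P, Y 0 ω ≠ inner ℝ (X 0 ω) β := by
      rw [ae_iff]; simpa using hβ
    filter_upwards [hne] with ω hω
    have hin : Tendsto (fun p : ℝ × Vec d => inner ℝ (X 0 ω) p.2 - Y 0 ω) (𝓝[>] 0 ×ˢ 𝓝 β)
        (𝓝 (inner ℝ (X 0 ω) β - Y 0 ω)) := by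
      refine Tendsto.sub_const ?_ _
      exact ((continuous_const.inner continuous_id).tendsto β).comp tendsto_snd
    have hpos : ∀ᶠ p : ℝ × Vec d in 𝓝[>] 0 ×ˢ 𝓝 β, 0 < p.1 :=
      tendsto_fst.eventually (eventually_mem_nhdsWithin)
    have hsmall : Tendsto (fun p : ℝ × Vec d => p.1) (𝓝[>] 0 ×ˢ 𝓝 β) (𝓝 0) :=
      tendsto_fst.mono_right nhdsWithin_le_nhds
    refine tendsto_const_nhds.congr' ?_
    rcases lt_or_gt_of_ne hω with hlt | hgt
    · have hev : ∀ᶠ p : ℝ × Vec d in 𝓝[>] 0 ×ˢ 𝓝 β, p.1 < inner ℝ (X 0 ω) p.2 - Y 0 ω :=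
        hsmall.eventually_lt hin (sub_pos.2 hlt)
      filter_upwards [hpos, hev] with p hp0 hp
      rw [score, hG.eq_one _ (by rw [le_div_iff₀ hp0]; linarith),
        Set.indicator_of_mem (by exact hlt), Pi.one_apply]
    · have hev : ∀ᶠ p : ℝ × Vec d in 𝓝[>] 0 ×ˢ 𝓝 β, inner ℝ (X 0 ω) p.2 - Y 0 ω < -p.1 := by
        refine hin.eventually_lt hsmall.neg ?_
        rw [neg_zero]; linarith
      filter_upwards [hpos, hev] with p hp0 hp
      rw [score, hG.eq_zero _ (by rw [div_le_iff₀ hp0]; linarith),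
        Set.indicator_of_notMem (by exact not_lt.2 hgt.le)]

/-- Away from `β₀`, the mean score is bounded away from zero uniformly over `𝓑`. -/
theorem exists_le_meanScore (hS : Sampling P q X Z Y β₀) (hI : Instruments P Z)
    (hG : SmoothingFunction r G) (hq0 : 0 < q) (hq1 : q < 1)
    (hid : Identification P q X Z Y β₀ 𝓑) (hR : RemainderRegularity P X Z Y 𝓑 C)
    {ρ : ℝ} (hρ : 0 < ρ) :
    ∃ c > 0, ∀ᶠ h in 𝓝[>] (0 : ℝ), ∀ β ∈ 𝓑, ρ ≤ ‖β - β₀‖ →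
      ∃ a, c ≤ |meanScore P q G X Z Y h β a| := by
  have hcl : IsClosed {β : Vec d | ρ ≤ ‖β - β₀‖} :=
    isClosed_le continuous_const (continuous_id.sub continuous_const).norm
  have hK := hR.compact.inter_right hcl
  suffices hs : ∃ c > 0, ∀ᶠ h in 𝓝[>] (0 : ℝ), ∀ β ∈ 𝓑 ∩ {β : Vec d | ρ ≤ ‖β - β₀‖},
      ∃ a, c ≤ |meanScore P q G X Z Y h β a| by
    obtain ⟨c, hc, h1⟩ := hs
    exact ⟨c, hc, h1.mono fun h h2 β hβ hβρ => h2 β ⟨hβ, hβρ⟩⟩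
  -- The existence of a uniform lower bound passes to subsets and finite unions, so by compactness
  -- it suffices to have it near each point β ≠ β₀.
  refine hK.induction_on (p := fun s => ∃ c > 0, ∀ᶠ h in 𝓝[>] (0 : ℝ), ∀ β ∈ s,
      ∃ a, c ≤ |meanScore P q G X Z Y h β a|) ?_ ?_ ?_ ?_
  · exact ⟨1, one_pos, Eventually.of_forall fun h β hβ => absurd hβ (Set.notMem_empty β)⟩
  · rintro s t hst ⟨c, hc, h1⟩
    exact ⟨c, hc, h1.mono fun h h2 β hβ => h2 β (hst hβ)⟩
  · rintro s t ⟨c, hc, h1⟩ ⟨c', hc', h1'⟩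
    refine ⟨min c c', lt_min hc hc', ?_⟩
    filter_upwards [h1, h1'] with h h2 h2' β hβ
    rcases hβ with hβ | hβ
    · obtain ⟨a, ha⟩ := h2 β hβ
      exact ⟨a, (min_le_left _ _).trans ha⟩
    · obtain ⟨a, ha⟩ := h2' β hβ
      exact ⟨a, (min_le_right _ _).trans ha⟩
  · rintro β ⟨hβ, hβρ⟩
    have hne : β ≠ β₀ := by
      rintro rfl
      simp only [Set.mem_ofPred_eq, sub_self, norm_zero] at hβρ
      linarith
    obtain ⟨M, hM1, hM⟩ := hI.exists_bound
    have hind : Measurable (Set.indicator {ω' | Y 0 ω' < inner ℝ (X 0 ω') β} (1 : Ω → ℝ)) :=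
      measurable_one.indicator (measurableSet_lt (hS.measurable_Y 0)
        ((hS.measurable_X 0).inner measurable_const))
    have hindb : ∀ ω, |q - Set.indicator {ω' | Y 0 ω' < inner ℝ (X 0 ω') β} (1 : Ω → ℝ) ω| ≤ 1 :=
      fun ω => by
        by_cases hω : ω ∈ {ω' | Y 0 ω' < inner ℝ (X 0 ω') β}
        · rw [Set.indicator_of_mem hω, Pi.one_apply, abs_le]; constructor <;> linarith
        · rw [Set.indicator_of_notMem hω, abs_le]; constructor <;> linarith
    have hint : Integrable (fun ω => (q - Set.indicator {ω' | Y 0 ω' < inner ℝ (X 0 ω') β}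
        (1 : Ω → ℝ) ω) • Z 0 ω) P := by
      refine Integrable.of_bound
        ((hind.const_sub q).smul (hS.measurable_Z 0)).aestronglyMeasurable M ?_
      filter_upwards [hM] with ω hω
      rw [norm_smul]
      calc _ ≤ 1 * M := mul_le_mul (hindb ω) hω (norm_nonneg _) zero_le_one
        _ = M := one_mul M
    have hv : ∃ a, ∫ ω, (Set.indicator {ω' | Y 0 ω' < inner ℝ (X 0 ω') β} 1 ω - q) * Z 0 ω a ∂P
        ≠ 0 := by
      by_contra! hcon
      refine hne ((hid.unique β hβ).1 ?_)
      ext a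
      have h1 := (EuclideanSpace.proj (𝕜 := ℝ) a).integral_comp_comm hint
      have h2 : (∫ ω, (q - Set.indicator {ω' | Y 0 ω' < inner ℝ (X 0 ω') β}
          (1 : Ω → ℝ) ω) • Z 0 ω ∂P) a = ∫ ω, ((q - Set.indicator
            {ω' | Y 0 ω' < inner ℝ (X 0 ω') β} (1 : Ω → ℝ) ω) • Z 0 ω) a ∂P := h1.symm
      rw [h2, PiLp.zero_apply, ← neg_eq_zero, ← integral_neg, ← hcon a]
      refine integral_congr_ae (ae_of_all _ fun ω => ?_)
      simp only [PiLp.smul_apply, smul_eq_mul]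
      ring
    obtain ⟨a, ha⟩ := hv
    have hlim := (tendsto_meanScore_prod hS hI hG hq0 hq1 (hR.no_mass β hβ) a).abs
    have hpos := abs_pos.2 ha
    have hev := hlim.eventually (lt_mem_nhds (half_lt_self hpos))
    obtain ⟨pa, hpa, pb, hpb, hab⟩ := eventually_prod_iff.1 hev
    refine ⟨{β' | pb β'}, mem_nhdsWithin_of_mem_nhds hpb, _, half_pos hpos, ?_⟩
    filter_upwards [hpa] with h hh β' hβ'
    exact ⟨a, (hab hh hβ').le⟩

end Consistency

end SEE

namespace SEE

/-! ### Rates -/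

/-- `n ^ (1 / 26)`, in terms of which all rates below are monomials. -/
def sampleRoot (n : ℕ) : ℝ := (n : ℝ) ^ (1 / 26 : ℝ)

theorem sampleRoot_pow (n : ℕ) : sampleRoot n ^ 26 = n := by
  rw [sampleRoot, ← Real.rpow_natCast, ← Real.rpow_mul (Nat.cast_nonneg n)]
  norm_num

theorem sampleRoot_nonneg (n : ℕ) : 0 ≤ sampleRoot n := Real.rpow_nonneg (Nat.cast_nonneg n) _

theorem sqrt_eq_sampleRoot_pow (n : ℕ) : √(n : ℝ) = sampleRoot n ^ 13 := by
  rw [← sampleRoot_pow, show sampleRoot n ^ 26 = (sampleRoot n ^ 13) ^ 2 by ring,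
    Real.sqrt_sq (pow_nonneg (sampleRoot_nonneg n) 13)]

theorem tendsto_sampleRoot : Tendsto sampleRoot atTop atTop :=
  (tendsto_rpow_atTop (by norm_num)).comp tendsto_natCast_atTop_atTop

section Rates

variable {r : ℕ} {h : ℕ → ℝ}

/-- Since r ≥ 3, 4r + 1 ≥ 13, so h ≤ 1 gives n³h^{13} ≥ 1, that is h ≥ n^{-3/13} = x^{-6}. The root
of order 26 = 2 · 13 makes both this rate and √n = x^{13} integer powers. -/
theorem eventually_one_le_sampleRoot_pow_mul (hr : 2 < r) (h_pos : ∀ n, 0 < h n)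
    (h_zero : Tendsto h atTop (𝓝 0))
    (h_rate : Tendsto (fun n : ℕ => (n : ℝ) ^ 3 * h n ^ (4 * r + 1)) atTop atTop) :
    ∀ᶠ n in atTop, 1 ≤ sampleRoot n ^ 6 * h n := by
  filter_upwards [h_rate.eventually_ge_atTop 1, h_zero.eventually (gt_mem_nhds one_pos)]
    with n h1 h2
  by_contra! hcon
  have hx := sampleRoot_nonneg n
  have h3 : (sampleRoot n ^ 6 * h n) ^ 13 < 1 :=
    pow_lt_one₀ (mul_nonneg (pow_nonneg hx 6) (h_pos n).le) hcon (by norm_num)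
  have h4 : h n ^ (4 * r + 1) ≤ h n ^ 13 :=
    pow_le_pow_of_le_one (h_pos n).le h2.le (by omega)
  have h5 : (n : ℝ) ^ 3 * h n ^ (4 * r + 1) ≤ (n : ℝ) ^ 3 * h n ^ 13 :=
    mul_le_mul_of_nonneg_left h4 (by positivity)
  rw [mul_pow, ← pow_mul, show 6 * 13 = 26 * 3 by norm_num, pow_mul, sampleRoot_pow] at h3
  linarith

theorem tendsto_natCast_mul_bandwidth (hr : 2 < r) (h_pos : ∀ n, 0 < h n)
    (h_zero : Tendsto h atTop (𝓝 0))
    (h_rate : Tendsto (fun n : ℕ => (n : ℝ) * h n ^ r) atTop atTop) :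
    Tendsto (fun n : ℕ => (n : ℝ) * h n) atTop atTop := by
  refine tendsto_atTop_mono' _ ?_ h_rate
  filter_upwards [h_zero.eventually (gt_mem_nhds one_pos)] with n h2
  exact mul_le_mul_of_nonneg_left (pow_le_of_le_one (h_pos n).le h2.le (by omega))
    (Nat.cast_nonneg n)

/-- The localization rate is negligible relative to `h ^ (1 / 2) (h + n h ^ (2 r))`. -/
theorem localization_rate_le {x s y η K : ℝ} (hx : 1 ≤ x) (hs : 0 < s) (hy : 0 ≤ y) (hη : 0 < η)
    (hxs : 1 ≤ x ^ 6 * s ^ 2) (hK : 2 * K ≤ η * x) :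
    x * (K * ((x ^ 12)⁻¹ + y)) ≤ s * (η * (s ^ 2 + x ^ 26 * y ^ 2)) := by
  have hx0 : 0 < x := by linarith
  have h1 : 1 ≤ x ^ 3 * s := by
    by_contra! hcon
    have := pow_lt_one₀ (by positivity) hcon two_ne_zero
    rw [mul_pow, ← pow_mul, show 3 * 2 = 6 by norm_num] at this
    linarith
  have hx12 : 0 < (x ^ 12)⁻¹ := by positivity
  -- In the application s = √h and y = h^r, so this is 2√h · √n h^r ≤ h + nh^{2r}.
  have hamgm : 2 * s * (x ^ 13 * y) ≤ s ^ 2 + x ^ 26 * y ^ 2 := by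
    nlinarith [sq_nonneg (s - x ^ 13 * y)]
  have h2 : x ^ 2 * (x ^ 12)⁻¹ ≤ s * s ^ 2 := by
    have e : x ^ 2 * (x ^ 12)⁻¹ = x ^ 2 * (x ^ 12)⁻¹ * 1 := by ring
    have h3 : 1 ≤ (x ^ 3 * s) * (x ^ 6 * s ^ 2) := one_le_mul_of_one_le_of_one_le h1 hxs
    calc x ^ 2 * (x ^ 12)⁻¹ ≤ x ^ 3 * (x ^ 12)⁻¹ :=
          mul_le_mul_of_nonneg_right (pow_le_pow_right₀ hx (by norm_num)) hx12.le
      _ ≤ x ^ 3 * (x ^ 12)⁻¹ * ((x ^ 3 * s) * (x ^ 6 * s ^ 2)) :=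
          le_mul_of_one_le_right (by positivity) h3
      _ = s * s ^ 2 := by field_simp
  have h4 : x ^ 2 * y ≤ s * (s * (x ^ 13 * y)) := by
    calc x ^ 2 * y ≤ x ^ 7 * y :=
          mul_le_mul_of_nonneg_right (pow_le_pow_right₀ hx (by norm_num)) hy
      _ ≤ x ^ 7 * y * (x ^ 6 * s ^ 2) := le_mul_of_one_le_right (by positivity) hxs
      _ = _ := by ring
  calc x * (K * ((x ^ 12)⁻¹ + y)) = K * (x * ((x ^ 12)⁻¹ + y)) := by ring
    _ ≤ η * x / 2 * (x * ((x ^ 12)⁻¹ + y)) :=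
        mul_le_mul_of_nonneg_right (by linarith) (by positivity)
    _ = η / 2 * (x ^ 2 * (x ^ 12)⁻¹ + x ^ 2 * y) := by ring
    _ ≤ η / 2 * (s * s ^ 2 + s * (s * (x ^ 13 * y))) :=
        mul_le_mul_of_nonneg_left (add_le_add h2 h4) (by positivity)
    _ ≤ η / 2 * (s * (s ^ 2 + x ^ 26 * y ^ 2) + s * (s ^ 2 + x ^ 26 * y ^ 2)) := by
        refine mul_le_mul_of_nonneg_left (add_le_add ?_ ?_) (by positivity)
        · exact mul_le_mul_of_nonneg_left (le_add_of_nonneg_right (by positivity)) hs.le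
        · refine mul_le_mul_of_nonneg_left ?_ hs.le
          have : 0 ≤ s * (x ^ 13 * y) := by positivity
          linarith
    _ = _ := by ring

/-- The squared localization rate is negligible relative to `n ^ (-1 / 2) (h + n h ^ (2 r))`. -/
theorem sq_localization_rate_le {x h y η K : ℝ} (hx : 1 ≤ x) (hh : 0 < h) (hη : 0 < η)
    (hxs : 1 ≤ x ^ 6 * h) (hK : 4 * K ≤ η * x) (hK0 : 0 ≤ K) :
    x ^ 13 * (K * ((x ^ 12)⁻¹ + y) ^ 2) ≤ η * (h + x ^ 26 * y ^ 2) := by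
  have hx0 : 0 < x := by linarith
  have h1 : x ^ 13 * (x * ((x ^ 12)⁻¹ ^ 2)) ≤ h := by
    calc x ^ 13 * (x * ((x ^ 12)⁻¹ ^ 2)) = (x ^ 10)⁻¹ * 1 := by field_simp
      _ ≤ (x ^ 10)⁻¹ * (x ^ 6 * h) := mul_le_mul_of_nonneg_left hxs (by positivity)
      _ ≤ (x ^ 10)⁻¹ * (x ^ 10 * h) := by
          refine mul_le_mul_of_nonneg_left ?_ (by positivity)
          exact mul_le_mul_of_nonneg_right (pow_le_pow_right₀ hx (by norm_num)) hh.le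
      _ = h := by field_simp
  have h2 : x ^ 13 * (x * y ^ 2) ≤ x ^ 26 * y ^ 2 := by
    calc x ^ 13 * (x * y ^ 2) = x ^ 14 * y ^ 2 := by ring
      _ ≤ _ := mul_le_mul_of_nonneg_right (pow_le_pow_right₀ hx (by norm_num)) (sq_nonneg y)
  calc x ^ 13 * (K * ((x ^ 12)⁻¹ + y) ^ 2)
      ≤ x ^ 13 * (K * (2 * ((x ^ 12)⁻¹ ^ 2 + y ^ 2))) := by
        gcongr
        nlinarith [sq_nonneg ((x ^ 12)⁻¹ - y)]
    _ = 2 * K * (x ^ 13 * ((x ^ 12)⁻¹ ^ 2 + y ^ 2)) := by ring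
    _ ≤ η * x / 2 * (x ^ 13 * ((x ^ 12)⁻¹ ^ 2 + y ^ 2)) :=
        mul_le_mul_of_nonneg_right (by linarith) (by positivity)
    _ = η / 2 * (x ^ 13 * (x * ((x ^ 12)⁻¹ ^ 2)) + x ^ 13 * (x * y ^ 2)) := by ring
    _ ≤ η / 2 * (h + x ^ 26 * y ^ 2) :=
        mul_le_mul_of_nonneg_left (add_le_add h1 h2) (by positivity)
    _ ≤ _ := by
        refine mul_le_mul_of_nonneg_right (by linarith) ?_
        positivity

end Rates

/-! ### The remainder of the linearization -/

section Remainder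

variable {Ω : Type*} [MeasurableSpace Ω] {d : ℕ} {P : Measure Ω} [IsProbabilityMeasure P]
  {r : ℕ} {q : ℝ} {X Z : ℕ → Ω → Vec d} {Y : ℕ → Ω → ℝ} {β₀ : Vec d} {G : ℝ → ℝ}
  {f : Vec d → ℝ → ℝ} {g : Vec d × Vec d → ℝ → ℝ} {C : Vec d × Vec d → ℝ} {𝓑 : Set (Vec d)}
  {h : ℕ → ℝ}

theorem norm_le_sum_abs (v : Vec d) : ‖v‖ ≤ ∑ a, |v a| := by
  rw [EuclideanSpace.norm_eq]
  refine Real.sqrt_le_iff.2 ⟨Finset.sum_nonneg fun _ _ => abs_nonneg _, ?_⟩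
  simp only [Real.norm_eq_abs]
  exact Finset.sum_sq_le_sq_sum_of_nonneg fun _ _ => abs_nonneg _

/-- The entries of the inverse Jacobians converge, hence are eventually bounded. The added 1 keeps κ
positive when d = 0. -/
theorem exists_norm_le_of_meanJacobian (hS : Sampling P q X Z Y β₀) (hG : SmoothingFunction r G)
    (hL : CondLawGivenZX P r X Z Y β₀ g C) (h_pos : ∀ n, 0 < h n)
    (h_zero : Tendsto h atTop (𝓝 0)) :
    ∃ κ : ℝ, 0 < κ ∧ ∀ᶠ n in atTop, ∀ (v : Vec d) (u : ℝ), 0 ≤ u →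
      (∀ a, |(meanJacobian P q G X Z Y β₀ n (h n) *ᵥ v.ofLp) a| ≤ u) → ‖v‖ ≤ κ * u := by
  set k : Fin d → Fin d → ℝ := fun b a => |(sigmaZX P X Z g)⁻¹ b a| + 1 with hk
  have hk0 : ∀ b a, 0 ≤ k b a := fun b a => by positivity
  have hev : ∀ᶠ n in atTop, ∀ b a, |(meanJacobian P q G X Z Y β₀ n (h n))⁻¹ b a| ≤ k b a := by
    rw [eventually_all]; intro b
    rw [eventually_all]; intro a
    exact (tendsto_meanJacobian_inv hS hG hL h_pos h_zero b a).abs.eventually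
      (ge_mem_nhds (lt_add_one _))
  refine ⟨1 + ∑ b, ∑ a, k b a, ?_, ?_⟩
  · have : 0 ≤ ∑ b, ∑ a, k b a :=
      Finset.sum_nonneg fun b _ => Finset.sum_nonneg fun a _ => hk0 b a
    linarith
  filter_upwards [hev, eventually_isUnit_meanJacobian (q := q) hS hG hL h_pos h_zero]
    with n hn hu v u hu0 hv
  refine (norm_le_sum_abs v).trans ?_
  have h1 : ∀ b, |v b| ≤ (∑ a, k b a) * u := fun b => by
    have e : v b = ((meanJacobian P q G X Z Y β₀ n (h n))⁻¹ *ᵥ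
        (meanJacobian P q G X Z Y β₀ n (h n) *ᵥ v.ofLp)) b := by
      rw [Matrix.mulVec_mulVec, Matrix.nonsing_inv_mul _ hu, Matrix.one_mulVec]
    rw [e, Matrix.mulVec, dotProduct, Finset.sum_mul]
    refine (Finset.abs_sum_le_sum_abs _ _).trans (Finset.sum_le_sum fun a _ => ?_)
    rw [abs_mul]
    exact mul_le_mul (hn b a) (hv a) (abs_nonneg _) (hk0 b a)
  calc ∑ a, |v a| ≤ ∑ b, (∑ a, k b a) * u := Finset.sum_le_sum fun b _ => h1 b
    _ = (∑ b, ∑ a, k b a) * u := by rw [Finset.sum_mul]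
    _ ≤ _ := mul_le_mul_of_nonneg_right (by linarith) hu0

theorem exists_abs_meanScore_le (hS : Sampling P q X Z Y β₀) (hI : Instruments P Z)
    (hG : SmoothingFunction r G) (hLZ : CondLawGivenZ P q r X Z Y β₀ f) (hr : 2 < r)
    (hq0 : 0 < q) {S : Matrix (Fin d) (Fin d) ℝ} (hSu : IsUnit S.det) (h_pos : ∀ n, 0 < h n)
    (h_zero : Tendsto h atTop (𝓝 0)) :
    ∃ K : ℝ, 0 ≤ K ∧ ∀ᶠ n in atTop, ∀ a,
      |meanScore P q G X Z Y (h n) β₀ a| ≤ K * h n ^ r := by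
  have hh : Tendsto h atTop (𝓝[>] 0) :=
    tendsto_nhdsWithin_iff.2 ⟨h_zero, Eventually.of_forall h_pos⟩
  set k : Fin d → ℝ := fun a => |(-1) ^ r * (S *ᵥ meanB P r G Z f S) a| + 1 with hk
  have hk0 : ∀ a, 0 ≤ k a := fun a => by positivity
  refine ⟨∑ a, k a, Finset.sum_nonneg fun a _ => hk0 a, ?_⟩
  rw [eventually_all]
  intro a
  have h1 := ((tendsto_meanScore hS hI hG hLZ hr hq0 hSu a).comp hh).abs.eventually
    (ge_mem_nhds (lt_add_one _))
  filter_upwards [h1] with n hn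
  have h2 := pow_pos (h_pos n) r
  simp only [Function.comp_apply] at hn
  rw [abs_mul, abs_inv, abs_of_pos h2, inv_mul_le_iff₀ h2, mul_comm] at hn
  refine hn.trans (mul_le_mul_of_nonneg_right ?_ h2.le)
  exact Finset.single_le_sum (f := k) (fun a _ => hk0 a) (Finset.mem_univ a)

/-- The scores are uniformly close to their means over balls. -/
theorem tendsto_measure_score_deviation (hS : Sampling P q X Z Y β₀) (hI : Instruments P Z)
    (hG : SmoothingFunction r G) (hq0 : 0 < q) (hq1 : q < 1)
    (hR : RemainderRegularity P X Z Y 𝓑 C) (h_pos : ∀ n, 0 < h n)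
    (hnh : Tendsto (fun n : ℕ => (n : ℝ) * h n) atTop atTop) {R : ℝ} (hR1 : 1 ≤ R) (a : Fin d) :
    Tendsto (fun n => P {ω | ∃ β, ‖β - β₀‖ ≤ R ∧
      sampleRoot n ^ 14 < |∑ j ∈ Finset.range n, (score q G (h n) β a (X j ω, Z j ω, Y j ω)
        - meanScore P q G X Z Y (h n) β a)|}) atTop (𝓝 0) := by
  obtain ⟨b, hb1, hb⟩ := exists_score_bound hS hI hG hq0 hq1
  obtain ⟨L, hL0, hL⟩ := exists_score_lipschitz hS hI hG
  -- With l = n^{-1/2} = x^{-13}, n l² b² = b² and l t = x for t = x^{14}. Divided by n = x^{26},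
  -- the deviation of the averages is x^{-12}.
  refine tendsto_measure_uniform_deviation hS (integrable_norm_X hS hR)
    (w := fun n β => score q G (h n) β a) (fun n β => measurable_score hG q (h n) β a)
    (ρ := fun _ => R) (s2 := fun _ => b ^ 2) (l := fun n => (sampleRoot n ^ 13)⁻¹)
    (t := fun n => sampleRoot n ^ 14) (K := b ^ 2) (κ := 1 / 26) (R := R) hb1 (by norm_num) hL0 β₀
    ?_ ?_ h_pos hnh (Eventually.of_forall fun _ => le_rfl) ?_ ?_ ?_ ?_ ?_ ?_
  · filter_upwards [hb] with ω hω n β j using hω j (h n) β a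
  · filter_upwards [hL] with ω hω n β γ j using hω j (h n) (h_pos n) β γ a
  · filter_upwards [eventually_ge_atTop 1] with n hn
    refine (inv_le_one_of_one_le₀ ?_).trans hR1
    exact_mod_cast hn
  · refine Eventually.of_forall fun n β _ => ?_
    have := norm_integral_le_of_norm_le_const (μ := P) (C := b ^ 2)
      (f := fun ω => score q G (h n) β a (X 0 ω, Z 0 ω, Y 0 ω) ^ 2) (by
        filter_upwards [hb] with ω hω
        rw [norm_pow]
        exact pow_le_pow_left₀ (norm_nonneg _) (hω 0 (h n) β a) 2)
    simpa using (le_abs_self _).trans this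
  · exact fun n => inv_nonneg.2 (pow_nonneg (sampleRoot_nonneg n) 13)
  · filter_upwards [tendsto_sampleRoot.eventually_ge_atTop (2 * b)] with n hn
    have hx : 1 ≤ sampleRoot n := by linarith
    rw [inv_mul_le_iff₀ (by positivity), mul_one]
    exact hn.trans (le_self_pow₀ hx (by norm_num))
  · filter_upwards [tendsto_sampleRoot.eventually_ge_atTop 1] with n hx
    have h0 : 0 < sampleRoot n := by linarith
    rw [← sampleRoot_pow]
    refine le_of_eq ?_
    field_simp
  · filter_upwards [tendsto_sampleRoot.eventually_ge_atTop 1] with n hx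
    have h0 : 0 < sampleRoot n := by linarith
    refine le_of_eq ?_
    change sampleRoot n = _
    field_simp

/-- The increments of the scores are uniformly close to their means over shrinking balls. -/
theorem tendsto_measure_increment_deviation (hS : Sampling P q X Z Y β₀) (hI : Instruments P Z)
    (hG : SmoothingFunction r G) (hq0 : 0 < q) (hq1 : q < 1)
    (hL : CondLawGivenZX P r X Z Y β₀ g C)
    (hR : RemainderRegularity P X Z Y 𝓑 C) (h_pos : ∀ n, 0 < h n)
    (h_zero : Tendsto h atTop (𝓝 0))
    (hnh : Tendsto (fun n : ℕ => (n : ℝ) * h n) atTop atTop)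
    (hxh : ∀ᶠ n in atTop, 1 ≤ sampleRoot n ^ 6 * h n) {K₁ η : ℝ} (hK₁ : 1 ≤ K₁) (hη : 0 < η)
    (a : Fin d) :
    Tendsto (fun n => P {ω | ∃ β, ‖β - β₀‖ ≤ K₁ * ((sampleRoot n ^ 12)⁻¹ + h n ^ r) ∧
      sampleRoot n ^ 13 * (η * (h n + (n : ℝ) * h n ^ (2 * r)))
        < |∑ j ∈ Finset.range n, (score q G (h n) β a (X j ω, Z j ω, Y j ω)
          - score q G (h n) β₀ a (X j ω, Z j ω, Y j ω)
          - (meanScore P q G X Z Y (h n) β a - meanScore P q G X Z Y (h n) β₀ a))|})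
      atTop (𝓝 0) := by
  obtain ⟨b, hb1, hb⟩ := exists_score_bound hS hI hG hq0 hq1
  obtain ⟨L, hL0, hLip⟩ := exists_score_lipschitz hS hI hG
  obtain ⟨ε, hε, K, hK1, hK⟩ := exists_increment_bounds hS hI hG hq0 hq1 hL hR
  have hlarge := tendsto_sampleRoot.eventually_ge_atTop
  have hρ0 : ∀ n, 1 ≤ sampleRoot n →
      (sampleRoot n ^ 12)⁻¹ ≤ K₁ * ((sampleRoot n ^ 12)⁻¹ + h n ^ r) := fun n hx => by
    have h1 := pow_pos (h_pos n) r
    have h2 : 0 < (sampleRoot n ^ 12)⁻¹ := by positivity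
    calc (sampleRoot n ^ 12)⁻¹ ≤ 1 * ((sampleRoot n ^ 12)⁻¹ + h n ^ r) := by linarith
      _ ≤ _ := mul_le_mul_of_nonneg_right hK₁ (by positivity)
  have hms : ∀ n β, ∫ ω', (score q G (h n) β a (X 0 ω', Z 0 ω', Y 0 ω')
      - score q G (h n) β₀ a (X 0 ω', Z 0 ω', Y 0 ω')) ∂P
      = meanScore P q G X Z Y (h n) β a - meanScore P q G X Z Y (h n) β₀ a := fun n β =>
    integral_sub (integrable_score hS hI hG hq0 hq1 0 (h n) β a)
      (integrable_score hS hI hG hq0 hq1 0 (h n) β₀ a)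
  simp_rw [← hms]
  -- With ρ the radius, the second moment on the doubled ball is at most K(2ρ)²/h, and l = √h/(√n ρ)
  -- makes n l² s2 equal to 4K. The condition l t ≥ x then reads x ρ ≤ √h η (h + nh^{2r}), which is
  -- `localization_rate_le`.
  refine tendsto_measure_uniform_deviation hS (integrable_norm_X hS hR)
    (w := fun n β x => score q G (h n) β a x - score q G (h n) β₀ a x)
    (fun n β => (measurable_score hG q (h n) β a).sub (measurable_score hG q (h n) β₀ a))
    (ρ := fun n => K₁ * ((sampleRoot n ^ 12)⁻¹ + h n ^ r))
    (s2 := fun n => K * ((2 * (K₁ * ((sampleRoot n ^ 12)⁻¹ + h n ^ r))) ^ 2 / h n))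
    (l := fun n => √(h n) / (sampleRoot n ^ 13 * (K₁ * ((sampleRoot n ^ 12)⁻¹ + h n ^ r))))
    (t := fun n => sampleRoot n ^ 13 * (η * (h n + (n : ℝ) * h n ^ (2 * r))))
    (b := 2 * b) (K := 4 * K) (κ := 1 / 26) (R := K₁ * (1 + 1)) (by linarith) (by norm_num) hL0 β₀
    ?_ ?_ h_pos hnh ?_ ?_ ?_ ?_ ?_ ?_ ?_
  · filter_upwards [hb] with ω hω n β j
    exact (abs_sub _ _).trans (by linarith [hω j (h n) β a, hω j (h n) β₀ a])
  · filter_upwards [hLip] with ω hω n β γ j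
    rw [sub_sub_sub_cancel_right]
    exact hω j (h n) (h_pos n) β γ a
  · filter_upwards [hlarge 1, h_zero.eventually (gt_mem_nhds one_pos)] with n hx hh
    refine mul_le_mul_of_nonneg_left (add_le_add ?_ ?_) (by linarith)
    · exact inv_le_one_of_one_le₀ (one_le_pow₀ hx)
    · exact pow_le_one₀ (h_pos n).le hh.le
  · filter_upwards [hlarge 1] with n hx
    refine le_trans ?_ (hρ0 n hx)
    rw [← sampleRoot_pow]
    exact inv_anti₀ (by positivity) (pow_le_pow_right₀ hx (by norm_num))
  · filter_upwards [h_zero.eventually (gt_mem_nhds hε)] with n hn β hβ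
    have h1 := (hK (h n) (h_pos n) hn (β - β₀) a).2
    rw [add_sub_cancel] at h1
    refine h1.trans (mul_le_mul_of_nonneg_left ?_ (by linarith))
    exact div_le_div_of_nonneg_right (pow_le_pow_left₀ (norm_nonneg _) hβ 2) (h_pos n).le
  · intro n
    have h1 := pow_pos (h_pos n) r
    have h2 := sampleRoot_nonneg n
    positivity
  · filter_upwards [hlarge (2 * (2 * b)), h_zero.eventually (gt_mem_nhds one_pos)] with n hx hh
    have hx1 : 1 ≤ sampleRoot n := by linarith
    have h1 := hρ0 n hx1
    have h2 : 0 < (sampleRoot n ^ 12)⁻¹ := by positivity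
    have h3 : sampleRoot n ≤ sampleRoot n ^ 13 * (K₁ * ((sampleRoot n ^ 12)⁻¹ + h n ^ r)) := by
      calc sampleRoot n = sampleRoot n ^ 13 * (sampleRoot n ^ 12)⁻¹ := by field_simp
        _ ≤ _ := mul_le_mul_of_nonneg_left h1 (by positivity)
    rw [div_mul_eq_mul_div, div_le_one (by linarith)]
    have h4 : √(h n) ≤ 1 := Real.sqrt_le_one.2 hh.le
    calc √(h n) * (2 * (2 * b)) ≤ 1 * (2 * (2 * b)) :=
          mul_le_mul_of_nonneg_right h4 (by linarith)
      _ ≤ _ := by linarith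
  · filter_upwards [hlarge 1] with n hx
    have h1 := hρ0 n hx
    have h2 : 0 < (sampleRoot n ^ 12)⁻¹ := by positivity
    have h3 := h_pos n
    set ρ := K₁ * ((sampleRoot n ^ 12)⁻¹ + h n ^ r) with hρ
    have h4 : 0 < ρ := by linarith
    have h5 : 0 < sampleRoot n := by linarith
    refine le_of_eq ?_
    rw [div_pow, Real.sq_sqrt h3.le, ← sampleRoot_pow]
    field_simp
    ring
  · filter_upwards [hlarge 1, hlarge (2 * K₁ / η), hxh] with n hx hx2 hxn
    have h1 := hρ0 n hx
    have h2 : 0 < (sampleRoot n ^ 12)⁻¹ := by positivity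
    have h3 := h_pos n
    have h5 : 0 < sampleRoot n := by linarith
    have h6 := localization_rate_le (x := sampleRoot n) (s := √(h n)) (y := h n ^ r) (η := η)
      (K := K₁) hx (Real.sqrt_pos.2 h3) (pow_pos h3 r).le hη (by rwa [Real.sq_sqrt h3.le])
      (by rwa [div_le_iff₀ hη, mul_comm _ η] at hx2)
    rw [Real.sq_sqrt h3.le, sampleRoot_pow, ← pow_mul, mul_comm r 2] at h6
    set ρ := K₁ * ((sampleRoot n ^ 12)⁻¹ + h n ^ r) with hρ
    have h4 : 0 < ρ := by linarith
    change sampleRoot n ≤ _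
    rw [div_mul_eq_mul_div, le_div_iff₀ (by positivity)]
    calc sampleRoot n * (sampleRoot n ^ 13 * ρ) = sampleRoot n ^ 13 * (sampleRoot n * ρ) := by ring
      _ ≤ sampleRoot n ^ 13 * (√(h n) * (η * (h n + (n : ℝ) * h n ^ (2 * r)))) :=
          mul_le_mul_of_nonneg_left h6 (by positivity)
      _ = _ := by ring

end Remainder

end SEE

namespace SEE

/-! ### Localization of the estimator and the remainder bound -/

section Linearization

variable {Ω : Type*} [MeasurableSpace Ω] {d : ℕ} {P : Measure Ω}
  {r : ℕ} {q : ℝ} {X Z : ℕ → Ω → Vec d} {Y : ℕ → Ω → ℝ} {β₀ : Vec d} {G : ℝ → ℝ}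
  {f : Vec d → ℝ → ℝ} {g : Vec d × Vec d → ℝ → ℝ} {C : Vec d × Vec d → ℝ} {𝓑 : Set (Vec d)}
  {h : ℕ → ℝ}

/-- As J L_n = -m_n(β₀), applying J to the remainder removes the inverse and leaves quantities that
the deviation bounds control. -/
theorem meanJacobian_mulVec_linearization {n : ℕ} {b : ℝ}
    (hu : IsUnit (meanJacobian P q G X Z Y β₀ n b).det) (Δ : Vec d) (ω : Ω) (a : Fin d) :
    (meanJacobian P q G X Z Y β₀ n b *ᵥ
        (√(n : ℝ) • Δ - leadingTerm P q G X Z Y β₀ n b ω).ofLp) a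
      = √(n : ℝ) * (meanJacobian P q G X Z Y β₀ n b *ᵥ Δ.ofLp) a
        + (√(n : ℝ))⁻¹ * ∑ j ∈ Finset.range n, score q G b β₀ a (X j ω, Z j ω, Y j ω) := by
  rw [← ee_apply, WithLp.ofLp_sub, WithLp.ofLp_smul, leadingTerm, Matrix.mulVec_sub,
    Matrix.mulVec_smul, Matrix.mulVec_neg, Matrix.mulVec_mulVec, Matrix.mul_nonsing_inv _ hu,
    Matrix.one_mulVec, sub_neg_eq_add]
  rfl

variable [IsProbabilityMeasure P]

/-- The part of `√n (β̂ - β₀)` beyond the leading term is `o_p(h + n h ^ (2 r))`. -/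
theorem isLittleOP_sub_leadingTerm (hq0 : 0 < q) (hq1 : q < 1) (hS : Sampling P q X Z Y β₀)
    (hI : Instruments P Z) (hLZ : CondLawGivenZ P q r X Z Y β₀ f) (hG : SmoothingFunction r G)
    (hid : Identification P q X Z Y β₀ 𝓑) (hL : CondLawGivenZX P r X Z Y β₀ g C)
    (h_pos : ∀ n, 0 < h n) (h_zero : Tendsto h atTop (𝓝 0))
    (h_rate₁ : Tendsto (fun n : ℕ => (n : ℝ) * h n ^ r) atTop atTop)
    (h_rate₂ : Tendsto (fun n : ℕ => (n : ℝ) ^ 3 * h n ^ (4 * r + 1)) atTop atTop)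
    {S : Matrix (Fin d) (Fin d) ℝ} (hSV : S * Sᵀ = asympVar P q Z)
    (hR : RemainderRegularity P X Z Y 𝓑 C) {βhat : ℕ → Ω → Vec d}
    (hβ : IsSEEEstimator P q G X Z Y h 𝓑 βhat) :
    IsLittleOP P (fun n ω => √(n : ℝ) • (βhat n ω - β₀) - leadingTerm P q G X Z Y β₀ n (h n) ω)
      (fun n : ℕ => h n + (n : ℝ) * h n ^ (2 * r)) := by
  intro η hη
  have hr := hL.order
  have hh : Tendsto h atTop (𝓝[>] 0) :=
    tendsto_nhdsWithin_iff.2 ⟨h_zero, Eventually.of_forall h_pos⟩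
  have hnh := tendsto_natCast_mul_bandwidth hr h_pos h_zero h_rate₁
  have hxh := eventually_one_le_sampleRoot_pow_mul hr h_pos h_zero h_rate₂
  obtain ⟨κ, hκ, hinv⟩ := exists_norm_le_of_meanJacobian (q := q) hS hG hL h_pos h_zero
  obtain ⟨K₀, hK₀, hmean⟩ := exists_abs_meanScore_le hS hI hG hLZ hr hq0
    (isUnit_det_sqrt hI hq0 hq1 hSV) h_pos h_zero
  obtain ⟨ε, hε, K, hK1, hK⟩ := exists_increment_bounds hS hI hG hq0 hq1 hL hR
  obtain ⟨ε', hε', hJ⟩ := exists_jacobian_eq hS hG hL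
  obtain ⟨R, hR1, hRB⟩ : ∃ R : ℝ, 1 ≤ R ∧ ∀ β ∈ 𝓑, ‖β - β₀‖ ≤ R := by
    obtain ⟨R, hR'⟩ := hR.compact.isBounded.subset_closedBall β₀
    refine ⟨max R 1, le_max_right _ _, fun β hβ => ?_⟩
    have := hR' hβ
    rw [Metric.mem_closedBall, dist_eq_norm] at this
    exact this.trans (le_max_left _ _)
  -- Within this radius the quadratic error satisfies κK‖Δ‖² ≤ ‖Δ‖/2 and can be absorbed on the
  -- left.
  have hρ₀ : 0 < 1 / (2 * κ * K) := by positivity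
  obtain ⟨c, hc, hfar⟩ := exists_le_meanScore hS hI hG hq0 hq1 hid hR hρ₀
  set K₁ := 2 * κ * (1 + K₀) + 1 with hK₁
  have hK₁1 : 1 ≤ K₁ := by rw [hK₁]; linarith [show 0 ≤ 2 * κ * (1 + K₀) by positivity]
  -- The curvature and the fluctuation each contribute η'δ, and inverting J costs κ, so 2κη' = η.
  set η' := η / (2 * κ) with hη'
  have hη'0 : 0 < η' := by positivity
  have h1 := fun a => tendsto_measure_score_deviation hS hI hG hq0 hq1 hR h_pos hnh hR1 a
  have h2 := fun a => tendsto_measure_increment_deviation hS hI hG hq0 hq1 hL hR h_pos h_zero hnh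
    hxh hK₁1 hη'0 a
  have h3 := (hβ.add (tendsto_finsetSum Finset.univ fun a _ => h1 a)).add
    (tendsto_finsetSum Finset.univ fun a _ => h2 a)
  simp only [Finset.sum_const_zero, add_zero] at h3
  refine tendsto_of_tendsto_of_tendsto_of_le_of_le' tendsto_const_nhds h3
    (Eventually.of_forall fun _ => zero_le) ?_
  have hlarge := tendsto_sampleRoot.eventually_ge_atTop
  filter_upwards [hlarge 1, tendsto_sampleRoot.eventually_gt_atTop c⁻¹,
    hlarge (4 * (K * K₁ ^ 2) / η'), hxh, hinv, hmean, h_zero.eventually (gt_mem_nhds hε),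
    h_zero.eventually (gt_mem_nhds hε'), hh.eventually hfar, eventually_ne_atTop 0,
    eventually_isUnit_meanJacobian (q := q) hS hG hL h_pos h_zero]
    with n hx hxc hxη hxn hinv hmean hnε hnε' hfar hn hunit
  -- Three bad events: β̂ is not a root in 𝓑, the scores deviate on the fixed ball, or their
  -- increments deviate on the shrinking ball. Only monotonicity and subadditivity are used, so β̂
  -- need not be measurable.
  refine (measure_mono (t := _ ∪ (⋃ a, _) ∪ ⋃ a, _) ?_).trans
    ((measure_union_le _ _).trans (add_le_add ((measure_union_le _ _).trans
      (add_le_add le_rfl (measure_iUnion_fintype_le _ _))) (measure_iUnion_fintype_le _ _)))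
  intro ω hω
  by_contra hcon
  simp only [Set.mem_union, Set.mem_iUnion, Set.mem_ofPred_eq, not_or, not_exists,
    not_and, not_lt, Classical.not_imp, not_not] at hcon
  obtain ⟨⟨⟨hmem, hee⟩, hdev1⟩, hdev2⟩ := hcon
  rw [Set.mem_ofPred_eq] at hω
  set x := sampleRoot n with hxdef
  have hx0 : 0 < x := by linarith
  have hnx : (n : ℝ) = x ^ 26 := (sampleRoot_pow n).symm
  have hsq : √(n : ℝ) = x ^ 13 := sqrt_eq_sampleRoot_pow n
  have hh0 := h_pos n
  set y := h n ^ r with hy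
  have hy0 : 0 < y := pow_pos hh0 r
  have hx12 : 0 < (x ^ 12)⁻¹ := by positivity
  set Δ := βhat n ω - β₀ with hΔ
  have hΔβ : β₀ + Δ = βhat n ω := add_sub_cancel _ _
  have hsum : ∀ a, ∑ j ∈ Finset.range n, score q G (h n) (βhat n ω) a (X j ω, Z j ω, Y j ω) = 0 :=
    fun a => by
      have e := congrArg (fun v : Vec d => v a) hee
      simp only [ee_apply, PiLp.zero_apply] at e
      refine (mul_eq_zero.1 e).resolve_left ?_
      rw [hsq]; positivity
  -- The empirical score vanishes at β̂, so the mean score there is at most the uniform deviation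
  -- x^{14}/x^{26}.
  have hMhat : ∀ a, |meanScore P q G X Z Y (h n) (βhat n ω) a| ≤ (x ^ 12)⁻¹ := fun a => by
    have e := hdev1 a (βhat n ω) (hRB _ hmem)
    rw [Finset.sum_sub_distrib, hsum a, zero_sub, abs_neg, Finset.sum_const, Finset.card_range,
      nsmul_eq_mul, hnx, abs_mul, abs_of_pos (by positivity)] at e
    refine le_of_mul_le_mul_left (e.trans (le_of_eq ?_)) (show 0 < x ^ 26 by positivity)
    field_simp
  -- Consistency: farther away some coordinate of the mean score would be at least c, which exceeds
  -- x^{-12}.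
  have hnear : ‖Δ‖ ≤ 1 / (2 * κ * K) := by
    by_contra! hcon
    obtain ⟨a, ha⟩ := hfar _ hmem hcon.le
    have e1 : (x ^ 12)⁻¹ ≤ x⁻¹ := inv_anti₀ hx0 (le_self_pow₀ hx (by norm_num))
    have e2 : x⁻¹ < c := inv_lt_of_inv_lt₀ hc hxc
    linarith [hMhat a]
  have hbias : ∀ a, |meanScore P q G X Z Y (h n) (βhat n ω) a
      - meanScore P q G X Z Y (h n) β₀ a
      - (meanJacobian P q G X Z Y β₀ n (h n) *ᵥ Δ.ofLp) a| ≤ K * ‖Δ‖ ^ 2 := fun a => by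
    have e := (hK (h n) hh0 hnε Δ a).1
    rw [hΔβ] at e
    simp_rw [← fun b => (hJ n hn (h n) hh0 hnε' a b).2] at e
    exact e
  have hΔ0 := norm_nonneg Δ
  -- Inverting the linearized mean score gives ‖Δ‖ ≤ κ(x^{-12} + K₀h^r + K‖Δ‖²); absorbing the
  -- quadratic term doubles the constant, whence K₁.
  have hlocal : ‖Δ‖ ≤ K₁ * ((x ^ 12)⁻¹ + y) := by
    have e1 := hinv Δ ((x ^ 12)⁻¹ + K₀ * y + K * ‖Δ‖ ^ 2) (by positivity) fun a => by
      have b1 := abs_le.1 (hbias a)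
      have b2 := abs_le.1 (hMhat a)
      have b3 := abs_le.1 (hmean a)
      exact abs_le.2 ⟨by linarith, by linarith⟩
    have e2 : κ * (K * ‖Δ‖ ^ 2) ≤ ‖Δ‖ / 2 := by
      have e3 : κ * K * ‖Δ‖ ≤ 1 / 2 := by
        rw [le_div_iff₀ (by positivity)] at hnear
        linarith
      calc κ * (K * ‖Δ‖ ^ 2) = (κ * K * ‖Δ‖) * ‖Δ‖ := by ring
        _ ≤ 1 / 2 * ‖Δ‖ := mul_le_mul_of_nonneg_right e3 hΔ0
        _ = _ := by ring
    have e4 : 0 ≤ κ * K₀ * (x ^ 12)⁻¹ := by positivity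
    have e5 : 0 ≤ κ * y := by positivity
    rw [hK₁]
    nlinarith
  have hquad : x ^ 13 * (K * ‖Δ‖ ^ 2) ≤ η' * (h n + n * h n ^ (2 * r)) := by
    have e := sq_localization_rate_le (x := x) (h := h n) (y := y) (η := η') (K := K * K₁ ^ 2)
      hx hh0 hη'0 hxn (by rwa [div_le_iff₀ hη'0, mul_comm _ η'] at hxη) (by positivity)
    rw [← hnx, hy, ← pow_mul, mul_comm r 2] at e
    refine le_trans (mul_le_mul_of_nonneg_left ?_ (by positivity)) e
    rw [mul_assoc, ← mul_pow]
    exact mul_le_mul_of_nonneg_left (pow_le_pow_left₀ hΔ0 hlocal 2) (by linarith)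
  set δ := h n + (n : ℝ) * h n ^ (2 * r) with hδ
  have hδ0 : 0 ≤ η' * δ := by positivity
  -- J applied to the remainder is minus the scaled centred increment minus √n times the
  -- linearization error of the mean score; multiplying by √n = x^{13} clears the normalization.
  have hfinal := hinv (√(n : ℝ) • Δ - leadingTerm P q G X Z Y β₀ n (h n) ω) (2 * (η' * δ))
    (by positivity) fun a => by
      rw [meanJacobian_mulVec_linearization hunit, hsq]
      have e1 := abs_le.1 (hdev2 a (βhat n ω) hlocal)
      rw [Finset.sum_sub_distrib, Finset.sum_sub_distrib, hsum a, Finset.sum_const,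
        Finset.card_range, nsmul_eq_mul, hnx] at e1
      have e2 := abs_le.1 (hbias a)
      have e3 : x ^ 26 * (K * ‖Δ‖ ^ 2) ≤ x ^ 13 * (η' * δ) := by
        calc x ^ 26 * (K * ‖Δ‖ ^ 2) = x ^ 13 * (x ^ 13 * (K * ‖Δ‖ ^ 2)) := by ring
          _ ≤ _ := mul_le_mul_of_nonneg_left hquad (by positivity)
      have hx26 : 0 < x ^ 26 := by positivity
      have e4 := mul_le_mul_of_nonneg_left e2.1 hx26.le
      have e5 := mul_le_mul_of_nonneg_left e2.2 hx26.le
      have hx13 : 0 < x ^ 13 := by positivity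
      set s := ∑ j ∈ Finset.range n, score q G (h n) β₀ a (X j ω, Z j ω, Y j ω) with hs
      have e6 : x ^ 13 * (x ^ 13 * (meanJacobian P q G X Z Y β₀ n (h n) *ᵥ Δ.ofLp) a
          + (x ^ 13)⁻¹ * s)
          = x ^ 26 * (meanJacobian P q G X Z Y β₀ n (h n) *ᵥ Δ.ofLp) a + s := by
        field_simp
      refine abs_le.2 ⟨le_of_mul_le_mul_left ?_ hx13, le_of_mul_le_mul_left ?_ hx13⟩
      · rw [e6]; linarith
      · rw [e6]; linarith
  have : κ * (2 * (η' * δ)) = η * δ := by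
    rw [hη']; field_simp
  linarith

end Linearization

end SEE

end

/-! ### The theorem -/

theorem theorem4 {Ω : Type*} [MeasurableSpace Ω] (P : Measure Ω) [IsProbabilityMeasure P]
    {d r : ℕ} (q : ℝ) (hq0 : 0 < q) (hq1 : q < 1)
    (X Z : ℕ → Ω → SEE.Vec d) (Y : ℕ → Ω → ℝ) (β₀ : SEE.Vec d) (𝓑 : Set (SEE.Vec d))
    (G : ℝ → ℝ) (f : SEE.Vec d → ℝ → ℝ) (g : SEE.Vec d × SEE.Vec d → ℝ → ℝ)
    (C : SEE.Vec d × SEE.Vec d → ℝ)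
    (h_sampling : SEE.Sampling P q X Z Y β₀)
    (h_instr : SEE.Instruments P Z)
    (h_lawZ : SEE.CondLawGivenZ P q r X Z Y β₀ f)
    (h_G : SEE.SmoothingFunction r G)
    (h_ident : SEE.Identification P q X Z Y β₀ 𝓑)
    (h_lawZX : SEE.CondLawGivenZX P r X Z Y β₀ g C)
    (h : ℕ → ℝ) (h_pos : ∀ n, 0 < h n) (h_zero : Tendsto h atTop (𝓝 0))
    (h_rate₁ : Tendsto (fun n : ℕ => (n : ℝ) * h n ^ r) atTop atTop)
    (h_rate₂ : Tendsto (fun n : ℕ => (n : ℝ) ^ 3 * h n ^ (4 * r + 1)) atTop atTop)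
    (S : Matrix (Fin d) (Fin d) ℝ) (hS : S * Sᵀ = SEE.asympVar P q Z) :
    -- the approximate MSE is well defined for all large sample sizes
    (∀ᶠ n in atTop,
      (∀ a b, Integrable (fun ω => SEE.jacobian q G X Z Y β₀ n (h n) ω a b) P) ∧
      IsUnit (SEE.meanJacobian P q G X Z Y β₀ n (h n)).det ∧
      MemLp (SEE.leadingTerm P q G X Z Y β₀ n (h n)) 2 P) ∧
    -- its expansion
    (∃ R₁ R₂ : ℕ → Matrix (Fin d) (Fin d) ℝ,
      (∀ᶠ n : ℕ in atTop, SEE.amse P q G X Z Y β₀ n (h n) =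
        (SEE.sigmaZX P X Z g)⁻¹ * S *
          (1 + ((n : ℝ) * h n ^ (2 * r)) •
              Matrix.vecMulVec (SEE.meanB P r G Z f S) (SEE.meanB P r G Z f S)
            - h n • SEE.meanAA P G Z f S) *
          Sᵀ * ((SEE.sigmaZX P X Z g)ᵀ)⁻¹ + R₁ n + R₂ n) ∧
      (∀ a b, (fun n => R₁ n a b) =O[atTop] fun n => h n ^ r) ∧
      (∀ a b, (fun n => R₂ n a b) =o[atTop]
        fun n : ℕ => h n + (n : ℝ) * h n ^ (2 * r))) ∧
    -- what is dropped from the estimator is of smaller order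
    (SEE.RemainderRegularity P X Z Y 𝓑 C →
      ∀ βhat : ℕ → Ω → SEE.Vec d, SEE.IsSEEEstimator P q G X Z Y h 𝓑 βhat →
        SEE.IsLittleOP P
          (fun n ω => √(n : ℝ) • (βhat n ω - β₀)
            - SEE.leadingTerm P q G X Z Y β₀ n (h n) ω)
          (fun n : ℕ => h n + (n : ℝ) * h n ^ (2 * r))) := by
  refine ⟨?_, SEE.amse_expansion hq0 hq1 h_sampling h_instr h_lawZ h_G h_lawZX h_pos h_zero hS,
    fun hR βhat hβ => SEE.isLittleOP_sub_leadingTerm hq0 hq1 h_sampling h_instr h_lawZ h_G h_ident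
      h_lawZX h_pos h_zero h_rate₁ h_rate₂ hS hR hβ⟩
  obtain ⟨ε, hε, hJ⟩ := SEE.exists_jacobian_eq (q := q) h_sampling h_G h_lawZX
  filter_upwards [SEE.eventually_isUnit_meanJacobian (q := q) h_sampling h_G h_lawZX h_pos h_zero,
    h_zero.eventually (gt_mem_nhds hε), eventually_ne_atTop 0] with n hu hn hn0
  exact ⟨fun a b => (hJ n hn0 (h n) (h_pos n) hn a b).1, hu,
    SEE.memLp_leadingTerm h_sampling h_instr h_G hq0 hq1 n (h n)⟩
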